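/- **Proposition.** Let $(A,[\cdot,\cdot],\sharp)$ be a Lie algebroid (smooth, real, of finite rank) over a smooth manifold $M$ (Hausdorff, second countable, without boundary). Assume that $A$ is regular, i.e. $\sharp:A\to TM$ has constant rank, so that $T\mathcal F:=\operatorname{im}\sharp$ is the tangent bundle of a regular foliation $\mathcal F$ and $K:=\ker\sharp$ is a vector bundle, and assume that $K$ is abelian, i.e. the bracket of any two sections of $K$ vanishes. Then $\nabla_{\sharp X}V:=[X,V]$, for $X\in\Gamma(A)$ and $V\in\Gamma(K)$, is a representation of $T\mathcal F$ on $K$. Let $d_{\mathcal F}$ be the induced differentials on the spaces $\Omega^p(\mathcal F,K)$ of foliated forms with values in $K$ and, using the dual representation, on $\Omega^p(\mathcal F,\wedge^qK^*)$; let $H^p(\mathcal F,K)$ and $H^p(\mathcal F,\wedge^qK^*)$ be their cohomologies. Let $(\Omega^\bullet(A)=\Gamma(\wedge^\bullet A^*),d_A)$ be the de Rham complex of $A$ and $H^\bullet(A)$ its cohomology. For $\gamma\in\Omega^2(\mathcal F,K)$ and $q\ge 1$ define $$i_\gamma:\Omega^p(\mathcal F,\wedge^qK^*)\to\Omega^{p+2}(\mathcal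 F,\wedge^{q-1}K^*),$$ $$i_\gamma(\beta)(Y_1,\dots,Y_{p+2})(V_1,\dots,V_{q-1})=\sum_{i<j}(-1)^{i+j}\beta(Y_1,\dots,\hat Y_i,\dots,\hat Y_j,\dots,Y_{p+2})(\gamma(Y_i,Y_j),V_1,\dots,V_{q-1}),$$ and $i_\gamma=0$ for $q=0$. A splitting is a smooth vector bundle map $\sigma:T\mathcal F\to A$ with $\sharp\circ\sigma=\mathrm{id}$. Splittings exist; for a splitting $\sigma$ put $$\gamma_\sigma(Y_1,Y_2)=[\sigma(Y_1),\sigma(Y_2)]-\sigma([Y_1,Y_2]),\qquad \gamma_\sigma\in\Omega^2(\mathcal F,K).$$ 1. All the differentials above square to zero, and for each splitting $\sigma$ the maps $$a^{p,q}:\Omega^{p+q}(A)\to\Omega^p(\mathcal F,\wedge^qK^*),\quad a^{p,q}(\alpha)(Y_1,\dots,Y_p)(V_1,\dots,V_q)=\alpha(\sigma(Y_1),\dots,\sigma(Y_p),V_1,\dots,V_q),$$ define an isomorphism of complexes $$\bigoplus_{p+q=\bullet}a^{p,q}:(\Omega^\bullet(A),d_A)\xrightarrow{\ \sim\ }\Big(\bigoplus_{p+q=\bullet}\Omega^p(\mathcal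 F,\wedge^qK^*),\ \delta_1+\delta_2\Big),$$ where on $\Omega^p(\mathcal F,\wedge^qK^*)$ one has $\delta_1=d_{\mathcal F}$ and $\delta_2=(-1)^p\,i_{\gamma_\sigma}$; the right-hand side is a complex. 2. The forms $\gamma_\sigma$ are closed, and their class $[\gamma]\in H^2(\mathcal F,K)$, the extension class, does not depend on $\sigma$. 3. For $p\le n$ let $F^p\Omega^n(A)$ be the space of those $\alpha\in\Omega^n(A)$ with $i_{V_0}\cdots i_{V_{n-p}}\alpha=0$ for all $V_0,\dots,V_{n-p}\in\Gamma(K)$ (so $F^p\Omega^n(A)=\Omega^n(A)$ for $p\le0$), and let $F^p\Omega^n(A)=0$ for $p>n$. The filtered complex $(\Omega^\bullet(A),d_A,F)$ has a first quadrant spectral sequence $$E_r^{p,q}=\frac{Z_r^{p,q}}{Z_{r-1}^{p+1,q-1}+d_AZ_{r-1}^{p-r+1,q+r-2}},\qquad Z_r^{p,q}=\{\alpha\in F^p\Omega^{p+q}(A): d_A\alpha\in F^{p+r}\Omega^{p+q+1}(A)\},\qquad r\ge2,$$ with differentials $d_r:E_r^{p,q}\to E_r^{p+r,q-r+1}$ induced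 by $d_A$. There are isomorphisms $E_2^{p,q}\cong H^p(\mathcal F,\wedge^qK^*)$ which, for every splitting, send the class of $\alpha\in Z_2^{p,q}$ to the class of $a^{p,q}(\alpha)$. The spectral sequence converges to $H^\bullet(A)$, $$E_2^{p,q}\cong H^p(\mathcal F,\wedge^qK^*)\Rightarrow H^{p+q}(A),$$ that is: with $F^pH^n(A)\subseteq H^n(A)$ the space of classes with a representative in $F^p\Omega^n(A)$, one has $H^n(A)=F^0H^n(A)\supseteq F^1H^n(A)\supseteq\dots\supseteq F^{n+1}H^n(A)=0$, and for all $r\ge 2$ with $r>p$ and $r>q+1$, every $\alpha\in Z_r^{p,q}$ is $d_A$-closed and sending its class in $E_r^{p,q}$ to that of $[\alpha]$ gives an isomorphism $E_r^{p,q}\cong F^pH^{p+q}(A)/F^{p+1}H^{p+q}(A)$. 4. Under the isomorphisms of 3, the differential of the second page is the cup product with the extension class $$(-1)^p\,i_{[\gamma]}:H^p(\mathcal F,\wedge^qK^*)\to H^{p+2}(\mathcal F,\wedge^{q-1}K^*),\qquad q\ge1:$$ for every closed $\gamma'\in\Omega^2(\mathcal F,K)$ representing $[\gamma]$ and every closed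 $\beta\in\Omega^p(\mathcal F,\wedge^qK^*)$, the form $i_{\gamma'}(\beta)$ is closed and $d_2[\beta]=[(-1)^p\,i_{\gamma'}(\beta)]$. 5. The spectral sequence is natural: for a morphism $\varphi:A\to A'$ over $\mathrm{id}_M$ between two such Lie algebroids (a smooth vector bundle map compatible with anchors and brackets), the pullback $\varphi^*:\Omega^\bullet(A')\to\Omega^\bullet(A)$ maps $Z_r^{p,q}$ of $A'$ to $Z_r^{p,q}$ of $A$ and induces a morphism between the spectral sequences of $A'$ and of $A$. -/

import Mathlib

open Bundle
open scoped Manifold ContDiff Topology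

set_option linter.unusedSectionVars false

noncomputable section

namespace LieAlgd

/-! ### Alternating maps -/

section Alternating

variable {L : Type*} [AddCommGroup L] [Module ℝ L] {N : Type*} [AddCommGroup N] [Module ℝ N]

theorem pairSum_aux {m : ℕ} (Ψ : L →ₗ[ℝ] L →ₗ[ℝ] L [⋀^Fin m]→ₗ[ℝ] N) (hΨ : ∀ v, Ψ v v = 0)
    (v : Fin (m + 2) → L) :
    (∑ i : Fin (m + 1), ∑ j ∈ Finset.Ici i, (-1 : ℤ) ^ ((i : ℕ) + ((j : ℕ) + 1)) •
      Ψ (v i.castSucc) (v j.succ) (j.removeNth (i.castSucc.removeNth v))) =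
    ((-1 / 2 : ℝ) • AlternatingMap.alternatizeUncurryFin
      (AlternatingMap.alternatizeUncurryFinLM ∘ₗ Ψ)) v := by
  have skew : ∀ a b, Ψ b a = - Ψ a b := by
    intro a b
    have h := hΨ (a + b)
    simp only [map_add, LinearMap.add_apply, hΨ, zero_add, add_zero] at h
    exact eq_neg_of_add_eq_zero_left h
  rw [AlternatingMap.smul_apply,
    AlternatingMap.alternatizeUncurryFin_alternatizeUncurryFinLM_comp_apply, Finset.smul_sum]
  refine Finset.sum_congr rfl fun i _ => ?_
  rw [Finset.smul_sum]
  refine Finset.sum_congr rfl fun j _ => ?_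
  rw [skew (v i.castSucc) (v j.succ), AlternatingMap.neg_apply, sub_neg_eq_add, ← two_smul ℝ,
    smul_comm (_ ^ _ : ℤ) (2 : ℝ), smul_smul, ← add_assoc, pow_succ, mul_neg_one, neg_smul]
  norm_num

/-- The alternating map
`(v₀, …, vₘ₊₁) ↦ ∑_{i < j} (-1)^(i+j) Ψ(vᵢ, vⱼ)(v₀, …, v̂ᵢ, …, v̂ⱼ, …, vₘ₊₁)`
attached to a skew-symmetric bilinear map `Ψ` with values in alternating maps.
The pairs `i < j` of indices in `Fin (m + 2)` are enumerated as `(i.castSucc, j.succ)` with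
`i ≤ j` in `Fin (m + 1)`. -/
def pairSum {m : ℕ} (Ψ : L →ₗ[ℝ] L →ₗ[ℝ] L [⋀^Fin m]→ₗ[ℝ] N) (hΨ : ∀ v, Ψ v v = 0) :
    L [⋀^Fin (m + 2)]→ₗ[ℝ] N where
  toFun v := ∑ i : Fin (m + 1), ∑ j ∈ Finset.Ici i, (-1 : ℤ) ^ ((i : ℕ) + ((j : ℕ) + 1)) •
      Ψ (v i.castSucc) (v j.succ) (j.removeNth (i.castSucc.removeNth v))
  map_update_add' v i x y := by
    rw [pairSum_aux Ψ hΨ, pairSum_aux Ψ hΨ, pairSum_aux Ψ hΨ]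
    convert AlternatingMap.map_update_add _ v i x y
  map_update_smul' v i c x := by
    rw [pairSum_aux Ψ hΨ, pairSum_aux Ψ hΨ]
    convert AlternatingMap.map_update_smul _ v i c x
  map_eq_zero_of_eq' v i j h hij := by
    rw [pairSum_aux Ψ hΨ]
    exact AlternatingMap.map_eq_zero_of_eq _ v h hij

theorem pairSum_apply {m : ℕ} (Ψ : L →ₗ[ℝ] L →ₗ[ℝ] L [⋀^Fin m]→ₗ[ℝ] N) (hΨ : ∀ v, Ψ v v = 0)
    (v : Fin (m + 2) → L) :
    pairSum Ψ hΨ v = ∑ i : Fin (m + 1), ∑ j ∈ Finset.Ici i,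
      (-1 : ℤ) ^ ((i : ℕ) + ((j : ℕ) + 1)) •
        Ψ (v i.castSucc) (v j.succ) (j.removeNth (i.castSucc.removeNth v)) := rfl

/-- The infinitesimal action of a pair of endomorphisms on an alternating map:
`(v₁, …, vₙ) ↦ D' (T (v₁, …, vₙ)) - ∑ᵢ T (v₁, …, D vᵢ, …, vₙ)`. -/
def lieDer {n : ℕ} (D : L →ₗ[ℝ] L) (D' : N →ₗ[ℝ] N) (T : L [⋀^Fin n]→ₗ[ℝ] N) :
    L [⋀^Fin n]→ₗ[ℝ] N where
  toFun v := D' (T v) - ∑ i, T (Function.update v i (D (v i)))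
  map_update_add' v i x y := by
    rename_i inst
    obtain rfl : inst = instDecidableEqFin n := Subsingleton.elim _ _
    have h : ∀ (z : L) (k : Fin n), Function.update (Function.update v i z) k
        (D (Function.update v i z k)) = if k = i then Function.update v i (D z) else
          Function.update (Function.update v k (D (v k))) i z := by
      intro z k
      split_ifs with hk
      · subst hk; simp
      · rw [Function.update_of_ne hk, Function.update_comm hk]
    simp only [h]
    rw [T.map_update_add, map_add]
    have : ∀ k, T (if k = i then Function.update v i (D (x + y)) else
          Function.update (Function.update v k (D (v k))) i (x + y)) =
        T (if k = i then Function.update v i (D x) else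
          Function.update (Function.update v k (D (v k))) i x) +
        T (if k = i then Function.update v i (D y) else
          Function.update (Function.update v k (D (v k))) i y) := by
      intro k
      split_ifs
      · rw [map_add, T.map_update_add]
      · rw [T.map_update_add]
    simp only [this, Finset.sum_add_distrib]
    abel
  map_update_smul' v i c x := by
    rename_i inst
    obtain rfl : inst = instDecidableEqFin n := Subsingleton.elim _ _
    have h : ∀ (z : L) (k : Fin n), Function.update (Function.update v i z) k
        (D (Function.update v i z k)) = if k = i then Function.update v i (D z) else
          Function.update (Function.update v k (D (v k))) i z := by
      intro z k
      split_ifs with hk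
      · subst hk; simp
      · rw [Function.update_of_ne hk, Function.update_comm hk]
    simp only [h]
    rw [T.map_update_smul, map_smul, smul_sub, Finset.smul_sum]
    congr 1
    refine Finset.sum_congr rfl fun k _ => ?_
    split_ifs
    · rw [map_smul, T.map_update_smul]
    · rw [T.map_update_smul]
  map_eq_zero_of_eq' v i j h hij := by
    rw [T.map_eq_zero_of_eq v h hij, map_zero, zero_sub, neg_eq_zero]
    rw [Fintype.sum_eq_add i j hij]
    · have : Function.update v j (D (v j)) =
          Function.update v i (D (v i)) ∘ Equiv.swap i j := by
        ext k
        rcases eq_or_ne k i with rfl | hki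
        · simp [Function.update_of_ne hij, Function.update_of_ne hij.symm, h]
        · rcases eq_or_ne k j with rfl | hkj
          · simp [h]
          · simp [Equiv.swap_apply_of_ne_of_ne hki hkj, Function.update_of_ne hki,
              Function.update_of_ne hkj]
      rw [this, T.map_swap _ hij, add_neg_cancel]
    · rintro k ⟨hki, hkj⟩
      refine T.map_eq_zero_of_eq _ (i := i) (j := j) ?_ hij
      rw [Function.update_of_ne hki.symm, Function.update_of_ne hkj.symm, h]

theorem lieDer_apply {n : ℕ} (D : L →ₗ[ℝ] L) (D' : N →ₗ[ℝ] N) (T : L [⋀^Fin n]→ₗ[ℝ] N)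
    (v : Fin n → L) :
    lieDer D D' T v = D' (T v) - ∑ i, T (Function.update v i (D (v i))) := rfl

end Alternating

/-! ### Families of vector spaces with a distinguished space of smooth sections -/

section Basic

variable (E : Type*) [NormedAddCommGroup E] [NormedSpace ℝ E]
  {M : Type*} [TopologicalSpace M] [ChartedSpace E M]

/-- A space of sections of a family of vector spaces over a manifold `M` which is stable under
multiplication by smooth functions. -/
structure SectionSpace (V : M → Type*) [∀ x, AddCommGroup (V x)] [∀ x, Module ℝ (V x)] where
  carrier : Submodule ℝ (∀ x, V x)
  smul_mem : ∀ (f : C^∞⟮𝓘(ℝ, E), M; 𝓘(ℝ, ℝ), ℝ⟯) {X : ∀ x, V x}, X ∈ carrier →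
    (fun x => f x • X x) ∈ carrier

variable {E}
variable {V : M → Type*} [∀ x, AddCommGroup (V x)] [∀ x, Module ℝ (V x)]
variable {W : M → Type*} [∀ x, AddCommGroup (W x)] [∀ x, Module ℝ (W x)]

instance (Γ : SectionSpace E V) : SMul C^∞⟮𝓘(ℝ, E), M; 𝓘(ℝ, ℝ), ℝ⟯ Γ.carrier :=
  ⟨fun f X => ⟨fun x => f x • X.1 x, Γ.smul_mem f X.2⟩⟩

theorem smul_apply' (Γ : SectionSpace E V) (f : C^∞⟮𝓘(ℝ, E), M; 𝓘(ℝ, ℝ), ℝ⟯) (X : Γ.carrier)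
    (x : M) : (f • X).1 x = f x • X.1 x := rfl

/-- The smooth real-valued functions. -/
def smoothFunctions (E : Type*) [NormedAddCommGroup E] [NormedSpace ℝ E]
    (M : Type*) [TopologicalSpace M] [ChartedSpace E M] : SectionSpace E (fun _ : M => ℝ) where
  carrier :=
    { carrier := {f | ContMDiff 𝓘(ℝ, E) 𝓘(ℝ, ℝ) ∞ f}
      add_mem' := fun hf hg => ContMDiff.add hf hg
      zero_mem' := contMDiff_const
      smul_mem' := fun c _ hf =>
        (show ContMDiff 𝓘(ℝ, E) 𝓘(ℝ, ℝ) ∞ (fun _ : M => c) from contMDiff_const).smul hf }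
  smul_mem f _ hX := f.contMDiff.smul hX

/-- The smooth families of alternating `n`-linear maps `V x × ⋯ × V x → W x`, that is, those
which send smooth sections to smooth sections. -/
def altForms (ΓV : SectionSpace E V) (ΓW : SectionSpace E W) (n : ℕ) :
    SectionSpace E (fun x => V x [⋀^Fin n]→ₗ[ℝ] W x) where
  carrier :=
    { carrier := {α | ∀ X : Fin n → ΓV.carrier, (fun x => α x (fun i => (X i).1 x)) ∈ ΓW.carrier}
      add_mem' := fun ha hη X => ΓW.carrier.add_mem (ha X) (hη X)
      zero_mem' := fun _ => ΓW.carrier.zero_mem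
      smul_mem' := fun c _ ha X => ΓW.carrier.smul_mem c (ha X) }
  smul_mem f _ ha X := ΓW.smul_mem f (ha X)

variable {ΓV : SectionSpace E V} {ΓW : SectionSpace E W} {n : ℕ}

/-- The value of a form on sections. -/
def onSections (α : (altForms ΓV ΓW n).carrier) :
    ΓV.carrier [⋀^Fin n]→ₗ[ℝ] ΓW.carrier where
  toFun X := ⟨fun x => α.1 x (fun i => (X i).1 x), α.2 X⟩
  map_update_add' X i Y Z := by
    apply Subtype.ext; funext x
    have h : ∀ Y : ΓV.carrier, (fun k => (Function.update X i Y k).1 x) =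
        Function.update (fun k => (X k).1 x) i (Y.1 x) := fun Y => by
      funext k; rcases eq_or_ne k i with rfl | hk <;> simp [*]
    simp only [h, Submodule.coe_add, Pi.add_apply]
    exact AlternatingMap.map_update_add _ _ _ _ _
  map_update_smul' X i c Y := by
    apply Subtype.ext; funext x
    have h : ∀ Y : ΓV.carrier, (fun k => (Function.update X i Y k).1 x) =
        Function.update (fun k => (X k).1 x) i (Y.1 x) := fun Y => by
      funext k; rcases eq_or_ne k i with rfl | hk <;> simp [*]
    simp only [h, Submodule.coe_smul, Pi.smul_apply]
    exact AlternatingMap.map_update_smul _ _ _ _ _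
  map_eq_zero_of_eq' X i j h hij := by
    apply Subtype.ext; funext x
    exact (α.1 x).map_eq_zero_of_eq _ (by simp [h]) hij

theorem onSections_apply (α : (altForms ΓV ΓW n).carrier) (X : Fin n → ΓV.carrier) (x : M) :
    (onSections α X).1 x = α.1 x (fun i => (X i).1 x) := rfl

theorem onSections_add (α η : (altForms ΓV ΓW n).carrier) :
    onSections (α + η) = onSections α + onSections η := rfl

theorem onSections_smul (c : ℝ) (α : (altForms ΓV ΓW n).carrier) :
    onSections (c • α) = c • onSections α := rfl

/-- An alternating map on sections is tensorial if it is linear over the smooth functions. -/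
def IsTensorial (T : ΓV.carrier [⋀^Fin n]→ₗ[ℝ] ΓW.carrier) : Prop :=
  ∀ (X : Fin n → ΓV.carrier) (i : Fin n) (f : C^∞⟮𝓘(ℝ, E), M; 𝓘(ℝ, ℝ), ℝ⟯),
    T (Function.update X i (f • X i)) = f • T X

theorem onSections_isTensorial (α : (altForms ΓV ΓW n).carrier) : IsTensorial (onSections α) := by
  intro X i f
  apply Subtype.ext; funext x
  have h : (fun k => (Function.update X i (f • X i) k).1 x) =
      Function.update (fun k => (X k).1 x) i (f x • (X i).1 x) := by
    funext k; rcases eq_or_ne k i with rfl | hk <;> simp [smul_apply', *]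
  rw [onSections_apply, h, AlternatingMap.map_update_smul, Function.update_eq_self]
  rfl

/-- There are enough sections: each vector is the value of a section, and a section vanishing at
`x` is a combination of sections with coefficients functions vanishing at `x`. -/
class IsFull (Γ : SectionSpace E V) : Prop where
  exists_eq : ∀ (x : M) (v : V x), ∃ X : Γ.carrier, X.1 x = v
  exists_sum : ∀ (x : M) (X : Γ.carrier), X.1 x = 0 →
    ∃ (k : ℕ) (f : Fin k → C^∞⟮𝓘(ℝ, E), M; 𝓘(ℝ, ℝ), ℝ⟯) (s : Fin k → Γ.carrier),
      (∀ i, f i x = 0) ∧ X = ∑ i, f i • s i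

theorem IsTensorial.apply_eq_zero [IsFull ΓV] {T : ΓV.carrier [⋀^Fin n]→ₗ[ℝ] ΓW.carrier}
    (hT : IsTensorial T) {x : M} {X : Fin n → ΓV.carrier} {i : Fin n} (h : (X i).1 x = 0) :
    (T X).1 x = 0 := by
  obtain ⟨k, f, s, hf, hX⟩ := IsFull.exists_sum x (X i) h
  rw [← Function.update_eq_self i X, hX, T.map_update_sum, Submodule.coe_sum, Finset.sum_apply]
  refine Finset.sum_eq_zero fun j _ => ?_
  have := hT (Function.update X i (s j)) i (f j)
  simp only [Function.update_self, Function.update_idem] at this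
  rw [this, smul_apply', hf, zero_smul]

theorem IsTensorial.congr [IsFull ΓV] {T : ΓV.carrier [⋀^Fin n]→ₗ[ℝ] ΓW.carrier}
    (hT : IsTensorial T) {x : M} {X Y : Fin n → ΓV.carrier} (h : ∀ i, (X i).1 x = (Y i).1 x) :
    (T X).1 x = (T Y).1 x := by
  have key : ∀ s : Finset (Fin n), (T (s.piecewise Y X)).1 x = (T X).1 x := by
    intro s
    induction s using Finset.induction_on with
    | empty => simp
    | insert i s hi ih =>
      rw [← ih, Finset.piecewise_insert]
      set Z := s.piecewise Y X with hZ
      have hZi : Z i = X i := by simp [hZ, hi]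
      have h2 : T (Function.update Z i (Y i)) =
          T (Function.update Z i (Y i - X i)) + T Z := by
        conv_rhs => rw [← Function.update_eq_self i Z, hZi]
        rw [Function.update_idem, ← T.map_update_add, sub_add_cancel]
      rw [h2, Submodule.coe_add, Pi.add_apply, add_eq_right]
      apply hT.apply_eq_zero (i := i)
      simp [h]
  have := key Finset.univ
  rw [Finset.piecewise_univ] at this
  exact this.symm

theorem exists_linear_extension (ΓV : SectionSpace E V) [IsFull ΓV] (x : M) :
    ∃ e : V x →ₗ[ℝ] ΓV.carrier, ∀ v, (e v).1 x = v := by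
  have := LinearMap.exists_rightInverse_of_surjective
    ((LinearMap.proj x : (∀ y, V y) →ₗ[ℝ] V x) ∘ₗ ΓV.carrier.subtype)
    (LinearMap.range_eq_top.2 fun v => IsFull.exists_eq x v)
  obtain ⟨e, he⟩ := this
  exact ⟨e, fun v => LinearMap.congr_fun he v⟩

/-- The form defined by a tensorial alternating map on sections. -/
def descend [IsFull ΓV] (T : ΓV.carrier [⋀^Fin n]→ₗ[ℝ] ΓW.carrier) (hT : IsTensorial T) :
    (altForms ΓV ΓW n).carrier :=
  ⟨fun x => (((LinearMap.proj x : (∀ y, W y) →ₗ[ℝ] W x) ∘ₗ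
      ΓW.carrier.subtype).compAlternatingMap T).compLinearMap
      (exists_linear_extension ΓV x).choose, fun X => by
    convert! (T X).2 using 1
    funext x
    exact hT.congr fun i => (exists_linear_extension ΓV x).choose_spec _⟩

theorem onSections_descend [IsFull ΓV] (T : ΓV.carrier [⋀^Fin n]→ₗ[ℝ] ΓW.carrier)
    (hT : IsTensorial T) : onSections (descend T hT) = T := by
  ext X x
  exact hT.congr fun i => (exists_linear_extension ΓV x).choose_spec _

/-- A form is determined by its values on sections. -/
theorem onSections_injective [IsFull ΓV] :
    Function.Injective (onSections : (altForms ΓV ΓW n).carrier → _) := by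
  intro α η h
  apply Subtype.ext; funext x
  ext v
  choose X hX using fun i => IsFull.exists_eq (Γ := ΓV) x (v i)
  have := congrArg (fun T => (T X).1 x) h
  simpa [onSections_apply, hX] using this

theorem IsTensorial.of_zero {T : ΓV.carrier [⋀^Fin (n + 1)]→ₗ[ℝ] ΓW.carrier}
    (h : ∀ (X : ΓV.carrier) (Y : Fin n → ΓV.carrier) (f : C^∞⟮𝓘(ℝ, E), M; 𝓘(ℝ, ℝ), ℝ⟯),
      T (Matrix.vecCons (f • X) Y) = f • T (Matrix.vecCons X Y)) : IsTensorial T := by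
  have h0 : ∀ (X : Fin (n + 1) → ΓV.carrier) (f : C^∞⟮𝓘(ℝ, E), M; 𝓘(ℝ, ℝ), ℝ⟯),
      T (Function.update X 0 (f • X 0)) = f • T X := by
    intro X f
    have := h (X 0) (Fin.tail X) f
    rw [Matrix.vecCons, Matrix.vecCons, Fin.cons_self_tail] at this
    rw [← this]
    congr 1
    rw [← Fin.cons_self_tail X, Fin.update_cons_zero]
    simp
  intro X i f
  rcases eq_or_ne i 0 with rfl | hi
  · exact h0 X f
  · have h1 := h0 (X ∘ Equiv.swap i 0) f
    have h2 : Function.update (X ∘ Equiv.swap i 0) 0 (f • (X ∘ Equiv.swap i 0) 0) =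
        Function.update X i (f • X i) ∘ Equiv.swap i 0 := by
      ext k : 1
      rcases eq_or_ne k 0 with rfl | hk
      · simp
      · rcases eq_or_ne k i with rfl | hki
        · simp [hk, hk.symm]
        · simp [Equiv.swap_apply_of_ne_of_ne hki hk, Function.update_of_ne hk,
            Function.update_of_ne hki]
    rw [h2, T.map_swap _ hi, T.map_swap _ hi] at h1
    apply Subtype.ext; funext x
    have h3 := congrFun (congrArg Subtype.val h1) x
    change -(T (Function.update X i (f • X i))).1 x = f x • -(T X).1 x at h3
    rw [smul_neg, neg_inj] at h3
    exact h3

theorem smul_sub_aux (Γ : SectionSpace E V) (f : C^∞⟮𝓘(ℝ, E), M; 𝓘(ℝ, ℝ), ℝ⟯) (s t : Γ.carrier) :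
    f • (s - t) = f • s - f • t := by
  apply Subtype.ext; funext x; exact smul_sub (f x) _ _

theorem smul_add_aux (Γ : SectionSpace E V) (f : C^∞⟮𝓘(ℝ, E), M; 𝓘(ℝ, ℝ), ℝ⟯) (s t : Γ.carrier) :
    f • (s + t) = f • s + f • t := by
  apply Subtype.ext; funext x; exact smul_add (f x) _ _

theorem smul_zsmul_aux (Γ : SectionSpace E V) (f : C^∞⟮𝓘(ℝ, E), M; 𝓘(ℝ, ℝ), ℝ⟯) (k : ℤ)
    (s : Γ.carrier) : f • (k • s) = k • (f • s) := by
  apply Subtype.ext; funext x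
  exact smul_comm (f x) k (s.1 x)

theorem smul_sum_aux (Γ : SectionSpace E V) (f : C^∞⟮𝓘(ℝ, E), M; 𝓘(ℝ, ℝ), ℝ⟯) {ι : Type*}
    (S : Finset ι) (s : ι → Γ.carrier) : f • ∑ i ∈ S, s i = ∑ i ∈ S, f • s i := by
  classical
  induction S using Finset.induction_on with
  | empty => apply Subtype.ext; funext x; exact smul_zero (f x)
  | insert i S hi ih => rw [Finset.sum_insert hi, Finset.sum_insert hi, smul_add_aux, ih]

theorem IsTensorial.vecCons {T : ΓV.carrier [⋀^Fin (n + 1)]→ₗ[ℝ] ΓW.carrier} (hT : IsTensorial T)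
    (X : ΓV.carrier) (Y : Fin n → ΓV.carrier) (f : C^∞⟮𝓘(ℝ, E), M; 𝓘(ℝ, ℝ), ℝ⟯) :
    T (Matrix.vecCons (f • X) Y) = f • T (Matrix.vecCons X Y) := by
  have := hT (Matrix.vecCons X Y) 0 f
  rw [← this]
  congr 1
  simp [Matrix.vecCons, Fin.update_cons_zero]

theorem removeNth_succ_vecCons {α : Type*} (i : Fin (n + 1)) (a : α) (Y : Fin (n + 1) → α) :
    i.succ.removeNth (Matrix.vecCons a Y : Fin (n + 2) → α) =
      Matrix.vecCons a (i.removeNth Y) := by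
  ext k
  refine Fin.cases ?_ (fun k => ?_) k
  · simp [Fin.removeNth]
  · simp [Fin.removeNth]

theorem IsTensorial.vecCons_removeNth {T : ΓV.carrier [⋀^Fin (n + 1)]→ₗ[ℝ] ΓW.carrier}
    (hT : IsTensorial T) (b X : ΓV.carrier) (Z : Fin n → ΓV.carrier)
    (f : C^∞⟮𝓘(ℝ, E), M; 𝓘(ℝ, ℝ), ℝ⟯) {j : Fin (n + 1)} (hj : j ≠ 0) :
    T (Matrix.vecCons b (j.removeNth (Matrix.vecCons (f • X) Z : Fin (n + 1) → ΓV.carrier))) =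
      f • T (Matrix.vecCons b
        (j.removeNth (Matrix.vecCons X Z : Fin (n + 1) → ΓV.carrier))) := by
  obtain ⟨j, rfl⟩ := Fin.exists_succ_eq.2 hj
  cases n with
  | zero => exact j.elim0
  | succ n =>
    rw [removeNth_succ_vecCons, removeNth_succ_vecCons]
    rw [← hT (Matrix.vecCons b (Matrix.vecCons X (j.removeNth Z))) 1 f]
    congr 1
    ext k : 1
    refine Fin.cases ?_ (fun k => Fin.cases ?_ (fun k => ?_) k) k
    · simp
    · simp
    · rw [Function.update_of_ne]
      · simp
      · simp [Fin.ext_iff]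

/-! ### Brackets, connections, and the differential -/

/-- Smooth sections of a vector bundle. -/
def smoothSections (E : Type*) [NormedAddCommGroup E] [NormedSpace ℝ E]
    {M : Type*} [TopologicalSpace M] [ChartedSpace E M]
    (F : Type*) [NormedAddCommGroup F] [NormedSpace ℝ F] (A : M → Type*)
    [TopologicalSpace (TotalSpace F A)] [∀ x, TopologicalSpace (A x)] [∀ x, AddCommGroup (A x)]
    [∀ x, Module ℝ (A x)] [FiberBundle F A] [VectorBundle ℝ F A] : SectionSpace E A where
  carrier :=
    { carrier := {X | ContMDiff 𝓘(ℝ, E) (𝓘(ℝ, E).prod 𝓘(ℝ, F)) ∞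
        (fun x => TotalSpace.mk' F x (X x))}
      add_mem' := fun hX hY => ContMDiff.add_section hX hY
      zero_mem' := contMDiff_zeroSection ℝ A
      smul_mem' := fun c _ hX => ContMDiff.const_smul_section (a := c) hX }
  smul_mem f _ hX := ContMDiff.smul_section f.contMDiff hX

/-- Smooth vector fields on `M`. -/
def vectorFields (E : Type*) [NormedAddCommGroup E] [NormedSpace ℝ E]
    (M : Type*) [TopologicalSpace M] [ChartedSpace E M] [IsManifold 𝓘(ℝ, E) ∞ M] :
    SectionSpace E (fun x : M => TangentSpace 𝓘(ℝ, E) x) :=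
  smoothSections E E (fun x : M => TangentSpace 𝓘(ℝ, E) x)

/-- The derivative `X f` of a smooth function along a vector field. -/
def dirDeriv [IsManifold 𝓘(ℝ, E) ∞ M] (X : (vectorFields E M).carrier)
    (f : C^∞⟮𝓘(ℝ, E), M; 𝓘(ℝ, ℝ), ℝ⟯) : C^∞⟮𝓘(ℝ, E), M; 𝓘(ℝ, ℝ), ℝ⟯ where
  val x := mvfderiv 𝓘(ℝ, E) f x (X.1 x)
  property := by
    have h1 := f.contMDiff.contMDiff_tangentMap (m := ∞) (by norm_num)
    have h2 := h1.comp X.2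
    exact (contMDiff_snd_tangentBundle_modelSpace ℝ 𝓘(ℝ, ℝ)).comp h2

section Differential

variable [IsManifold 𝓘(ℝ, E) ∞ M]

/-- A skew-symmetric bracket on a space of sections satisfying the Leibniz rule with respect to an
anchor map. -/
structure AnchoredBracket (Γ : SectionSpace E V) where
  anchor : ∀ x, V x →ₗ[ℝ] TangentSpace 𝓘(ℝ, E) x
  anchor_mem : ∀ X : Γ.carrier, (fun x => anchor x (X.1 x)) ∈ (vectorFields E M).carrier
  bracket : Γ.carrier →ₗ[ℝ] Γ.carrier →ₗ[ℝ] Γ.carrier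
  bracket_self : ∀ X, bracket X X = 0
  leibniz : ∀ (X Y : Γ.carrier) (f : C^∞⟮𝓘(ℝ, E), M; 𝓘(ℝ, ℝ), ℝ⟯),
    bracket X (f • Y) = f • bracket X Y + dirDeriv ⟨_, anchor_mem X⟩ f • Y

/-- The vector field which is the image of a section under the anchor. -/
def AnchoredBracket.toVF {Γ : SectionSpace E V} (B : AnchoredBracket Γ) (X : Γ.carrier) :
    (vectorFields E M).carrier :=
  ⟨fun x => B.anchor x (X.1 x), B.anchor_mem X⟩

/-- A connection along an anchored bracket. -/
structure Connection {Γ : SectionSpace E V} (B : AnchoredBracket Γ) (ΓW : SectionSpace E W) where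
  nabla : Γ.carrier →ₗ[ℝ] ΓW.carrier →ₗ[ℝ] ΓW.carrier
  smul_left : ∀ (f : C^∞⟮𝓘(ℝ, E), M; 𝓘(ℝ, ℝ), ℝ⟯) X s, nabla (f • X) s = f • nabla X s
  leibniz : ∀ X (f : C^∞⟮𝓘(ℝ, E), M; 𝓘(ℝ, ℝ), ℝ⟯) s,
    nabla X (f • s) = f • nabla X s + dirDeriv (B.toVF X) f • s

/-- The action of sections on smooth functions by derivation along the anchor. -/
def trivialConnection {Γ : SectionSpace E V} (B : AnchoredBracket Γ) :
    Connection B (smoothFunctions E M) where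
  nabla := LinearMap.mk₂ ℝ
    (fun X g => ⟨dirDeriv (B.toVF X) ⟨g.1, g.2⟩, (dirDeriv (B.toVF X) ⟨g.1, g.2⟩).contMDiff⟩)
    (fun X Y g => by
      apply Subtype.ext; funext x
      change mvfderiv 𝓘(ℝ, E) g.1 x (B.anchor x (X.1 x + Y.1 x)) =
        mvfderiv 𝓘(ℝ, E) g.1 x (B.anchor x (X.1 x)) + mvfderiv 𝓘(ℝ, E) g.1 x (B.anchor x (Y.1 x))
      rw [map_add, map_add])
    (fun c X g => by
      apply Subtype.ext; funext x
      change mvfderiv 𝓘(ℝ, E) g.1 x (B.anchor x (c • X.1 x)) =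
        c • mvfderiv 𝓘(ℝ, E) g.1 x (B.anchor x (X.1 x))
      rw [map_smul, map_smul])
    (fun X g h => by
      apply Subtype.ext; funext x
      have hg : MDifferentiableAt 𝓘(ℝ, E) 𝓘(ℝ, ℝ) g.1 x := g.2.mdifferentiableAt (by simp)
      have hh : MDifferentiableAt 𝓘(ℝ, E) 𝓘(ℝ, ℝ) h.1 x := h.2.mdifferentiableAt (by simp)
      exact DFunLike.congr_fun (mvfderiv_add hg hh) _)
    (fun c X g => by
      apply Subtype.ext; funext x
      have hg : MDifferentiableAt 𝓘(ℝ, E) 𝓘(ℝ, ℝ) g.1 x := g.2.mdifferentiableAt (by simp)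
      have hc : MDifferentiableAt 𝓘(ℝ, E) 𝓘(ℝ, ℝ) (fun _ : M => c) x := mdifferentiableAt_const
      have h := DFunLike.congr_fun (mvfderiv_mul hc hg) ((B.toVF X).1 x)
      rw [mvfderiv_const, smul_zero, add_zero] at h
      exact h)
  smul_left f X g := by
    apply Subtype.ext; funext x
    change mvfderiv 𝓘(ℝ, E) g.1 x (B.anchor x (f x • X.1 x)) =
      f x • mvfderiv 𝓘(ℝ, E) g.1 x (B.anchor x (X.1 x))
    rw [map_smul, map_smul]
  leibniz X f g := by
    apply Subtype.ext; funext x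
    have hg : MDifferentiableAt 𝓘(ℝ, E) 𝓘(ℝ, ℝ) g.1 x := g.2.mdifferentiableAt (by simp)
    have hf : MDifferentiableAt 𝓘(ℝ, E) 𝓘(ℝ, ℝ) f x := f.contMDiff.mdifferentiableAt (by simp)
    have h := DFunLike.congr_fun (mvfderiv_mul hf hg) ((B.toVF X).1 x)
    refine h.trans ?_
    change f x * _ + g.1 x * _ = f x * _ + _ * g.1 x
    rw [mul_comm (g.1 x)]
    rfl

variable {B : AnchoredBracket ΓV}

theorem AnchoredBracket.leibniz_left (B : AnchoredBracket ΓV) (X Y : ΓV.carrier)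
    (f : C^∞⟮𝓘(ℝ, E), M; 𝓘(ℝ, ℝ), ℝ⟯) :
    B.bracket (f • X) Y = f • B.bracket X Y - dirDeriv (B.toVF Y) f • X := by
  have skew : ∀ a b, B.bracket b a = - B.bracket a b := by
    intro a b
    have h := B.bracket_self (a + b)
    simp only [map_add, LinearMap.add_apply, B.bracket_self, zero_add, add_zero] at h
    exact eq_neg_of_add_eq_zero_left h
  rw [skew Y, B.leibniz, neg_add, skew X Y]
  apply Subtype.ext; funext x
  change -(f x • -((B.bracket X Y).1 x)) + -((dirDeriv (B.toVF Y) f) x • X.1 x) =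
    f x • (B.bracket X Y).1 x - (dirDeriv (B.toVF Y) f) x • X.1 x
  rw [smul_neg, neg_neg, sub_eq_add_neg]

/-- The part of the differential involving the brackets:
`(X₀, …, Xₙ) ↦ ∑_{i < j} (-1)^(i+j) T([Xᵢ, Xⱼ], X₀, …, X̂ᵢ, …, X̂ⱼ, …, Xₙ)`. -/
def bracketPart (B : AnchoredBracket ΓV) : ∀ {n : ℕ},
    (ΓV.carrier [⋀^Fin n]→ₗ[ℝ] ΓW.carrier) → ΓV.carrier [⋀^Fin (n + 1)]→ₗ[ℝ] ΓW.carrier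
  | 0, _ => 0
  | _ + 1, T => pairSum (LinearMap.mk₂ ℝ (fun X Y => T.curryLeft (B.bracket X Y))
      (fun X Y Z => by simp) (fun c X Y => by simp) (fun X Y Z => by simp)
      (fun c X Y => by simp)) (fun X => by simp [B.bracket_self])

/-- The Koszul formula
`(X₀, …, Xₙ) ↦ ∑ᵢ (-1)^i ∇_{Xᵢ} (T(X₀, …, X̂ᵢ, …, Xₙ))
  + ∑_{i < j} (-1)^(i+j) T([Xᵢ, Xⱼ], X₀, …, X̂ᵢ, …, X̂ⱼ, …, Xₙ)`. -/
def koszul {B : AnchoredBracket ΓV} (D : Connection B ΓW) {n : ℕ}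
    (T : ΓV.carrier [⋀^Fin n]→ₗ[ℝ] ΓW.carrier) : ΓV.carrier [⋀^Fin (n + 1)]→ₗ[ℝ] ΓW.carrier :=
  AlternatingMap.alternatizeUncurryFin
    { toFun := fun X => (D.nabla X).compAlternatingMap T
      map_add' := fun X Y => by ext; simp
      map_smul' := fun c X => by ext; simp } + bracketPart B T

theorem koszul_apply_succ {B : AnchoredBracket ΓV} (D : Connection B ΓW) {n : ℕ}
    (T : ΓV.carrier [⋀^Fin (n + 1)]→ₗ[ℝ] ΓW.carrier) (X : Fin (n + 2) → ΓV.carrier) :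
    koszul D T X = ∑ i : Fin (n + 2), (-1 : ℤ) ^ (i : ℕ) • D.nabla (X i) (T (i.removeNth X)) +
      ∑ i : Fin (n + 1), ∑ j ∈ Finset.Ici i, (-1 : ℤ) ^ ((i : ℕ) + ((j : ℕ) + 1)) •
        T (Matrix.vecCons (B.bracket (X i.castSucc) (X j.succ))
          (j.removeNth (i.castSucc.removeNth X))) := by
  rw [koszul, AlternatingMap.add_apply, AlternatingMap.alternatizeUncurryFin_apply]
  rfl

theorem koszul_apply_zero {B : AnchoredBracket ΓV} (D : Connection B ΓW)
    (T : ΓV.carrier [⋀^Fin 0]→ₗ[ℝ] ΓW.carrier) (X : Fin 1 → ΓV.carrier) :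
    koszul D T X = D.nabla (X 0) (T (Fin.removeNth 0 X)) := by
  rw [koszul, AlternatingMap.add_apply, AlternatingMap.alternatizeUncurryFin_apply]
  simp [bracketPart]

theorem koszul_add {B : AnchoredBracket ΓV} (D : Connection B ΓW) {n : ℕ}
    (T S : ΓV.carrier [⋀^Fin n]→ₗ[ℝ] ΓW.carrier) : koszul D (T + S) = koszul D T + koszul D S := by
  ext X : 1
  cases n with
  | zero => simp [koszul_apply_zero]
  | succ n =>
    simp only [koszul_apply_succ, AlternatingMap.add_apply, map_add, smul_add,
      Finset.sum_add_distrib]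
    abel

theorem koszul_smul {B : AnchoredBracket ΓV} (D : Connection B ΓW) {n : ℕ} (c : ℝ)
    (T : ΓV.carrier [⋀^Fin n]→ₗ[ℝ] ΓW.carrier) : koszul D (c • T) = c • koszul D T := by
  ext X : 1
  cases n with
  | zero => simp [koszul_apply_zero]
  | succ n =>
    simp only [koszul_apply_succ, AlternatingMap.smul_apply, map_smul, smul_add,
      Finset.smul_sum, smul_comm c]

theorem koszul_isTensorial {B : AnchoredBracket ΓV} (D : Connection B ΓW) {n : ℕ}
    {T : ΓV.carrier [⋀^Fin n]→ₗ[ℝ] ΓW.carrier} (hT : IsTensorial T) :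
    IsTensorial (koszul D T) := by
  apply IsTensorial.of_zero
  intro X Y f
  cases n with
  | zero =>
    rw [koszul_apply_zero, koszul_apply_zero]
    exact D.smul_left _ _ _
  | succ n =>
    have h1 : ∀ (X : ΓV.carrier),
        ∑ i : Fin (n + 2), (-1 : ℤ) ^ (i : ℕ) •
          D.nabla ((Matrix.vecCons X Y : Fin (n + 2) → ΓV.carrier) i)
            (T (i.removeNth (Matrix.vecCons X Y : Fin (n + 2) → ΓV.carrier))) =
        D.nabla X (T Y) + ∑ i : Fin (n + 1), (-1 : ℤ) ^ ((i : ℕ) + 1) •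
          D.nabla (Y i) (T (Matrix.vecCons X (i.removeNth Y))) := by
      intro X
      rw [Fin.sum_univ_succ]
      congr 1
      · simp [Fin.removeNth_zero]
      · refine Finset.sum_congr rfl fun i _ => ?_
        rw [removeNth_succ_vecCons]
        rfl
    have h2 : ∀ (X : ΓV.carrier),
        (∑ i : Fin (n + 1), ∑ j ∈ Finset.Ici i, (-1 : ℤ) ^ ((i : ℕ) + ((j : ℕ) + 1)) •
        T (Matrix.vecCons (B.bracket ((Matrix.vecCons X Y : Fin (n + 2) → ΓV.carrier) i.castSucc)
            ((Matrix.vecCons X Y : Fin (n + 2) → ΓV.carrier) j.succ))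
          (j.removeNth (i.castSucc.removeNth (Matrix.vecCons X Y : Fin (n + 2) → ΓV.carrier))))) =
        (∑ j : Fin (n + 1), (-1 : ℤ) ^ ((j : ℕ) + 1) •
          T (Matrix.vecCons (B.bracket X (Y j)) (j.removeNth Y))) +
        ∑ i : Fin n, ∑ j ∈ Finset.Ici i.succ, (-1 : ℤ) ^ ((i : ℕ) + 1 + ((j : ℕ) + 1)) •
        T (Matrix.vecCons (B.bracket (Y i.castSucc) (Y j))
          (j.removeNth (Matrix.vecCons X (i.castSucc.removeNth Y)))) := by
      intro X
      rw [Fin.sum_univ_succ]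
      congr 1
      · have : Finset.Ici (0 : Fin (n + 1)) = Finset.univ := by ext; simp
        rw [this]
        refine Finset.sum_congr rfl fun j _ => ?_
        simp [Fin.removeNth_zero]
      · refine Finset.sum_congr rfl fun i _ => Finset.sum_congr rfl fun j _ => ?_
        have hj : (Matrix.vecCons X Y : Fin (n + 2) → ΓV.carrier) j.succ = Y j := rfl
        have hi : (Matrix.vecCons X Y : Fin (n + 2) → ΓV.carrier) i.succ.castSucc =
          Y i.castSucc := rfl
        have hr : i.succ.castSucc.removeNth (Matrix.vecCons X Y : Fin (n + 2) → ΓV.carrier) =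
            Matrix.vecCons X (i.castSucc.removeNth Y) := by
          rw [← Fin.succ_castSucc]
          exact removeNth_succ_vecCons _ _ _
        rw [hj, hi, hr, Fin.val_succ]
    rw [koszul_apply_succ, koszul_apply_succ, h1, h1, h2, h2]
    have h3 : ∀ i : Fin (n + 1), D.nabla (Y i) (T (Matrix.vecCons (f • X) (i.removeNth Y))) =
        f • D.nabla (Y i) (T (Matrix.vecCons X (i.removeNth Y))) +
          dirDeriv (B.toVF (Y i)) f • T (Matrix.vecCons X (i.removeNth Y)) := by
      intro i
      rw [hT.vecCons, D.leibniz]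
    have h4 : ∀ j : Fin (n + 1), T (Matrix.vecCons (B.bracket (f • X) (Y j)) (j.removeNth Y)) =
        f • T (Matrix.vecCons (B.bracket X (Y j)) (j.removeNth Y)) -
          dirDeriv (B.toVF (Y j)) f • T (Matrix.vecCons X (j.removeNth Y)) := by
      intro j
      rw [B.leibniz_left, ← AlternatingMap.curryLeft_apply_apply, map_sub,
        AlternatingMap.sub_apply, AlternatingMap.curryLeft_apply_apply,
        AlternatingMap.curryLeft_apply_apply, hT.vecCons, hT.vecCons]
    have h5 : ∀ i : Fin n, ∀ j ∈ Finset.Ici i.succ,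
        T (Matrix.vecCons (B.bracket (Y i.castSucc) (Y j))
          (j.removeNth (Matrix.vecCons (f • X) (i.castSucc.removeNth Y)))) =
        f • T (Matrix.vecCons (B.bracket (Y i.castSucc) (Y j))
          (j.removeNth (Matrix.vecCons X (i.castSucc.removeNth Y)))) := by
      intro i j hj
      apply hT.vecCons_removeNth
      rintro rfl
      simp at hj
    have h6 : ∀ (g : Fin n → Fin (n + 1) → ΓW.carrier) (h : Fin n → Fin (n + 1) → ΓW.carrier),
        (∀ i, ∀ j ∈ Finset.Ici i.succ, g i j = h i j) →
        ∑ i : Fin n, ∑ j ∈ Finset.Ici i.succ, (-1 : ℤ) ^ ((i : ℕ) + 1 + ((j : ℕ) + 1)) • g i j =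
        ∑ i : Fin n, ∑ j ∈ Finset.Ici i.succ, (-1 : ℤ) ^ ((i : ℕ) + 1 + ((j : ℕ) + 1)) • h i j :=
      fun g h hgh => Finset.sum_congr rfl fun i _ => Finset.sum_congr rfl fun j hj => by
        rw [hgh i j hj]
    rw [D.smul_left, h6 _ _ h5]
    simp only [h3, h4, smul_add_aux, smul_sum_aux, smul_zsmul_aux, smul_add, smul_sub,
      Finset.sum_add_distrib, Finset.sum_sub_distrib]
    abel

/-- The differential `d` on forms, given on sections by the Koszul formula. -/
def dForm [IsFull ΓV] {B : AnchoredBracket ΓV} (D : Connection B ΓW) (n : ℕ) :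
    (altForms ΓV ΓW n).carrier →ₗ[ℝ] (altForms ΓV ΓW (n + 1)).carrier where
  toFun α := descend (koszul D (onSections α)) (koszul_isTensorial D (onSections_isTensorial α))
  map_add' α β := by
    apply onSections_injective
    simp only [onSections_descend, onSections_add]
    exact koszul_add D _ _
  map_smul' c α := by
    apply onSections_injective
    simp only [RingHom.id_apply, onSections_descend, onSections_smul]
    exact koszul_smul D _ _

/-- The differential is given on sections by the Koszul formula. -/
theorem onSections_dForm [IsFull ΓV] {B : AnchoredBracket ΓV} (D : Connection B ΓW) (n : ℕ)
    (α : (altForms ΓV ΓW n).carrier) :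
    onSections (dForm D n α) = koszul D (onSections α) :=
  onSections_descend (koszul D (onSections α))
    (koszul_isTensorial D (onSections_isTensorial α))

end Differential

end Basic

variable {E : Type*} [NormedAddCommGroup E] [NormedSpace ℝ E]
  {M : Type*} [TopologicalSpace M] [ChartedSpace E M]

section Full

variable [FiniteDimensional ℝ E] [IsManifold 𝓘(ℝ, E) ∞ M] [T2Space M] [SigmaCompactSpace M]
  {F : Type*} [NormedAddCommGroup F] [NormedSpace ℝ F] [FiniteDimensional ℝ F]
  {A : M → Type*} [TopologicalSpace (TotalSpace F A)] [∀ x, TopologicalSpace (A x)]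
  [∀ x, AddCommGroup (A x)] [∀ x, Module ℝ (A x)] [FiberBundle F A] [VectorBundle ℝ F A]
  [ContMDiffVectorBundle ∞ F A 𝓘(ℝ, E)]

/-- Every vector of a vector bundle is the value of a smooth section. -/
theorem exists_section_eq (x : M) (v : A x) : ∃ X : (smoothSections E F A).carrier, X.1 x = v := by
  classical
  obtain ⟨s, hs⟩ := exists_contMDiffSection_forall_mem_convex_of_local (F_fiber := F) (n := ⊤)
    𝓘(ℝ, E) A (fun y => {w | ∀ h : y = x, w = h ▸ v})
    (fun y => by
      intro a ha b hb s t _ _ hst h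
      subst h
      rw [ha rfl, hb rfl, ← add_smul, hst, one_smul])
    (fun y => by
      by_cases h : y = x
      · subst h
        obtain ⟨u, hu, hu'⟩ := FiberBundle.exists_contMDiffOn_extend (k := ∞) 𝓘(ℝ, E) F v
        refine ⟨u, hu, _, hu', ?_⟩
        intro z _ hz
        subst hz
        simp
      · refine ⟨{x}ᶜ, isOpen_compl_singleton.mem_nhds h, 0,
          (contMDiff_zeroSection ℝ A).contMDiffOn, fun z hz hzx => absurd hzx hz⟩)
  exact ⟨⟨s, s.contMDiff⟩, hs x rfl⟩

theorem exists_bump {U : Set M} (hU : IsOpen U) {x : M} (hx : x ∈ U) :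
    ∃ f : C^∞⟮𝓘(ℝ, E), M; 𝓘(ℝ, ℝ), ℝ⟯, tsupport f ⊆ U ∧ f x = 1 := by
  obtain ⟨f, -, hf⟩ := (SmoothBumpFunction.nhds_basis_tsupport (I := 𝓘(ℝ, E)) x).mem_iff.1
    (hU.mem_nhds hx)
  exact ⟨⟨f, f.contMDiff⟩, hf, f.eq_one⟩

instance smoothSections_isFull : IsFull (smoothSections E F A) where
  exists_eq := exists_section_eq
  exists_sum := by
    intro x X hX
    let e := trivializationAt F A x
    have hxe : x ∈ e.baseSet := FiberBundle.mem_baseSet_trivializationAt F A x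
    have : ContMDiffVectorBundle 1 F A 𝓘(ℝ, E) := ContMDiffVectorBundle.of_le (n := ∞) (by norm_num)
    let b := Module.finBasis ℝ F
    obtain ⟨ψ, hψ, hψx⟩ := exists_bump (E := E) e.open_baseSet hxe
    set k := Module.finrank ℝ F
    have hc : ∀ i, ContMDiff 𝓘(ℝ, E) 𝓘(ℝ, ℝ) ∞
        (fun y => ψ y * e.localFrameCoeff 𝓘(ℝ, E) b i y (X.1 y)) := by
      intro i
      apply contMDiff_of_tsupport
      intro y hy
      have hy' : y ∈ e.baseSet := hψ (closure_mono (Function.support_mul_subset_left _ _) hy)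
      exact ψ.contMDiff.contMDiffAt.mul (contMDiffAt_localFrameCoeff b hy' X.2.contMDiffAt i)
    let c : Fin k → C^∞⟮𝓘(ℝ, E), M; 𝓘(ℝ, ℝ), ℝ⟯ := fun i => ⟨_, hc i⟩
    let s : Fin k → (smoothSections E F A).carrier := fun i =>
      ⟨fun y => ψ y • e.localFrame b i y,
        ContMDiffOn.smul_section_of_tsupport ψ.contMDiff.contMDiffOn e.open_baseSet hψ
          (e.contMDiffOn_localFrame_baseSet ∞ b i)⟩
    refine ⟨k + 1, Fin.cons (1 - ψ * ψ) c, Fin.cons X s, ?_, ?_⟩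
    · intro i
      refine Fin.cases ?_ (fun i => ?_) i
      · change 1 - ψ x * ψ x = 0
        simp [hψx]
      · change ψ x * e.localFrameCoeff 𝓘(ℝ, E) b i x (X.1 x) = 0
        simp [hX]
    · rw [Fin.sum_univ_succ]
      apply Subtype.ext; funext y
      simp only [Fin.cons_zero, Fin.cons_succ, Submodule.coe_add, Pi.add_apply, Submodule.coe_sum,
        Finset.sum_apply, smul_apply']
      change X.1 y = (1 - ψ y * ψ y) • X.1 y + ∑ i, (ψ y *
        e.localFrameCoeff 𝓘(ℝ, E) b i y (X.1 y)) • ψ y • e.localFrame b i y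
      by_cases hy : y ∈ e.baseSet
      · have h := e.eq_sum_localFrameCoeff_smul (I := 𝓘(ℝ, E)) (b := b) (s := X.1) hy
        have h2 : ∑ i, (ψ y * e.localFrameCoeff 𝓘(ℝ, E) b i y (X.1 y)) • ψ y • e.localFrame b i y =
            (ψ y * ψ y) • X.1 y := by
          conv_rhs => rw [h, Finset.smul_sum]
          refine Finset.sum_congr rfl fun i _ => ?_
          rw [smul_smul, smul_smul]
          congr 1
          ring
        rw [h2, ← add_smul, sub_add_cancel, one_smul]
      · have h0 : ψ y = 0 := image_eq_zero_of_notMem_tsupport fun h => hy (hψ h)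
        simp [h0]

end Full

/-! ### Lie algebroids -/

/-- A (smooth, real) Lie algebroid over `M`: a smooth vector bundle `A → M`, a Lie bracket on its
smooth sections, and an anchor `A → TM`, a smooth vector bundle map such that
`[X, f Y] = f [X, Y] + (♯X f) Y` and `♯[X, Y] = [♯X, ♯Y]`. -/
structure LieAlgebroid (E : Type*) [NormedAddCommGroup E] [NormedSpace ℝ E]
    {M : Type*} [TopologicalSpace M] [ChartedSpace E M] [IsManifold 𝓘(ℝ, E) ∞ M]
    (F : Type*) [NormedAddCommGroup F] [NormedSpace ℝ F] (A : M → Type*)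
    [TopologicalSpace (TotalSpace F A)] [∀ x, TopologicalSpace (A x)] [∀ x, AddCommGroup (A x)]
    [∀ x, Module ℝ (A x)] [∀ x, IsTopologicalAddGroup (A x)] [∀ x, ContinuousSMul ℝ (A x)]
    [FiberBundle F A] [VectorBundle ℝ F A] where
  anchor : Cₛ^∞⟮𝓘(ℝ, E); F →L[ℝ] E, fun x : M => A x →L[ℝ] TangentSpace 𝓘(ℝ, E) x⟯
  bracket : (smoothSections E F A).carrier →ₗ[ℝ] (smoothSections E F A).carrier →ₗ[ℝ]
    (smoothSections E F A).carrier
  bracket_self : ∀ X, bracket X X = 0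
  jacobi : ∀ X Y Z, bracket X (bracket Y Z) = bracket (bracket X Y) Z + bracket Y (bracket X Z)
  leibniz : ∀ (X Y : (smoothSections E F A).carrier) (f : C^∞⟮𝓘(ℝ, E), M; 𝓘(ℝ, ℝ), ℝ⟯) (x : M),
    (bracket X (f • Y)).1 x =
      f x • (bracket X Y).1 x + mvfderiv 𝓘(ℝ, E) f x (anchor x (X.1 x)) • Y.1 x
  anchor_bracket : ∀ (X Y : (smoothSections E F A).carrier) (x : M),
    anchor x ((bracket X Y).1 x) = VectorField.mlieBracket 𝓘(ℝ, E)
      (fun y => anchor y (X.1 y)) (fun y => anchor y (Y.1 y)) x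

namespace LieAlgebroid

variable [IsManifold 𝓘(ℝ, E) ∞ M]
  {F : Type*} [NormedAddCommGroup F] [NormedSpace ℝ F]
  {A : M → Type*} [TopologicalSpace (TotalSpace F A)] [∀ x, TopologicalSpace (A x)]
  [∀ x, AddCommGroup (A x)] [∀ x, Module ℝ (A x)]
  [∀ x, IsTopologicalAddGroup (A x)] [∀ x, ContinuousSMul ℝ (A x)]
  [FiberBundle F A] [VectorBundle ℝ F A]
  (𝒜 : LieAlgebroid E F A)

/-- The isotropy `K = ker ♯`. -/
def K (x : M) : Submodule ℝ (A x) := LinearMap.ker (𝒜.anchor x : A x →ₗ[ℝ] TangentSpace 𝓘(ℝ, E) x)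

/-- The tangent spaces `T𝓕 = im ♯` of the orbits. -/
def TF (x : M) : Submodule ℝ (TangentSpace 𝓘(ℝ, E) x) :=
  LinearMap.range (𝒜.anchor x : A x →ₗ[ℝ] TangentSpace 𝓘(ℝ, E) x)

/-- A Lie algebroid is regular if its anchor has constant rank. -/
class IsRegular : Prop where
  exists_rank : ∃ r : ℕ, ∀ x, Module.finrank ℝ (𝒜.TF x) = r

/-- The isotropy is abelian if the bracket of any two sections of `K = ker ♯` vanishes. -/
class HasAbelianIsotropy : Prop where
  bracket_eq_zero : ∀ X Y : (smoothSections E F A).carrier,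
    (∀ x, X.1 x ∈ 𝒜.K x) → (∀ x, Y.1 x ∈ 𝒜.K x) → 𝒜.bracket X Y = 0

/-- The smooth sections of `K`. -/
def sectionsK : SectionSpace E (fun x => 𝒜.K x) where
  carrier :=
    { carrier := {V | (fun x => (V x : A x)) ∈ (smoothSections E F A).carrier}
      add_mem' := fun hV hW => (smoothSections E F A).carrier.add_mem hV hW
      zero_mem' := (smoothSections E F A).carrier.zero_mem
      smul_mem' := fun c _ hV => (smoothSections E F A).carrier.smul_mem c hV }
  smul_mem f _ hV := (smoothSections E F A).smul_mem f hV

/-- The smooth sections of `T𝓕`. -/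
def sectionsTF : SectionSpace E (fun x => 𝒜.TF x) where
  carrier :=
    { carrier := {Y | (fun x => (Y x : TangentSpace 𝓘(ℝ, E) x)) ∈ (vectorFields E M).carrier}
      add_mem' := fun hV hW => (vectorFields E M).carrier.add_mem hV hW
      zero_mem' := (vectorFields E M).carrier.zero_mem
      smul_mem' := fun c _ hV => (vectorFields E M).carrier.smul_mem c hV }
  smul_mem f _ hV := (vectorFields E M).smul_mem f hV

theorem anchor_mem [ContMDiffVectorBundle ∞ F A 𝓘(ℝ, E)] (X : (smoothSections E F A).carrier) :
    (fun x => 𝒜.anchor x (X.1 x)) ∈ (vectorFields E M).carrier :=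
  ContMDiff.clm_bundle_apply 𝒜.anchor.contMDiff X.2

/-- A smooth splitting of the anchor `♯ : A → T𝓕`: a right inverse `σ : T𝓕 → A` which is linear
on the fibers and maps smooth sections to smooth sections. -/
structure Splitting where
  toFun : ∀ x, 𝒜.TF x →ₗ[ℝ] A x
  smooth : ∀ Y : 𝒜.sectionsTF.carrier, (fun x => toFun x (Y.1 x)) ∈ (smoothSections E F A).carrier
  anchor_apply : ∀ x (y : 𝒜.TF x), 𝒜.anchor x (toFun x y) = y

/-- Generalized inverses of linear maps of the same rank as a given one. -/
theorem generalized_inverse {E' F' : Type*} [NormedAddCommGroup E'] [NormedSpace ℝ E']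
    [NormedAddCommGroup F'] [NormedSpace ℝ F'] [FiniteDimensional ℝ E']
    {N N₀ : F' →L[ℝ] E'} {T₀ : E' →L[ℝ] F'} (h1 : N₀ ∘L T₀ ∘L N₀ = N₀) (h2 : T₀ ∘L N₀ ∘L T₀ = T₀)
    (hr : Module.finrank ℝ (LinearMap.range (N : F' →ₗ[ℝ] E')) =
      Module.finrank ℝ (LinearMap.range (N₀ : F' →ₗ[ℝ] E')))
    (hu : IsUnit (1 + (N - N₀) ∘L T₀)) :
    N ∘L (T₀ ∘L Ring.inverse (1 + (N - N₀) ∘L T₀)) ∘L N = N := by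
  set u := 1 + (N - N₀) ∘L T₀ with hu'
  have huv : Ring.inverse u * u = 1 := Ring.inverse_mul_cancel u hu
  have key : ∀ w, u (N₀ (T₀ w)) = N (T₀ w) := by
    intro w
    have e2 : T₀ (N₀ (T₀ w)) = T₀ w := by simpa using DFunLike.congr_fun h2 w
    simp only [hu', add_apply, one_apply_eq_self,
      ContinuousLinearMap.comp_apply, sub_apply, e2]
    abel
  have hinj : Function.Injective u := by
    intro a b hab
    have h : ∀ z, (Ring.inverse u) (u z) = z := fun z => DFunLike.congr_fun huv z
    rw [← h a, hab, h b]
  have hmap : (LinearMap.range (N₀ : F' →ₗ[ℝ] E')).map (u : E' →ₗ[ℝ] E') =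
      LinearMap.range (N : F' →ₗ[ℝ] E') := by
    apply Submodule.eq_of_le_of_finrank_eq
    · rintro _ ⟨_, ⟨w, rfl⟩, rfl⟩
      have e1 : N₀ (T₀ (N₀ w)) = N₀ w := by simpa using DFunLike.congr_fun h1 w
      refine ⟨T₀ (N₀ w), ?_⟩
      change N (T₀ (N₀ w)) = u (N₀ w)
      rw [← key, e1]
    · rw [hr]
      exact (LinearEquiv.finrank_eq (Submodule.equivMapOfInjective _ hinj _)).symm
  ext w
  have : N w ∈ (LinearMap.range (N₀ : F' →ₗ[ℝ] E')).map (u : E' →ₗ[ℝ] E') := by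
    rw [hmap]; exact ⟨w, rfl⟩
  obtain ⟨_, ⟨z, rfl⟩, hz⟩ := this
  change u (N₀ z) = N w at hz
  have e1 : N₀ (T₀ (N₀ z)) = N₀ z := by simpa using DFunLike.congr_fun h1 z
  have e3 : (Ring.inverse u) (u (N₀ z)) = N₀ z := DFunLike.congr_fun huv (N₀ z)
  change N (T₀ ((Ring.inverse u) (N w))) = N w
  rw [← hz, e3, ← key, e1]

theorem exists_generalized_inverse {E' F' : Type*} [NormedAddCommGroup E'] [NormedSpace ℝ E']
    [NormedAddCommGroup F'] [NormedSpace ℝ F'] [FiniteDimensional ℝ E'] [FiniteDimensional ℝ F']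
    (N : F' →L[ℝ] E') : ∃ T : E' →L[ℝ] F', N ∘L T ∘L N = N ∧ T ∘L N ∘L T = T := by
  obtain ⟨s, hs⟩ := (N : F' →ₗ[ℝ] E').rangeRestrict.exists_rightInverse_of_surjective
    (LinearMap.range_rangeRestrict _)
  obtain ⟨p, hp⟩ := Submodule.exists_isCompl (LinearMap.range (N : F' →ₗ[ℝ] E'))
  obtain ⟨P, hP⟩ := (LinearMap.range (N : F' →ₗ[ℝ] E')).subtype.exists_leftInverse_of_injective
    (Submodule.ker_subtype _)
  have hN : ∀ r : LinearMap.range (N : F' →ₗ[ℝ] E'), N (s r) = r := fun r =>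
    congrArg Subtype.val (LinearMap.congr_fun hs r)
  have hP' : ∀ r : LinearMap.range (N : F' →ₗ[ℝ] E'), P r = r := fun r => LinearMap.congr_fun hP r
  refine ⟨LinearMap.toContinuousLinearMap (s ∘ₗ P), ?_, ?_⟩
  · ext w
    change N (s (P (N w))) = N w
    rw [hN]
    exact congrArg Subtype.val (hP' ⟨N w, w, rfl⟩)
  · ext w
    change s (P (N (s (P w)))) = s (P w)
    rw [hN, hP']

variable [FiniteDimensional ℝ E] [FiniteDimensional ℝ F] [T2Space M] [SigmaCompactSpace M]
  [ContMDiffVectorBundle ∞ F A 𝓘(ℝ, E)]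

/-- The anchor of a regular Lie algebroid has a smooth generalized inverse. -/
theorem exists_inverse [h : 𝒜.IsRegular] :
    ∃ s : Cₛ^∞⟮𝓘(ℝ, E); E →L[ℝ] F, fun x : M => TangentSpace 𝓘(ℝ, E) x →L[ℝ] A x⟯,
      ∀ x a, 𝒜.anchor x (s x (𝒜.anchor x a)) = 𝒜.anchor x a := by
  apply exists_contMDiffSection_forall_mem_convex_of_local (n := ⊤) 𝓘(ℝ, E)
    (fun x : M => TangentSpace 𝓘(ℝ, E) x →L[ℝ] A x)
    (fun x => {s | ∀ a, 𝒜.anchor x (s (𝒜.anchor x a)) = 𝒜.anchor x a})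
  · intro x s hs t ht a b _ _ hab c
    simp [hs c, ht c, ← add_smul, hab]
  · intro x
    obtain ⟨r, hr⟩ := h.exists_rank
    let eA := trivializationAt F A x
    let eT := trivializationAt E (fun y : M => TangentSpace 𝓘(ℝ, E) y) x
    let B : Set M := eA.baseSet ∩ eT.baseSet
    have hB : IsOpen B := eA.open_baseSet.inter eT.open_baseSet
    have hxB : x ∈ B := ⟨FiberBundle.mem_baseSet_trivializationAt F A x,
      FiberBundle.mem_baseSet_trivializationAt E (fun y : M => TangentSpace 𝓘(ℝ, E) y) x⟩
    let N : M → F →L[ℝ] E := fun y => ContinuousLinearMap.inCoordinates F A E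
      (fun y : M => TangentSpace 𝓘(ℝ, E) y) x y x y (𝒜.anchor y)
    have hN : ContMDiffOn 𝓘(ℝ, E) 𝓘(ℝ, F →L[ℝ] E) ∞ N B :=
      ((trivializationAt (F →L[ℝ] E) (fun y : M => A y →L[ℝ] TangentSpace 𝓘(ℝ, E) y)
        x).contMDiffOn_section_iff hB subset_rfl).1 𝒜.anchor.contMDiff.contMDiffOn
    have hNeq : ∀ y (hy : y ∈ B), N y = (eT.continuousLinearEquivAt ℝ y hy.2 :
        TangentSpace 𝓘(ℝ, E) y →L[ℝ] E).comp ((𝒜.anchor y).comp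
          ((eA.continuousLinearEquivAt ℝ y hy.1).symm : F →L[ℝ] A y)) := fun y hy =>
      ContinuousLinearMap.inCoordinates_eq hy.1 hy.2
    have hrank : ∀ y ∈ B, Module.finrank ℝ (LinearMap.range (N y : F →ₗ[ℝ] E)) = r := by
      intro y hy
      rw [← hr y]
      have : LinearMap.range (N y : F →ₗ[ℝ] E) =
          (𝒜.TF y).map (eT.continuousLinearEquivAt ℝ y hy.2).toLinearEquiv.toLinearMap := by
        rw [hNeq y hy, TF]
        ext w
        constructor
        · rintro ⟨a, rfl⟩
          exact ⟨_, ⟨_, rfl⟩, rfl⟩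
        · rintro ⟨_, ⟨a, rfl⟩, rfl⟩
          refine ⟨eA.continuousLinearEquivAt ℝ y hy.1 a, ?_⟩
          change eT.continuousLinearEquivAt ℝ y hy.2 (𝒜.anchor y
            ((eA.continuousLinearEquivAt ℝ y hy.1).symm (eA.continuousLinearEquivAt ℝ y hy.1 a))) =
              eT.continuousLinearEquivAt ℝ y hy.2 (𝒜.anchor y a)
          rw [ContinuousLinearEquiv.symm_apply_apply]
      rw [this]
      exact LinearEquiv.finrank_map_eq _ _
    obtain ⟨T₀, h1, h2⟩ := exists_generalized_inverse (N x)
    let u : M → E →L[ℝ] E := fun y => 1 + (N y - N x) ∘L T₀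
    have hu : ContMDiffOn 𝓘(ℝ, E) 𝓘(ℝ, E →L[ℝ] E) ∞ u B :=
      contMDiffOn_const.add ((hN.sub contMDiffOn_const).clm_comp contMDiffOn_const)
    let U : Set M := B ∩ u ⁻¹' {w | IsUnit w}
    have hU : IsOpen U := hu.continuousOn.isOpen_inter_preimage hB Units.isOpen
    have hxU : x ∈ U := ⟨hxB, by simp [u]⟩
    let S : M → E →L[ℝ] F := fun y => T₀ ∘L Ring.inverse (u y)
    have hS : ContMDiffOn 𝓘(ℝ, E) 𝓘(ℝ, E →L[ℝ] F) ∞ S U := by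
      refine ContMDiffOn.clm_comp contMDiffOn_const ?_
      intro y hy
      obtain ⟨w, hw⟩ := hy.2
      have h3 : ContDiffAt ℝ ∞ Ring.inverse (u y) := hw ▸ contDiffAt_ringInverse ℝ w
      exact (h3.contMDiffAt.comp y (hu.contMDiffAt (hB.mem_nhds hy.1))).contMDiffWithinAt
    classical
    let s : ∀ y : M, TangentSpace 𝓘(ℝ, E) y →L[ℝ] A y := fun y =>
      (eA.symmL ℝ y).comp ((S y).comp (eT.continuousLinearMapAt ℝ y))
    have hs : ∀ y (hy : y ∈ B) w, s y w = (eA.continuousLinearEquivAt ℝ y hy.1).symm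
        (S y (eT.continuousLinearEquivAt ℝ y hy.2 w)) := by
      intro y hy w
      change eA.symmL ℝ y (S y (eT.continuousLinearMapAt ℝ y w)) = _
      rw [Trivialization.coe_continuousLinearEquivAt_eq,
        Trivialization.symm_continuousLinearEquivAt_eq]
    refine ⟨U, hU.mem_nhds hxU, s, ?_, ?_⟩
    · refine ((trivializationAt (E →L[ℝ] F) (fun y : M => TangentSpace 𝓘(ℝ, E) y →L[ℝ] A y)
        x).contMDiffOn_section_iff hU (fun y hy => ⟨hy.1.2, hy.1.1⟩)).2 ?_
      refine hS.congr fun y hy => ?_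
      change ContinuousLinearMap.inCoordinates E (fun y : M => TangentSpace 𝓘(ℝ, E) y) F A
        x y x y (s y) = S y
      rw [ContinuousLinearMap.inCoordinates_eq hy.1.2 hy.1.1]
      ext w
      change eA.continuousLinearEquivAt ℝ y hy.1.1
        (s y ((eT.continuousLinearEquivAt ℝ y hy.1.2).symm w)) = S y w
      rw [hs y hy.1, ContinuousLinearEquiv.apply_symm_apply,
        ContinuousLinearEquiv.apply_symm_apply]
    · intro y hy a
      have h3 := generalized_inverse h1 h2 ((hrank y hy.1).trans (hrank x hxB).symm) hy.2
      have h4 := DFunLike.congr_fun h3 (eA.continuousLinearEquivAt ℝ y hy.1.1 a)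
      change N y (S y (N y (eA.continuousLinearEquivAt ℝ y hy.1.1 a))) =
        N y (eA.continuousLinearEquivAt ℝ y hy.1.1 a) at h4
      have h5 : ∀ w, N y w = eT.continuousLinearEquivAt ℝ y hy.1.2 (𝒜.anchor y
          ((eA.continuousLinearEquivAt ℝ y hy.1.1).symm w)) := fun w => by rw [hNeq y hy.1]; rfl
      simp only [h5, ContinuousLinearEquiv.symm_apply_apply] at h4
      rw [← hs y hy.1] at h4
      exact (eT.continuousLinearEquivAt ℝ y hy.1.2).injective h4

/-- A regular Lie algebroid admits a splitting. -/
theorem exists_splitting [𝒜.IsRegular] : Nonempty 𝒜.Splitting := by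
  obtain ⟨s, hs⟩ := 𝒜.exists_inverse
  refine ⟨⟨fun x => (s x : TangentSpace 𝓘(ℝ, E) x →ₗ[ℝ] A x) ∘ₗ (𝒜.TF x).subtype, ?_, ?_⟩⟩
  · intro Y
    exact ContMDiff.clm_bundle_apply s.contMDiff Y.2
  · rintro x ⟨_, a, rfl⟩
    exact hs x a

/-- The anchor as a map `Γ(A) → Γ(T𝓕)`. -/
def anchorTF : (smoothSections E F A).carrier →ₗ[ℝ] 𝒜.sectionsTF.carrier where
  toFun X := ⟨fun x => ⟨𝒜.anchor x (X.1 x), X.1 x, rfl⟩, 𝒜.anchor_mem X⟩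
  map_add' X Y := by
    apply Subtype.ext; funext x; apply Subtype.ext
    exact map_add (𝒜.anchor x) _ _
  map_smul' c X := by
    apply Subtype.ext; funext x; apply Subtype.ext
    exact map_smul (𝒜.anchor x) _ _

/-- The inclusion `Γ(K) → Γ(A)`. -/
def inclK : 𝒜.sectionsK.carrier →ₗ[ℝ] (smoothSections E F A).carrier where
  toFun V := ⟨fun x => V.1 x, V.2⟩
  map_add' _ _ := rfl
  map_smul' _ _ := rfl

/-- A section of `A` with values in `K`, as a section of `K`. -/
def toK (X : (smoothSections E F A).carrier) (hX : 𝒜.anchorTF X = 0) : 𝒜.sectionsK.carrier :=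
  ⟨fun x => ⟨X.1 x, congrArg Subtype.val (congrFun (congrArg Subtype.val hX) x)⟩, X.2⟩

theorem inclK_injective : Function.Injective 𝒜.inclK := by
  intro V W h
  apply Subtype.ext; funext x; apply Subtype.ext
  exact congrFun (congrArg Subtype.val h) x

@[simp] theorem inclK_toK (X : (smoothSections E F A).carrier) (hX : 𝒜.anchorTF X = 0) :
    𝒜.inclK (𝒜.toK X hX) = X := rfl

@[simp] theorem anchorTF_inclK (V : 𝒜.sectionsK.carrier) : 𝒜.anchorTF (𝒜.inclK V) = 0 := by
  apply Subtype.ext; funext x; apply Subtype.ext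
  exact (V.1 x).2

theorem inclK_smul (f : C^∞⟮𝓘(ℝ, E), M; 𝓘(ℝ, ℝ), ℝ⟯) (V : 𝒜.sectionsK.carrier) :
    𝒜.inclK (f • V) = f • 𝒜.inclK V := rfl

theorem anchorTF_smul (f : C^∞⟮𝓘(ℝ, E), M; 𝓘(ℝ, ℝ), ℝ⟯) (X : (smoothSections E F A).carrier) :
    𝒜.anchorTF (f • X) = f • 𝒜.anchorTF X := by
  apply Subtype.ext; funext x; apply Subtype.ext
  exact map_smul (𝒜.anchor x) _ _

variable {𝒜}

/-- A splitting as a map `Γ(T𝓕) → Γ(A)`. -/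
def Splitting.onSec (σ : 𝒜.Splitting) :
    𝒜.sectionsTF.carrier →ₗ[ℝ] (smoothSections E F A).carrier where
  toFun Y := ⟨fun x => σ.toFun x (Y.1 x), σ.smooth Y⟩
  map_add' X Y := by
    apply Subtype.ext; funext x
    exact map_add (σ.toFun x) _ _
  map_smul' c X := by
    apply Subtype.ext; funext x
    exact map_smul (σ.toFun x) _ _

theorem Splitting.onSec_smul (σ : 𝒜.Splitting) (f : C^∞⟮𝓘(ℝ, E), M; 𝓘(ℝ, ℝ), ℝ⟯)
    (Y : 𝒜.sectionsTF.carrier) : σ.onSec (f • Y) = f • σ.onSec Y := by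
  apply Subtype.ext; funext x
  exact map_smul (σ.toFun x) _ _

@[simp] theorem Splitting.anchorTF_onSec (σ : 𝒜.Splitting) (Y : 𝒜.sectionsTF.carrier) :
    𝒜.anchorTF (σ.onSec Y) = Y := by
  apply Subtype.ext; funext x; apply Subtype.ext
  exact σ.anchor_apply x _

variable (𝒜)

instance sectionsTF_isFull [𝒜.IsRegular] : IsFull 𝒜.sectionsTF where
  exists_eq := by
    rintro x ⟨_, a, rfl⟩
    obtain ⟨X, rfl⟩ := exists_section_eq (E := E) (F := F) x a
    exact ⟨𝒜.anchorTF X, rfl⟩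
  exists_sum := by
    intro x Y hY
    obtain ⟨σ⟩ := 𝒜.exists_splitting
    have h0 : (σ.onSec Y).1 x = 0 := by
      change σ.toFun x (Y.1 x) = 0
      rw [hY, map_zero]
    obtain ⟨k, f, s, hf, hs⟩ := IsFull.exists_sum x (σ.onSec Y) h0
    refine ⟨k, f, fun i => 𝒜.anchorTF (s i), hf, ?_⟩
    rw [← σ.anchorTF_onSec Y, hs, map_sum]
    simp only [anchorTF_smul]

instance sectionsK_isFull [𝒜.IsRegular] : IsFull 𝒜.sectionsK where
  exists_eq := by
    intro x v
    obtain ⟨σ⟩ := 𝒜.exists_splitting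
    obtain ⟨X, hX⟩ := exists_section_eq (E := E) (F := F) x (v : A x)
    refine ⟨𝒜.toK (X - σ.onSec (𝒜.anchorTF X)) (by simp), ?_⟩
    apply Subtype.ext
    have h1 : (𝒜.anchorTF X).1 x = 0 := by
      apply Subtype.ext
      change 𝒜.anchor x (X.1 x) = 0
      rw [hX]
      exact v.2
    change X.1 x - σ.toFun x ((𝒜.anchorTF X).1 x) = v
    rw [h1, map_zero, sub_zero, hX]
  exists_sum := by
    intro x V hV
    obtain ⟨σ⟩ := 𝒜.exists_splitting
    obtain ⟨k, f, s, hf, hs⟩ := IsFull.exists_sum x (𝒜.inclK V) (congrArg Subtype.val hV)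
    refine ⟨k, f, fun i => 𝒜.toK (s i - σ.onSec (𝒜.anchorTF (s i))) (by simp), hf, ?_⟩
    apply 𝒜.inclK_injective
    have h1 : 𝒜.inclK V - σ.onSec (𝒜.anchorTF (𝒜.inclK V)) = 𝒜.inclK V := by simp
    rw [← h1, hs, map_sum, map_sum, map_sum, ← Finset.sum_sub_distrib]
    refine Finset.sum_congr rfl fun i _ => ?_
    rw [inclK_smul, inclK_toK, smul_sub_aux, anchorTF_smul, σ.onSec_smul]

end LieAlgebroid


/-! ### Connections on spaces of alternating forms -/

section AltConnection

variable [IsManifold 𝓘(ℝ, E) ∞ M]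
  {V : M → Type*} [∀ x, AddCommGroup (V x)] [∀ x, Module ℝ (V x)]
  {W : M → Type*} [∀ x, AddCommGroup (W x)] [∀ x, Module ℝ (W x)]
  {U : M → Type*} [∀ x, AddCommGroup (U x)] [∀ x, Module ℝ (U x)]
  {ΓU : SectionSpace E U} {ΓV : SectionSpace E V} {ΓW : SectionSpace E W}
  {B : AnchoredBracket ΓU}

theorem lieDer_isTensorial (D : Connection B ΓV) (D' : Connection B ΓW) (X : ΓU.carrier) {n : ℕ}
    {T : ΓV.carrier [⋀^Fin n]→ₗ[ℝ] ΓW.carrier} (hT : IsTensorial T) :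
    IsTensorial (lieDer (D.nabla X) (D'.nabla X) T) := by
  intro v i f
  rw [lieDer_apply, lieDer_apply]
  have h1 : ∀ k, T (Function.update (Function.update v i (f • v i)) k
      (D.nabla X (Function.update v i (f • v i) k))) =
      f • T (Function.update v k (D.nabla X (v k))) +
        if k = i then dirDeriv (B.toVF X) f • T v else 0 := by
    intro k
    by_cases hk : k = i
    · subst hk
      rw [Function.update_self, Function.update_idem, D.leibniz, T.map_update_add, if_pos rfl]
      have h2 := hT (Function.update v k (D.nabla X (v k))) k f
      have h3 := hT v k (dirDeriv (B.toVF X) f)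
      rw [Function.update_self, Function.update_idem] at h2
      rw [h2, h3]
    · rw [Function.update_of_ne hk, Function.update_comm (Ne.symm hk), if_neg hk, add_zero]
      have h2 := hT (Function.update v k (D.nabla X (v k))) i f
      rw [Function.update_of_ne (Ne.symm hk)] at h2
      exact h2
  simp only [h1, Finset.sum_add_distrib, Finset.sum_ite_eq', Finset.mem_univ, if_true]
  rw [hT, D'.leibniz, smul_sub_aux, smul_sum_aux]
  abel

theorem smul_update_aux {n : ℕ} (T : (altForms ΓV ΓW n).carrier)
    (f : C^∞⟮𝓘(ℝ, E), M; 𝓘(ℝ, ℝ), ℝ⟯) : onSections (f • T) = fun v => f • onSections T v := rfl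

/-- The connection on forms induced by connections on the source and on the target:
`(∇_X T)(v₁, …, vₙ) = ∇_X (T(v₁, …, vₙ)) - ∑ᵢ T(v₁, …, ∇_X vᵢ, …, vₙ)`. -/
def altConnection [IsFull ΓV] (D : Connection B ΓV) (D' : Connection B ΓW) (n : ℕ) :
    Connection B (altForms ΓV ΓW n) where
  nabla := LinearMap.mk₂ ℝ
    (fun X T => descend (lieDer (D.nabla X) (D'.nabla X) (onSections T))
      (lieDer_isTensorial D D' X (onSections_isTensorial T)))
    (fun X Y T => by
      apply onSections_injective
      rw [onSections_add, onSections_descend, onSections_descend, onSections_descend]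
      ext1 v
      simp only [AlternatingMap.add_apply, lieDer_apply, map_add, LinearMap.add_apply,
        AlternatingMap.map_update_add, Finset.sum_add_distrib]
      abel)
    (fun c X T => by
      apply onSections_injective
      rw [onSections_smul, onSections_descend, onSections_descend]
      ext1 v
      simp only [AlternatingMap.smul_apply, lieDer_apply, map_smul, LinearMap.smul_apply,
        AlternatingMap.map_update_smul, ← Finset.smul_sum, smul_sub])
    (fun X T S => by
      apply onSections_injective
      simp only [onSections_add, onSections_descend]
      ext1 v
      simp only [AlternatingMap.add_apply, lieDer_apply, map_add,
        Finset.sum_add_distrib]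
      abel)
    (fun c X T => by
      apply onSections_injective
      simp only [onSections_smul, onSections_descend]
      ext1 v
      simp only [AlternatingMap.smul_apply, lieDer_apply, map_smul,
        ← Finset.smul_sum, smul_sub])
  smul_left f X T := by
    apply onSections_injective
    ext1 v
    rw [LinearMap.mk₂_apply, LinearMap.mk₂_apply, onSections_descend, smul_update_aux,
      onSections_descend]
    have h1 : ∀ k, onSections T (Function.update v k (f • D.nabla X (v k))) =
        f • onSections T (Function.update v k (D.nabla X (v k))) := by
      intro k
      have h2 := onSections_isTensorial T (Function.update v k (D.nabla X (v k))) k f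
      rwa [Function.update_self, Function.update_idem] at h2
    simp only [lieDer_apply, D.smul_left, D'.smul_left, h1, smul_sub_aux, smul_sum_aux]
  leibniz X f T := by
    apply onSections_injective
    ext1 v
    rw [LinearMap.mk₂_apply, LinearMap.mk₂_apply, onSections_add, AlternatingMap.add_apply,
      onSections_descend, lieDer_apply]
    simp only [smul_update_aux, onSections_descend, lieDer_apply, D'.leibniz, smul_sub_aux, smul_sum_aux]
    abel

/-- The induced connection on sections. -/
theorem onSections_altConnection [IsFull ΓV] (D : Connection B ΓV) (D' : Connection B ΓW) {n : ℕ}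
    (X : ΓU.carrier) (T : (altForms ΓV ΓW n).carrier) (v : Fin n → ΓV.carrier) :
    onSections ((altConnection D D' n).nabla X T) v = D'.nabla X (onSections T v) -
      ∑ i, onSections T (Function.update v i (D.nabla X (v i))) := by
  change onSections (descend (lieDer (D.nabla X) (D'.nabla X) (onSections T))
      (lieDer_isTensorial D D' X (onSections_isTensorial T))) v = _
  rw [onSections_descend, lieDer_apply]

end AltConnection

/-! ### Forms on a regular Lie algebroid with abelian isotropy -/

section Regular

variable [FiniteDimensional ℝ E] [IsManifold 𝓘(ℝ, E) ∞ M] [T2Space M] [SigmaCompactSpace M]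
  {F : Type*} [NormedAddCommGroup F] [NormedSpace ℝ F] [FiniteDimensional ℝ F]
  {A : M → Type*} [TopologicalSpace (TotalSpace F A)] [∀ x, TopologicalSpace (A x)]
  [∀ x, AddCommGroup (A x)] [∀ x, Module ℝ (A x)]
  [∀ x, IsTopologicalAddGroup (A x)] [∀ x, ContinuousSMul ℝ (A x)]
  [FiberBundle F A] [VectorBundle ℝ F A] [ContMDiffVectorBundle ∞ F A 𝓘(ℝ, E)]

namespace LieAlgebroid

variable (𝒜 : LieAlgebroid E F A)

/-- The bracket on `Γ(A)` with its anchor. -/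
def bracketA : AnchoredBracket (smoothSections E F A) where
  anchor x := (𝒜.anchor x : A x →ₗ[ℝ] TangentSpace 𝓘(ℝ, E) x)
  anchor_mem X := 𝒜.anchor_mem X
  bracket := 𝒜.bracket
  bracket_self := 𝒜.bracket_self
  leibniz X Y f := by
    apply Subtype.ext; funext x
    exact 𝒜.leibniz X Y f x

theorem mlieBracket_anchorTF (X Y : (smoothSections E F A).carrier) (x : M) :
    VectorField.mlieBracket 𝓘(ℝ, E) (fun y => ((𝒜.anchorTF X).1 y : TangentSpace 𝓘(ℝ, E) y))
      (fun y => ((𝒜.anchorTF Y).1 y : TangentSpace 𝓘(ℝ, E) y)) x =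
        (𝒜.anchorTF (𝒜.bracket X Y)).1 x :=
  (𝒜.anchor_bracket X Y x).symm

theorem mlieBracket_mem [𝒜.IsRegular] (Y₁ Y₂ : 𝒜.sectionsTF.carrier) (x : M) :
    VectorField.mlieBracket 𝓘(ℝ, E) (fun y => (Y₁.1 y : TangentSpace 𝓘(ℝ, E) y))
      (fun y => (Y₂.1 y : TangentSpace 𝓘(ℝ, E) y)) x ∈ 𝒜.TF x := by
  obtain ⟨σ⟩ := 𝒜.exists_splitting
  have h := 𝒜.mlieBracket_anchorTF (σ.onSec Y₁) (σ.onSec Y₂) x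
  rw [σ.anchorTF_onSec, σ.anchorTF_onSec] at h
  rw [h]
  exact Subtype.property _

/-- The Lie bracket of vector fields tangent to `T𝓕`. -/
def lieTF [𝒜.IsRegular] (Y₁ Y₂ : 𝒜.sectionsTF.carrier) : 𝒜.sectionsTF.carrier :=
  ⟨fun x => ⟨_, 𝒜.mlieBracket_mem Y₁ Y₂ x⟩, by
    obtain ⟨σ⟩ := 𝒜.exists_splitting
    have h : (fun x => (⟨_, 𝒜.mlieBracket_mem Y₁ Y₂ x⟩ : 𝒜.TF x)) =
        (𝒜.anchorTF (𝒜.bracket (σ.onSec Y₁) (σ.onSec Y₂))).1 := by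
      funext x
      apply Subtype.ext
      rw [← 𝒜.mlieBracket_anchorTF, σ.anchorTF_onSec, σ.anchorTF_onSec]
    rw [h]
    exact Subtype.property _⟩

theorem anchorTF_bracket [𝒜.IsRegular] (X Y : (smoothSections E F A).carrier) :
    𝒜.anchorTF (𝒜.bracket X Y) = 𝒜.lieTF (𝒜.anchorTF X) (𝒜.anchorTF Y) := by
  apply Subtype.ext; funext x; apply Subtype.ext
  exact 𝒜.anchor_bracket X Y x

theorem lieTF_eq [𝒜.IsRegular] (σ : 𝒜.Splitting) (Y₁ Y₂ : 𝒜.sectionsTF.carrier) :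
    𝒜.lieTF Y₁ Y₂ = 𝒜.anchorTF (𝒜.bracket (σ.onSec Y₁) (σ.onSec Y₂)) := by
  rw [anchorTF_bracket, σ.anchorTF_onSec, σ.anchorTF_onSec]

theorem lieTF_self [𝒜.IsRegular] (Y : 𝒜.sectionsTF.carrier) : 𝒜.lieTF Y Y = 0 := by
  obtain ⟨σ⟩ := 𝒜.exists_splitting
  rw [𝒜.lieTF_eq σ, 𝒜.bracket_self, map_zero]

theorem lieTF_leibniz [𝒜.IsRegular] (X Y : 𝒜.sectionsTF.carrier)
    (f : C^∞⟮𝓘(ℝ, E), M; 𝓘(ℝ, ℝ), ℝ⟯) (x : M) :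
    ((𝒜.lieTF X (f • Y)).1 x : TangentSpace 𝓘(ℝ, E) x) = f x • ((𝒜.lieTF X Y).1 x).1 +
      mvfderiv 𝓘(ℝ, E) f x (X.1 x).1 • (Y.1 x).1 := by
  obtain ⟨σ⟩ := 𝒜.exists_splitting
  rw [𝒜.lieTF_eq σ, 𝒜.lieTF_eq σ, σ.onSec_smul]
  change 𝒜.anchor x ((𝒜.bracket (σ.onSec X) (f • σ.onSec Y)).1 x) =
    f x • 𝒜.anchor x ((𝒜.bracket (σ.onSec X) (σ.onSec Y)).1 x) +
      mvfderiv 𝓘(ℝ, E) f x (X.1 x).1 • (Y.1 x).1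
  rw [𝒜.leibniz, map_add, map_smul, map_smul]
  have h1 : 𝒜.anchor x ((σ.onSec X).1 x) = (X.1 x).1 := σ.anchor_apply x _
  have h2 : 𝒜.anchor x ((σ.onSec Y).1 x) = (Y.1 x).1 := σ.anchor_apply x _
  rw [h1, h2]

/-- The Lie bracket of vector fields on `Γ(T𝓕)`, anchored by the inclusion `T𝓕 ⊆ TM`. -/
def bracketTF [𝒜.IsRegular] : AnchoredBracket 𝒜.sectionsTF where
  anchor x := (𝒜.TF x).subtype
  anchor_mem Y := Y.2
  bracket := LinearMap.mk₂ ℝ 𝒜.lieTF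
    (fun X Y Z => by
      obtain ⟨σ⟩ := 𝒜.exists_splitting
      simp only [𝒜.lieTF_eq σ, map_add, LinearMap.add_apply])
    (fun c X Y => by
      obtain ⟨σ⟩ := 𝒜.exists_splitting
      simp only [𝒜.lieTF_eq σ, map_smul, LinearMap.smul_apply])
    (fun X Y Z => by
      obtain ⟨σ⟩ := 𝒜.exists_splitting
      simp only [𝒜.lieTF_eq σ, map_add])
    (fun c X Y => by
      obtain ⟨σ⟩ := 𝒜.exists_splitting
      simp only [𝒜.lieTF_eq σ, map_smul])
  bracket_self := 𝒜.lieTF_self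
  leibniz X Y f := Subtype.ext (funext fun x => Subtype.ext (𝒜.lieTF_leibniz X Y f x))

/-- Brackets of a section of `A` with a section of `K` are sections of `K`. -/
theorem anchorTF_bracket_inclK [𝒜.IsRegular] (X : (smoothSections E F A).carrier)
    (V : 𝒜.sectionsK.carrier) : 𝒜.anchorTF (𝒜.bracket X (𝒜.inclK V)) = 0 := by
  obtain ⟨σ⟩ := 𝒜.exists_splitting
  rw [anchorTF_bracket, anchorTF_inclK, 𝒜.lieTF_eq σ, map_zero, map_zero, map_zero]

variable [𝒜.IsRegular] [𝒜.HasAbelianIsotropy]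

/-- If the isotropy is abelian, the bracket with a section of `K` depends only on the anchor. -/
theorem bracket_inclK_congr {X Y : (smoothSections E F A).carrier}
    (h : 𝒜.anchorTF X = 𝒜.anchorTF Y) (V : 𝒜.sectionsK.carrier) :
    𝒜.bracket X (𝒜.inclK V) = 𝒜.bracket Y (𝒜.inclK V) := by
  have h3 : 𝒜.bracket X (𝒜.inclK V) =
      𝒜.bracket (X - Y) (𝒜.inclK V) + 𝒜.bracket Y (𝒜.inclK V) := by
    rw [← LinearMap.add_apply, ← map_add, sub_add_cancel]
  rw [h3, add_eq_right]
  refine HasAbelianIsotropy.bracket_eq_zero _ _ (fun x => ?_) fun x => (V.1 x).2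
  have h2 : 𝒜.anchorTF (X - Y) = 0 := by rw [map_sub, h, sub_self]
  exact congrArg Subtype.val (congrFun (congrArg Subtype.val h2) x)

/-- The representation of `T𝓕` on `K`: `∇_Y V = [X, V]` for any section `X` of `A` with `♯X = Y`. -/
def nablaK (Y : 𝒜.sectionsTF.carrier) (V : 𝒜.sectionsK.carrier) : 𝒜.sectionsK.carrier :=
  𝒜.toK (𝒜.bracket (𝒜.exists_splitting.some.onSec Y) (𝒜.inclK V)) (𝒜.anchorTF_bracket_inclK _ V)

theorem inclK_nablaK {X : (smoothSections E F A).carrier} {Y : 𝒜.sectionsTF.carrier}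
    (h : 𝒜.anchorTF X = Y) (V : 𝒜.sectionsK.carrier) :
    𝒜.inclK (𝒜.nablaK Y V) = 𝒜.bracket X (𝒜.inclK V) :=
  𝒜.bracket_inclK_congr ((Splitting.anchorTF_onSec _ _).trans h.symm) V

theorem nablaK_smul_left (f : C^∞⟮𝓘(ℝ, E), M; 𝓘(ℝ, ℝ), ℝ⟯) (Y : 𝒜.sectionsTF.carrier)
    (V : 𝒜.sectionsK.carrier) : 𝒜.nablaK (f • Y) V = f • 𝒜.nablaK Y V := by
  obtain ⟨σ⟩ := 𝒜.exists_splitting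
  apply 𝒜.inclK_injective
  rw [inclK_smul, 𝒜.inclK_nablaK (σ.anchorTF_onSec _), 𝒜.inclK_nablaK (σ.anchorTF_onSec _),
    σ.onSec_smul]
  have h := 𝒜.bracketA.leibniz_left (σ.onSec Y) (𝒜.inclK V) f
  refine h.trans ?_
  have h0 : dirDeriv (𝒜.bracketA.toVF (𝒜.inclK V)) f • (σ.onSec Y) = 0 := by
    apply Subtype.ext; funext x
    change mvfderiv 𝓘(ℝ, E) f x (𝒜.anchor x (V.1 x)) • (σ.onSec Y).1 x = (0 : A x)
    have : 𝒜.anchor x (V.1 x) = 0 := (V.1 x).2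
    rw [this, map_zero, zero_smul]
  rw [h0, sub_zero]
  rfl

theorem nablaK_leibniz (Y : 𝒜.sectionsTF.carrier) (f : C^∞⟮𝓘(ℝ, E), M; 𝓘(ℝ, ℝ), ℝ⟯)
    (V : 𝒜.sectionsK.carrier) (x : M) : ((𝒜.nablaK Y (f • V)).1 x : A x) =
      f x • ((𝒜.nablaK Y V).1 x).1 + mvfderiv 𝓘(ℝ, E) f x (Y.1 x).1 • (V.1 x).1 := by
  obtain ⟨σ⟩ := 𝒜.exists_splitting
  change (𝒜.inclK (𝒜.nablaK Y (f • V))).1 x = f x • (𝒜.inclK (𝒜.nablaK Y V)).1 x + _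
  rw [𝒜.inclK_nablaK (σ.anchorTF_onSec _), 𝒜.inclK_nablaK (σ.anchorTF_onSec _), inclK_smul,
    𝒜.leibniz]
  have h1 : 𝒜.anchor x ((σ.onSec Y).1 x) = (Y.1 x).1 := σ.anchor_apply x _
  rw [h1]
  rfl

/-- The representation of `T𝓕` on `K` as a connection. -/
def connK : Connection 𝒜.bracketTF 𝒜.sectionsK where
  nabla := LinearMap.mk₂ ℝ 𝒜.nablaK
    (fun X Y V => by
      obtain ⟨σ⟩ := 𝒜.exists_splitting
      apply 𝒜.inclK_injective
      simp only [𝒜.inclK_nablaK (σ.anchorTF_onSec _), map_add, LinearMap.add_apply])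
    (fun c X V => by
      obtain ⟨σ⟩ := 𝒜.exists_splitting
      apply 𝒜.inclK_injective
      simp only [𝒜.inclK_nablaK (σ.anchorTF_onSec _), map_smul, LinearMap.smul_apply])
    (fun X V W => by
      obtain ⟨σ⟩ := 𝒜.exists_splitting
      apply 𝒜.inclK_injective
      simp only [𝒜.inclK_nablaK (σ.anchorTF_onSec _), map_add])
    (fun c X V => by
      obtain ⟨σ⟩ := 𝒜.exists_splitting
      apply 𝒜.inclK_injective
      simp only [𝒜.inclK_nablaK (σ.anchorTF_onSec _), map_smul])
  smul_left := 𝒜.nablaK_smul_left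
  leibniz Y f V :=
     Subtype.ext (funext fun x => Subtype.ext (𝒜.nablaK_leibniz Y f V x))

end LieAlgebroid

end Regular

/-! ### Contractions and components -/

section Contraction

/-- The alternating map `(v₀, v₁) ↦ b(v₀, v₁)` attached to a skew-symmetric bilinear map. -/
def alternatingPair {L : Type*} [AddCommGroup L] [Module ℝ L] {N : Type*} [AddCommGroup N]
    [Module ℝ N] (b : L →ₗ[ℝ] L →ₗ[ℝ] N) (hb : ∀ v, b v v = 0) : L [⋀^Fin 2]→ₗ[ℝ] N where
  toFun v := b (v 0) (v 1)
  map_update_add' v i x y := by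
    rename_i inst
    obtain rfl : inst = instDecidableEqFin 2 := Subsingleton.elim _ _
    fin_cases i <;> simp
  map_update_smul' v i c x := by
    rename_i inst
    obtain rfl : inst = instDecidableEqFin 2 := Subsingleton.elim _ _
    fin_cases i <;> simp
  map_eq_zero_of_eq' v i j h hij := by
    fin_cases i <;> fin_cases j <;> simp_all

theorem append_update_left {α β : Type*} {p q : ℕ} (s : α → β) (Y : Fin p → α) (b : Fin q → β)
    (i : Fin p) (y : α) :
    (fun k : Fin (p + q) => Fin.append (fun j => s (Function.update Y i y j)) b (Fin.cast rfl k)) =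
      Function.update (fun k : Fin (p + q) => Fin.append (fun j => s (Y j)) b (Fin.cast rfl k))
        (Fin.castAdd q i) (s y) := by
  ext k : 1
  refine Fin.addCases (fun k => ?_) (fun k => ?_) k
  · rcases eq_or_ne k i with rfl | hk
    · simp
    · rw [Function.update_of_ne (by simpa using hk)]
      simp [hk]
  · rw [Function.update_of_ne (by simp [Fin.ext_iff]; omega)]
    simp

theorem append_update_right {α β : Type*} {p q : ℕ} (t : α → β) (b : Fin p → β) (V : Fin q → α)
    (i : Fin q) (v : α) :
    (fun k : Fin (p + q) => Fin.append b (fun j => t (Function.update V i v j)) (Fin.cast rfl k)) =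
      Function.update (fun k : Fin (p + q) => Fin.append b (fun j => t (V j)) (Fin.cast rfl k))
        (Fin.natAdd p i) (t v) := by
  ext k : 1
  refine Fin.addCases (fun k => ?_) (fun k => ?_) k
  · rw [Function.update_of_ne (by simp [Fin.ext_iff]; omega)]
    simp
  · rcases eq_or_ne k i with rfl | hk
    · simp
    · rw [Function.update_of_ne (by simpa using hk)]
      simp [hk]

/-- The restriction of an alternating map to `p` arguments in the image of `s` followed by `q`
arguments in the image of `t`: `(Y, V) ↦ T (s Y₁, …, s Yₚ, t V₁, …, t V_q)`. -/
def blockRestrict {L : Type*} [AddCommGroup L] [Module ℝ L] {N : Type*} [AddCommGroup N]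
    [Module ℝ N] {L₁ : Type*} [AddCommGroup L₁] [Module ℝ L₁] {L₂ : Type*} [AddCommGroup L₂]
    [Module ℝ L₂] (s : L₁ →ₗ[ℝ] L) (t : L₂ →ₗ[ℝ] L) {p q n : ℕ} (h : p + q = n)
    (T : L [⋀^Fin n]→ₗ[ℝ] N) : L₁ [⋀^Fin p]→ₗ[ℝ] L₂ [⋀^Fin q]→ₗ[ℝ] N where
  toFun Y :=
    { toFun := fun V => T (fun i => Fin.append (fun j => s (Y j)) (fun j => t (V j))
        (Fin.cast h.symm i))
      map_update_add' := fun V i v w => by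
        rename_i inst
        obtain rfl : inst = instDecidableEqFin q := Subsingleton.elim _ _
        subst h
        rw [append_update_right, append_update_right, append_update_right, map_add, T.map_update_add]
      map_update_smul' := fun V i c v => by
        rename_i inst
        obtain rfl : inst = instDecidableEqFin q := Subsingleton.elim _ _
        subst h
        rw [append_update_right, append_update_right, map_smul, T.map_update_smul]
      map_eq_zero_of_eq' := fun V i j hV hij => by
        subst h
        exact T.map_eq_zero_of_eq _ (i := Fin.natAdd p i) (j := Fin.natAdd p j) (by simp [hV])
          (by simpa using hij) }
  map_update_add' Y i v w := by
    rename_i inst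
    obtain rfl : inst = instDecidableEqFin p := Subsingleton.elim _ _
    subst h
    ext V
    change T _ = T _ + T _
    rw [append_update_left, append_update_left, append_update_left, map_add, T.map_update_add]
  map_update_smul' Y i c v := by
    rename_i inst
    obtain rfl : inst = instDecidableEqFin p := Subsingleton.elim _ _
    subst h
    ext V
    change T _ = c • T _
    rw [append_update_left, append_update_left, map_smul, T.map_update_smul]
  map_eq_zero_of_eq' Y i j hY hij := by
    subst h
    ext V
    exact T.map_eq_zero_of_eq _ (i := Fin.castAdd q i) (j := Fin.castAdd q j) (by simp [hY])
          (by simpa using hij)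

theorem blockRestrict_apply {L : Type*} [AddCommGroup L] [Module ℝ L] {N : Type*} [AddCommGroup N]
    [Module ℝ N] {L₁ : Type*} [AddCommGroup L₁] [Module ℝ L₁] {L₂ : Type*} [AddCommGroup L₂]
    [Module ℝ L₂] (s : L₁ →ₗ[ℝ] L) (t : L₂ →ₗ[ℝ] L) {p q n : ℕ} (h : p + q = n)
    (T : L [⋀^Fin n]→ₗ[ℝ] N) (Y : Fin p → L₁) (V : Fin q → L₂) :
    blockRestrict s t h T Y V = T (fun i => Fin.append (fun j => s (Y j)) (fun j => t (V j))
        (Fin.cast h.symm i)) := rfl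

variable {V : M → Type*} [∀ x, AddCommGroup (V x)] [∀ x, Module ℝ (V x)]
  {W : M → Type*} [∀ x, AddCommGroup (W x)] [∀ x, Module ℝ (W x)]
  {U : M → Type*} [∀ x, AddCommGroup (U x)] [∀ x, Module ℝ (U x)]
  {ΓU : SectionSpace E U} {ΓV : SectionSpace E V} {ΓW : SectionSpace E W}

theorem sum_alt_apply {L : Type*} [AddCommGroup L] [Module ℝ L] {N : Type*} [AddCommGroup N]
    [Module ℝ N] {n : ℕ} {ι : Type*} (s : Finset ι) (T : ι → L [⋀^Fin n]→ₗ[ℝ] N) (v : Fin n → L) :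
    (∑ i ∈ s, T i) v = ∑ i ∈ s, T i v := by
  classical
  induction s using Finset.induction_on with
  | empty => rfl
  | insert i s hi ih => rw [Finset.sum_insert hi, Finset.sum_insert hi, AlternatingMap.add_apply, ih]

/-- The bilinear map `(y₁, y₂) ↦ ((Y, V) ↦ β(Y)(γ(y₁, y₂), V))`. -/
def insertPair {L : Type*} [AddCommGroup L] [Module ℝ L] {N : Type*} [AddCommGroup N]
    [Module ℝ N] {R : Type*} [AddCommGroup R] [Module ℝ R] {p q : ℕ} (γ : L [⋀^Fin 2]→ₗ[ℝ] N)
    (β : L [⋀^Fin p]→ₗ[ℝ] N [⋀^Fin (q + 1)]→ₗ[ℝ] R) :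
    L →ₗ[ℝ] L →ₗ[ℝ] L [⋀^Fin p]→ₗ[ℝ] N [⋀^Fin q]→ₗ[ℝ] R :=
  LinearMap.mk₂ ℝ (fun y₁ y₂ =>
      (AlternatingMap.curryLeftLinearMap.flip (γ ![y₁, y₂])).compAlternatingMap β)
    (fun y₁ y₂ y₃ => by
      have h : γ ![y₁ + y₂, y₃] = γ ![y₁, y₃] + γ ![y₂, y₃] := γ.toMultilinearMap.cons_add _ _ _
      rw [h, map_add]; rfl)
    (fun c y₁ y₂ => by
      have h : γ ![c • y₁, y₂] = c • γ ![y₁, y₂] := γ.toMultilinearMap.cons_smul _ _ _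
      rw [h, map_smul]; rfl)
    (fun y₁ y₂ y₃ => by
      have h : γ ![y₁, y₂ + y₃] = γ ![y₁, y₂] + γ ![y₁, y₃] :=
        (γ.curryLeft y₁).toMultilinearMap.cons_add ![] y₂ y₃
      rw [h, map_add]; rfl)
    (fun c y₁ y₂ => by
      have h : γ ![y₁, c • y₂] = c • γ ![y₁, y₂] :=
        (γ.curryLeft y₁).toMultilinearMap.cons_smul ![] c y₂
      rw [h, map_smul]; rfl)

section

variable {L : Type*} [AddCommGroup L] [Module ℝ L] {N : Type*} [AddCommGroup N]
  [Module ℝ N] {R : Type*} [AddCommGroup R] [Module ℝ R] {p q : ℕ} (γ : L [⋀^Fin 2]→ₗ[ℝ] N)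
  (β β' : L [⋀^Fin p]→ₗ[ℝ] N [⋀^Fin (q + 1)]→ₗ[ℝ] R)

theorem insertPair_self (y : L) : insertPair γ β y y = 0 := by
  have h : γ ![y, y] = 0 := γ.map_eq_zero_of_eq _ (i := 0) (j := 1) rfl (by simp)
  change (AlternatingMap.curryLeftLinearMap.flip (γ ![y, y])).compAlternatingMap _ = 0
  rw [h, map_zero]
  rfl

theorem pairSum_insertPair_add : pairSum (insertPair γ (β + β')) (insertPair_self _ _) =
    pairSum (insertPair γ β) (insertPair_self _ _) +
      pairSum (insertPair γ β') (insertPair_self _ _) := by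
  ext Y V
  have h : insertPair γ (β + β') = insertPair γ β + insertPair γ β' := by
    ext y₁ y₂ Y V
    rfl
  simp only [AlternatingMap.add_apply, pairSum_apply, sum_alt_apply, h, LinearMap.add_apply,
    smul_add, Finset.sum_add_distrib]

theorem pairSum_insertPair_smul (c : ℝ) :
    pairSum (insertPair γ (c • β)) (insertPair_self _ _) =
      c • pairSum (insertPair γ β) (insertPair_self _ _) := by
  ext Y V
  have h : insertPair γ (c • β) = c • insertPair γ β := by
    ext y₁ y₂ Y V
    rfl
  simp only [AlternatingMap.smul_apply, pairSum_apply, sum_alt_apply, h, LinearMap.smul_apply,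
    Finset.smul_sum, smul_comm c]

end

/-- The contraction
`(i_γ β)(Y)(V) = ∑_{i < j} (-1)^(i+j) β(Y₁, …, Ŷᵢ, …, Ŷⱼ, …, Yₚ₊₂)(γ(Yᵢ, Yⱼ), V₁, …, V_q)`. -/
def contraction (γ : (altForms ΓU ΓV 2).carrier) (p q : ℕ) :
    (altForms ΓU (altForms ΓV ΓW (q + 1)) p).carrier →ₗ[ℝ]
      (altForms ΓU (altForms ΓV ΓW q) (p + 2)).carrier where
  toFun β := ⟨fun x => pairSum (insertPair (γ.1 x) (β.1 x)) (insertPair_self _ _), fun Y => by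
    intro V
    have h : (fun x => pairSum (insertPair (γ.1 x) (β.1 x)) (insertPair_self _ _)
        (fun i => (Y i).1 x) (fun i => (V i).1 x)) =
        ∑ i : Fin (p + 1), ∑ j ∈ Finset.Ici i, (-1 : ℤ) ^ ((i : ℕ) + ((j : ℕ) + 1)) •
          (onSections (onSections β (j.removeNth (i.castSucc.removeNth Y)))
            (Matrix.vecCons (onSections γ ![Y i.castSucc, Y j.succ]) V)).1 := by
      funext x
      rw [pairSum_apply, sum_alt_apply, Finset.sum_apply]
      refine Finset.sum_congr rfl fun i _ => ?_
      rw [sum_alt_apply, Finset.sum_apply]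
      refine Finset.sum_congr rfl fun j _ => ?_
      rw [AlternatingMap.smul_apply, Pi.smul_apply]
      congr 1
      rw [onSections_apply, onSections_apply]
      change β.1 x _ (Matrix.vecCons (γ.1 x _) _) = _
      congr 1
      funext k
      refine Fin.cases ?_ (fun k => ?_) k
      · rw [Matrix.cons_val_zero, Matrix.cons_val_zero, onSections_apply]
        congr 1
        funext l
        fin_cases l <;> rfl
      · rfl
    change (fun x => pairSum (insertPair (γ.1 x) (β.1 x)) (insertPair_self _ _)
        (fun i => (Y i).1 x) (fun i => (V i).1 x)) ∈ ΓW.carrier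
    rw [h]
    exact ΓW.carrier.sum_mem fun i _ => ΓW.carrier.sum_mem fun j _ =>
      zsmul_mem (Subtype.property _) _⟩
  map_add' β β' := by
    apply Subtype.ext; funext x
    exact pairSum_insertPair_add _ _ _
  map_smul' c β := by
    apply Subtype.ext; funext x
    exact pairSum_insertPair_smul _ _ _

theorem contraction_apply (γ : (altForms ΓU ΓV 2).carrier) {p q : ℕ}
    (β : (altForms ΓU (altForms ΓV ΓW (q + 1)) p).carrier) (x : M) (Y : Fin (p + 2) → U x)
    (v : Fin q → V x) :
    (contraction γ p q β).1 x Y v = ∑ i : Fin (p + 1), ∑ j ∈ Finset.Ici i,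
      (-1 : ℤ) ^ ((i : ℕ) + ((j : ℕ) + 1)) •
        β.1 x (j.removeNth (i.castSucc.removeNth Y))
          (Matrix.vecCons (γ.1 x ![Y i.castSucc, Y j.succ]) v) := by
  change pairSum (insertPair (γ.1 x) (β.1 x)) (insertPair_self _ _) Y v = _
  simp only [pairSum_apply, sum_alt_apply, AlternatingMap.smul_apply]
  rfl

end Contraction

/-! ### Sequences of linear maps: cohomology, filtrations, spectral sequences -/

section Homological

universe u

variable {C : ℕ → Type u} [∀ n, AddCommGroup (C n)] [∀ n, Module ℝ (C n)]
  (d : ∀ n, C n →ₗ[ℝ] C (n + 1))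

/-- The coboundaries `im (d : Cⁿ⁻¹ → Cⁿ)`, where `C⁻¹ = 0`. -/
def coboundaries : ∀ n, Submodule ℝ (C n)
  | 0 => ⊥
  | n + 1 => LinearMap.range (d n)

/-- The cohomology `ker (d : Cⁿ → Cⁿ⁺¹) / im (d : Cⁿ⁻¹ → Cⁿ)`. -/
def Cohomology (n : ℕ) : Type u :=
  LinearMap.ker (d n) ⧸ (coboundaries d n).submoduleOf (LinearMap.ker (d n))

instance (n : ℕ) : AddCommGroup (Cohomology d n) :=
  inferInstanceAs (AddCommGroup (LinearMap.ker (d n) ⧸ (coboundaries d n).submoduleOf _))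

instance (n : ℕ) : Module ℝ (Cohomology d n) :=
  inferInstanceAs (Module ℝ (LinearMap.ker (d n) ⧸ (coboundaries d n).submoduleOf _))

/-- The projection from the closed elements to the cohomology. -/
def cohProj (n : ℕ) : LinearMap.ker (d n) →ₗ[ℝ] Cohomology d n :=
  ((coboundaries d n).submoduleOf (LinearMap.ker (d n))).mkQ

/-- The class of a closed element. -/
def cohClass {n : ℕ} (a : C n) (ha : d n a = 0) : Cohomology d n :=
  cohProj d n ⟨a, ha⟩

variable (Fil : ℤ → ∀ n, Submodule ℝ (C n))

/-- The submodule `Z_r^p = {a ∈ F^p | d a ∈ F^(p+r)}` of `Cⁿ`, for a filtration `F` of `C`. -/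
def approxCocycles (r p : ℤ) (n : ℕ) : Submodule ℝ (C n) :=
  Fil p n ⊓ (Fil (p + r) (n + 1)).comap (d n)

/-- The submodule `d Z_(r-1)^(p-r+1) = F^p ∩ d F^(p-r+1)` of `Cⁿ`, for a filtration `F` of `C`. -/
def approxCoboundaries (r p : ℤ) : ∀ n, Submodule ℝ (C n)
  | 0 => ⊥
  | n + 1 => (approxCocycles d Fil (r - 1) (p - r + 1) n).map (d n)

/-- A first quadrant spectral sequence, starting from the second page, which is the spectral
sequence of the complex `(C, d)` with the decreasing filtration `F`. This means that there are
identifications `E_r^{p,q} = Z_r^p / (Z_(r-1)^(p+1) + d Z_(r-1)^(p-r+1))` in degree `p + q`, given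
by surjections `Z_r^p → E_r^{p,q}` with the appropriate kernel, such that the differential of
`E_r` is induced by `d`, and such that the isomorphism between the cohomology of `E_r` and
`E_{r+1}` is induced by the identity of `C`. -/
structure FiltrationSpectralSequence where
  E : CategoryTheory.E₂CohomologicalSpectralSequenceNat (ModuleCat.{u} ℝ)
  proj : ∀ (r : ℤ) (hr : 2 ≤ r) {p q n : ℕ}, p + q = n →
    (approxCocycles d Fil r p n →ₗ[ℝ] (E.page r hr).X (p, q))
  proj_surjective : ∀ (r : ℤ) (hr : 2 ≤ r) {p q n : ℕ} (h : p + q = n),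
    Function.Surjective (proj r hr h)
  proj_eq_zero_iff : ∀ (r : ℤ) (hr : 2 ≤ r) {p q n : ℕ} (h : p + q = n)
    (a : approxCocycles d Fil r p n), proj r hr h a = 0 ↔
      (a : C n) ∈ approxCocycles d Fil (r - 1) (p + 1) n ⊔ approxCoboundaries d Fil r p n
  d_proj : ∀ (r : ℤ) (hr : 2 ≤ r) {p q p' q' n : ℕ} (h : p + q = n) (h' : p' + q' = n + 1)
    (_ : (p : ℤ) + r = p') (a : approxCocycles d Fil r p n)
    (b : approxCocycles d Fil r p' (n + 1)), (b : C (n + 1)) = d n a →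
      ((E.page r hr).d (p, q) (p', q')).hom (proj r hr h a) = proj r hr h' b
  iso_proj : ∀ (r : ℤ) (hr : 2 ≤ r) {p q n : ℕ} (h : p + q = n)
    (z : (E.page r hr).cycles (p, q)) (a : approxCocycles d Fil r p n)
    (a' : approxCocycles d Fil (r + 1) p n), (a' : C n) = a →
      ((E.page r hr).iCycles (p, q)).hom z = proj r hr h a →
        (E.iso r (r + 1) (p, q) rfl hr).hom.hom (((E.page r hr).homologyπ (p, q)).hom z) =
          proj (r + 1) (by lia) h a'

/-- The filtration of the cohomology induced by a filtration of `C`: the classes which have a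
representative in `F^p`. -/
def filCohomology (p : ℤ) (n : ℕ) : Submodule ℝ (Cohomology d n) :=
  ((Fil p n).submoduleOf (LinearMap.ker (d n))).map (cohProj d n)

/-- The graded pieces `F^p Hⁿ / F^(p+1) Hⁿ` of the cohomology. -/
abbrev grCohomology (p : ℤ) (n : ℕ) : Type u :=
  filCohomology d Fil p n ⧸
    (filCohomology d Fil (p + 1) n).submoduleOf (filCohomology d Fil p n)

variable {d Fil}

/-- Convergence of the spectral sequence to the cohomology of `C`: the induced filtration of
`Hⁿ` is `Hⁿ = F⁰ Hⁿ ⊇ F¹ Hⁿ ⊇ ⋯ ⊇ Fⁿ⁺¹ Hⁿ = 0`, and `E_r^{p,q}` is `F^p H^{p+q} / F^(p+1) H^{p+q}`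
as soon as no nonzero differential on a page from `E_r` on starts or ends at `(p, q)`, that is,
for `r > p` and `r > q + 1`. -/
def FiltrationSpectralSequence.Converges (S : FiltrationSpectralSequence d Fil) : Prop :=
  (∀ n, filCohomology d Fil 0 n = ⊤) ∧
  (∀ n p, filCohomology d Fil (p + 1) n ≤ filCohomology d Fil p n) ∧
  (∀ n : ℕ, filCohomology d Fil (n + 1) n = ⊥) ∧
  ∀ (r : ℤ) (hr : 2 ≤ r) (p q n : ℕ) (h : p + q = n), (p : ℤ) < r → (q : ℤ) + 1 < r →
    ∃ e : (S.E.page r hr).X (p, q) ≃ₗ[ℝ] grCohomology d Fil p n,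
      ∀ a : approxCocycles d Fil r p n, ∃ (ha : d n a = 0)
        (ha' : cohClass d (a : C n) ha ∈ filCohomology d Fil p n),
        e (S.proj r hr h a) = Submodule.Quotient.mk ⟨_, ha'⟩

end Homological

/-! ### The complexes of a regular Lie algebroid with abelian isotropy -/

section Complexes

variable [FiniteDimensional ℝ E] [IsManifold 𝓘(ℝ, E) ∞ M] [T2Space M] [SigmaCompactSpace M]
  {F : Type*} [NormedAddCommGroup F] [NormedSpace ℝ F] [FiniteDimensional ℝ F]
  {A : M → Type*} [TopologicalSpace (TotalSpace F A)] [∀ x, TopologicalSpace (A x)]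
  [∀ x, AddCommGroup (A x)] [∀ x, Module ℝ (A x)]
  [∀ x, IsTopologicalAddGroup (A x)] [∀ x, ContinuousSMul ℝ (A x)]
  [FiberBundle F A] [VectorBundle ℝ F A] [ContMDiffVectorBundle ∞ F A 𝓘(ℝ, E)]

namespace LieAlgebroid

variable (𝒜 : LieAlgebroid E F A)

/-- The space `Ωⁿ(A) = Γ(⋀ⁿ A*)`. -/
abbrev Form (_ : LieAlgebroid E F A) (n : ℕ) :=
  (altForms (smoothSections E F A) (smoothFunctions E M) n).carrier

/-- The de Rham differential `d_A` of a Lie algebroid. -/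
def dA (n : ℕ) : 𝒜.Form n →ₗ[ℝ] 𝒜.Form (n + 1) :=
  dForm (trivialConnection 𝒜.bracketA) n

/-- The space `Ωᵖ(𝓕, K)` of foliated forms with values in `K`. -/
abbrev KForm (p : ℕ) := (altForms 𝒜.sectionsTF 𝒜.sectionsK p).carrier

/-- The space `Ωᵖ(𝓕, ⋀^q K*)` of foliated forms with values in `⋀^q K*`. -/
abbrev BiForm (p q : ℕ) :=
  (altForms 𝒜.sectionsTF (altForms 𝒜.sectionsK (smoothFunctions E M) q) p).carrier

/-- The submodules `F^p Ωⁿ(A) = {α | i_{V₀} ⋯ i_{V_q} α = 0 for all V₀, …, V_q in K}` for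
`p + q = n`: a form lies in `F^p` if it vanishes whenever more than `n - p` of its arguments are
in `K`. Thus `F^p Ωⁿ(A) = Ωⁿ(A)` if `p ≤ 0` and `F^p Ωⁿ(A) = 0` if `p > n`. -/
def filtration (p : ℤ) (n : ℕ) : Submodule ℝ (𝒜.Form n) where
  carrier := {α | ∀ (x : M) (v : Fin n → A x) (S : Finset (Fin n)),
    (∀ i ∈ S, v i ∈ 𝒜.K x) → (n : ℤ) < p + S.card → α.1 x v = 0}
  add_mem' ha hb x v S hS hn := by
    refine (congrArg₂ (· + ·) (ha x v S hS hn) (hb x v S hS hn)).trans (add_zero (0 : ℝ))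
  zero_mem' _ _ _ _ _ := rfl
  smul_mem' c α ha x v S hS hn := by
    refine (congrArg (c • ·) (ha x v S hS hn)).trans (smul_zero c)

variable {𝒜}

/-- The map `a^{p,q} : Ω^{p+q}(A) → Ωᵖ(𝓕, ⋀^q K*)` attached to a splitting:
`a^{p,q}(α)(Y₁, …, Yₚ)(V₁, …, V_q) = α(σ Y₁, …, σ Yₚ, V₁, …, V_q)`. -/
def Splitting.component (σ : 𝒜.Splitting) {p q n : ℕ} (h : p + q = n) :
    𝒜.Form n →ₗ[ℝ] 𝒜.BiForm p q where
  toFun α := ⟨fun x => blockRestrict (σ.toFun x) (𝒜.K x).subtype h (α.1 x), fun Y V => by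
    subst h
    have := α.2 (fun i => Fin.append (fun j => σ.onSec (Y j)) (fun j => 𝒜.inclK (V j)) i)
    convert this using 1
    funext x
    rw [blockRestrict_apply]
    congr 1
    funext i
    refine Fin.addCases (fun i => ?_) (fun i => ?_) i
    · simp
      rfl
    · simp
      rfl⟩
  map_add' α β := rfl
  map_smul' c α := rfl

variable (𝒜) [𝒜.IsRegular] [𝒜.HasAbelianIsotropy]

/-- The differential on foliated forms with values in `K`. -/
def dK (p : ℕ) : 𝒜.KForm p →ₗ[ℝ] 𝒜.KForm (p + 1) := dForm 𝒜.connK p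

/-- The differential `d_𝓕` on foliated forms with values in `⋀^q K*`, on which `T𝓕` acts through
the dual of its representation on `K`. -/
def dF (q p : ℕ) : 𝒜.BiForm p q →ₗ[ℝ] 𝒜.BiForm (p + 1) q :=
  dForm (altConnection 𝒜.connK (trivialConnection 𝒜.bracketTF) q) p

variable {𝒜}

/-- The curvature `γ(Y₁, Y₂) = [σ Y₁, σ Y₂] - σ [Y₁, Y₂]` of a splitting, on sections. -/
def Splitting.curvatureFun (σ : 𝒜.Splitting) (Y₁ Y₂ : 𝒜.sectionsTF.carrier) :
    𝒜.sectionsK.carrier :=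
  𝒜.toK (𝒜.bracket (σ.onSec Y₁) (σ.onSec Y₂) - σ.onSec (𝒜.lieTF Y₁ Y₂)) (by
    rw [map_sub, σ.anchorTF_onSec, anchorTF_bracket, σ.anchorTF_onSec, σ.anchorTF_onSec, sub_self])

theorem Splitting.inclK_curvatureFun (σ : 𝒜.Splitting) (Y₁ Y₂ : 𝒜.sectionsTF.carrier) :
    𝒜.inclK (σ.curvatureFun Y₁ Y₂) =
      𝒜.bracket (σ.onSec Y₁) (σ.onSec Y₂) - σ.onSec (𝒜.bracketTF.bracket Y₁ Y₂) := rfl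

theorem Splitting.curvatureFun_self (σ : 𝒜.Splitting) (Y : 𝒜.sectionsTF.carrier) :
    σ.curvatureFun Y Y = 0 := by
  apply 𝒜.inclK_injective
  rw [inclK_curvatureFun, 𝒜.bracket_self, 𝒜.bracketTF.bracket_self, map_zero, map_zero, sub_zero]

/-- The curvature of a splitting as an alternating map on sections. -/
def Splitting.curvatureAlt (σ : 𝒜.Splitting) :
    𝒜.sectionsTF.carrier [⋀^Fin 2]→ₗ[ℝ] 𝒜.sectionsK.carrier :=
  alternatingPair (LinearMap.mk₂ ℝ σ.curvatureFun
    (fun X Y Z => by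
      apply 𝒜.inclK_injective
      simp only [inclK_curvatureFun, map_add, LinearMap.add_apply]
      abel)
    (fun c X Y => by
      apply 𝒜.inclK_injective
      simp only [inclK_curvatureFun, map_smul, LinearMap.smul_apply, smul_sub])
    (fun X Y Z => by
      apply 𝒜.inclK_injective
      simp only [inclK_curvatureFun, map_add]
      abel)
    (fun c X Y => by
      apply 𝒜.inclK_injective
      simp only [inclK_curvatureFun, map_smul, smul_sub])) σ.curvatureFun_self

theorem Splitting.curvatureFun_smul (σ : 𝒜.Splitting) (f : C^∞⟮𝓘(ℝ, E), M; 𝓘(ℝ, ℝ), ℝ⟯)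
    (X Y : 𝒜.sectionsTF.carrier) : σ.curvatureFun (f • X) Y = f • σ.curvatureFun X Y := by
  apply 𝒜.inclK_injective
  have h1 : 𝒜.bracket (f • σ.onSec X) (σ.onSec Y) = f • 𝒜.bracket (σ.onSec X) (σ.onSec Y) -
      dirDeriv (𝒜.bracketA.toVF (σ.onSec Y)) f • σ.onSec X :=
    𝒜.bracketA.leibniz_left (σ.onSec X) (σ.onSec Y) f
  have h2 : 𝒜.bracketA.toVF (σ.onSec Y) = 𝒜.bracketTF.toVF Y := by
    apply Subtype.ext; funext x
    exact σ.anchor_apply x _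
  rw [inclK_smul, inclK_curvatureFun, inclK_curvatureFun, σ.onSec_smul, h1,
    𝒜.bracketTF.leibniz_left, map_sub, σ.onSec_smul, σ.onSec_smul, h2, smul_sub_aux]
  abel

theorem Splitting.curvatureAlt_isTensorial (σ : 𝒜.Splitting) : IsTensorial σ.curvatureAlt := by
  apply IsTensorial.of_zero
  intro X Y f
  exact σ.curvatureFun_smul f X (Y 0)

/-- The curvature of a splitting as a form in `Ω²(𝓕, K)`. -/
def Splitting.curvature (σ : 𝒜.Splitting) : 𝒜.KForm 2 :=
  descend σ.curvatureAlt σ.curvatureAlt_isTensorial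

/-- The curvature is given on sections by `γ(Y₁, Y₂) = [σ Y₁, σ Y₂] - σ [Y₁, Y₂]`. -/
theorem Splitting.onSections_curvature (σ : 𝒜.Splitting) (Y : Fin 2 → 𝒜.sectionsTF.carrier) :
    𝒜.inclK (onSections σ.curvature Y) = 𝒜.bracket (σ.onSec (Y 0)) (σ.onSec (Y 1)) -
      σ.onSec (𝒜.bracketTF.bracket (Y 0) (Y 1)) := by
  rw [curvature, onSections_descend]
  rfl

variable (𝒜)

/-- The contraction `i_γ : Ωᵖ(𝓕, ⋀^(q+1) K*) → Ω^(p+2)(𝓕, ⋀^q K*)`. -/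
abbrev iGamma (γ : 𝒜.KForm 2) (p q : ℕ) : 𝒜.BiForm p (q + 1) →ₗ[ℝ] 𝒜.BiForm (p + 2) q :=
  contraction γ p q

/-- The space `⨁_{p + q = n} Ωᵖ(𝓕, ⋀^q K*)`. -/
abbrev Total (n : ℕ) := ∀ pq : {pq : ℕ × ℕ // pq.1 + pq.2 = n}, 𝒜.BiForm pq.1.1 pq.1.2

/-- The projection of `⨁_{p + q = n} Ωᵖ(𝓕, ⋀^q K*)` to a summand. -/
abbrev totalProj {n : ℕ} (p q : ℕ) (h : p + q = n) : 𝒜.Total n →ₗ[ℝ] 𝒜.BiForm p q :=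
  LinearMap.proj (⟨(p, q), h⟩ : {pq : ℕ × ℕ // pq.1 + pq.2 = n})

/-- The component in bidegree `(p, q)` of `δ₁ + δ₂`, where `δ₁ = d_𝓕` and where `δ₂ = (-1)ᵖ i_γ` on
`Ωᵖ(𝓕, ⋀^q K*)`. -/
def totalComponent (γ : 𝒜.KForm 2) (n : ℕ) :
    ∀ p q : ℕ, p + q = n + 1 → 𝒜.Total n →ₗ[ℝ] 𝒜.BiForm p q
  | 0, _, _ => 0
  | 1, q, h => 𝒜.dF q 0 ∘ₗ 𝒜.totalProj 0 q (by omega)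
  | p + 2, q, h => 𝒜.dF q (p + 1) ∘ₗ 𝒜.totalProj (p + 1) q (by omega) +
      (-1 : ℝ) ^ p • 𝒜.iGamma γ p q ∘ₗ 𝒜.totalProj p (q + 1) (by omega)

/-- The differential `δ₁ + δ₂` on `⨁_{p + q = n} Ωᵖ(𝓕, ⋀^q K*)`, where `δ₁ = d_𝓕` and where
`δ₂ = (-1)ᵖ i_γ` on `Ωᵖ(𝓕, ⋀^q K*)`. -/
def totalD (γ : 𝒜.KForm 2) (n : ℕ) : 𝒜.Total n →ₗ[ℝ] 𝒜.Total (n + 1) :=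
  LinearMap.pi fun pq => 𝒜.totalComponent γ n pq.1.1 pq.1.2 pq.2

end LieAlgebroid

end Complexes

/-! ### Cohomology and morphisms -/

section Morphisms

variable [FiniteDimensional ℝ E] [IsManifold 𝓘(ℝ, E) ∞ M] [T2Space M] [SigmaCompactSpace M]
  {F : Type*} [NormedAddCommGroup F] [NormedSpace ℝ F] [FiniteDimensional ℝ F]
  {A : M → Type*} [TopologicalSpace (TotalSpace F A)] [∀ x, TopologicalSpace (A x)]
  [∀ x, AddCommGroup (A x)] [∀ x, Module ℝ (A x)]
  [∀ x, IsTopologicalAddGroup (A x)] [∀ x, ContinuousSMul ℝ (A x)]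
  [FiberBundle F A] [VectorBundle ℝ F A] [ContMDiffVectorBundle ∞ F A 𝓘(ℝ, E)]
  {F' : Type*} [NormedAddCommGroup F'] [NormedSpace ℝ F'] [FiniteDimensional ℝ F']
  {A' : M → Type*} [TopologicalSpace (TotalSpace F' A')] [∀ x, TopologicalSpace (A' x)]
  [∀ x, AddCommGroup (A' x)] [∀ x, Module ℝ (A' x)]
  [∀ x, IsTopologicalAddGroup (A' x)] [∀ x, ContinuousSMul ℝ (A' x)]
  [FiberBundle F' A'] [VectorBundle ℝ F' A'] [ContMDiffVectorBundle ∞ F' A' 𝓘(ℝ, E)]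

namespace LieAlgebroid

/-- The Lie algebroid cohomology `Hⁿ(A)`. -/
abbrev HA (𝒜 : LieAlgebroid E F A) (n : ℕ) := Cohomology 𝒜.dA n

/-- The foliated cohomology `Hᵖ(𝓕, K)` with coefficients in `K`. -/
abbrev HK (𝒜 : LieAlgebroid E F A) [𝒜.IsRegular] [𝒜.HasAbelianIsotropy] (p : ℕ) :=
  Cohomology 𝒜.dK p

/-- The foliated cohomology `Hᵖ(𝓕, ⋀^q K*)` with coefficients in `⋀^q K*`. -/
abbrev HF (𝒜 : LieAlgebroid E F A) [𝒜.IsRegular] [𝒜.HasAbelianIsotropy] (p q : ℕ) :=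
  Cohomology (𝒜.dF q) p

/-- A morphism of Lie algebroids over the identity of `M`: a smooth vector bundle map compatible
with the anchors and the brackets. -/
structure Hom (𝒜 : LieAlgebroid E F A) (ℬ : LieAlgebroid E F' A') where
  toFun : ∀ x, A x →ₗ[ℝ] A' x
  smooth : ∀ X : (smoothSections E F A).carrier,
    (fun x => toFun x (X.1 x)) ∈ (smoothSections E F' A').carrier
  anchor_apply : ∀ x (a : A x), ℬ.anchor x (toFun x a) = 𝒜.anchor x a
  bracket_apply : ∀ (X Y : (smoothSections E F A).carrier) (x : M),
    toFun x ((𝒜.bracket X Y).1 x) = (ℬ.bracket ⟨_, smooth X⟩ ⟨_, smooth Y⟩).1 x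

/-- The pullback of forms along a morphism of Lie algebroids over the identity of `M`. -/
def Hom.pullback {𝒜 : LieAlgebroid E F A} {ℬ : LieAlgebroid E F' A'} (φ : 𝒜.Hom ℬ) (n : ℕ) :
    ℬ.Form n →ₗ[ℝ] 𝒜.Form n where
  toFun β := ⟨fun x => (β.1 x).compLinearMap (φ.toFun x), fun X =>
    β.2 fun i => ⟨_, φ.smooth (X i)⟩⟩
  map_add' _ _ := rfl
  map_smul' _ _ := rfl

end LieAlgebroid

end Morphisms

end LieAlgd

end

universe uA

/-! A splitting σ gives A = σ(T𝓕) ⊕ K, so a form on A is the same as the tuple of its restrictions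
to p arguments from T𝓕 and q arguments from K. In these terms the bracket has only the pieces [σY₁,
σY₂] = σ[Y₁, Y₂] + γ(Y₁, Y₂), [σY, V] = ∇_Y V and [V, W] = 0, and K acts on functions by zero. Hence
d_A either raises p by one, through d_𝓕, or raises it by two, through insertion of γ, and does
nothing else. `blockRestrict_ce` is this computation for abstract vector spaces with a bracket,
carried out by induction on p with Cartan's formula; `Splitting.component_dA` is its geometric form.
The same induction by contraction gives d² = 0 (`ce_ce`). Statements about forms are checked on
sections, which determine a form.

In components, F^p is the space of forms whose components of T𝓕-degree less than p vanish
(`Splitting.mem_filtration_iff`). So d_A preserves F, induces zero on the graded pieces and d_𝓕 one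
step further, and the second page is foliated cohomology. A closed β lifts to the form α whose only
component is β, and then d_A α has the single component (-1)^p i_γ β; this is d₂. On F^p the leading
component does not depend on the splitting (`Splitting.component_eq_of_mem`), so neither does the
identification of the second page.

If σ is changed by a K-valued one-form κ, the curvature changes by dκ: the quadratic term in κ
vanishes because K is abelian. So the class of γ is well defined, and every closed representative is
itself the curvature of some splitting; the formula for d₂ need only be proved for curvatures.

The remainder is the algebra of filtered complexes. The homology of the r-th page and the next page
are both quotients of Z_(r+1)^p, with the same kernel. Convergence holds because the filtration is
finite in each degree, and naturality because a morphism respects anchors and hence maps kernels of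
anchors to each other. -/

noncomputable section

namespace LieAlgd

/-! ### Chevalley–Eilenberg calculus on abstract vector spaces -/

section ChevalleyEilenberg

variable {L : Type*} [AddCommGroup L] [Module ℝ L] {N : Type*} [AddCommGroup N] [Module ℝ N]

/-- `T.curryLeft X` is the contraction ι_X T. The identities of the calculus are proved by
contracting both sides and inducting on the degree. -/
theorem alternatingMap_ext_curryLeft {n : ℕ} {T S : L [⋀^Fin (n + 1)]→ₗ[ℝ] N}
    (h : ∀ X, T.curryLeft X = S.curryLeft X) : T = S := by
  ext v
  have := congrArg (fun R => R (Fin.tail v)) (h (v 0))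
  simpa [Matrix.vecCons, Fin.cons_self_tail] using this

/-- The relation [L, ι_Y] = ι_{D Y}: the term where `D` acts on the first argument is the only one
missing from the Lie derivative of the contracted form. -/
theorem curryLeft_lieDer {n : ℕ} (D : L →ₗ[ℝ] L) (D' : N →ₗ[ℝ] N)
    (T : L [⋀^Fin (n + 1)]→ₗ[ℝ] N) (Y : L) :
    (lieDer D D' T).curryLeft Y = lieDer D D' (T.curryLeft Y) - T.curryLeft (D Y) := by
  ext v
  simp only [AlternatingMap.curryLeft_apply_apply, AlternatingMap.sub_apply, lieDer_apply,
    Fin.sum_univ_succ]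
  have h0 : Function.update (Matrix.vecCons Y v : Fin (n + 1) → L) 0
      (D ((Matrix.vecCons Y v : Fin (n + 1) → L) 0)) = Matrix.vecCons (D Y) v := by
    simp [Matrix.vecCons, Fin.update_cons_zero]
  have h1 : ∀ i : Fin n, Function.update (Matrix.vecCons Y v : Fin (n + 1) → L) i.succ
      (D ((Matrix.vecCons Y v : Fin (n + 1) → L) i.succ)) =
        Matrix.vecCons Y (Function.update v i (D (v i))) := by
    intro i
    simp [Matrix.vecCons, Fin.cons_update]
  simp only [h0, h1]
  abel

theorem lieDer_zero_apply (D : L →ₗ[ℝ] L) (D' : N →ₗ[ℝ] N)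
    (T : L [⋀^Fin 0]→ₗ[ℝ] N) (v : Fin 0 → L) : lieDer D D' T v = D' (T v) := by
  simp [lieDer_apply]

theorem lieDer_add {n : ℕ} (D : L →ₗ[ℝ] L) (D' : N →ₗ[ℝ] N) (T S : L [⋀^Fin n]→ₗ[ℝ] N) :
    lieDer D D' (T + S) = lieDer D D' T + lieDer D D' S := by
  ext v
  simp only [lieDer_apply, AlternatingMap.add_apply, map_add, Finset.sum_add_distrib]
  abel

theorem lieDer_smul {n : ℕ} (D : L →ₗ[ℝ] L) (D' : N →ₗ[ℝ] N) (c : ℝ) (T : L [⋀^Fin n]→ₗ[ℝ] N) :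
    lieDer D D' (c • T) = c • lieDer D D' T := by
  ext v
  simp only [lieDer_apply, AlternatingMap.smul_apply, map_smul, smul_sub, Finset.smul_sum]

theorem lieDer_sub {n : ℕ} (D : L →ₗ[ℝ] L) (D' : N →ₗ[ℝ] N) (T S : L [⋀^Fin n]→ₗ[ℝ] N) :
    lieDer D D' (T - S) = lieDer D D' T - lieDer D D' S := by
  ext v
  simp only [lieDer_apply, AlternatingMap.sub_apply, map_sub, Finset.sum_sub_distrib]
  abel

/-- After contraction with `X` the cross terms, with one derivation on the form and the other on
`X`, cancel; what is left is the commutator on ι_X T, known by induction, and the commutator on `X`.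
This gives both [L_X, L_Y] = L_[X, Y] and the flatness of induced connections. -/
theorem lieDer_commutator {n : ℕ} (D₁ D₂ D : L →ₗ[ℝ] L) (D₁' D₂' D' : N →ₗ[ℝ] N)
    (h : ∀ X, D X = D₁ (D₂ X) - D₂ (D₁ X)) (h' : ∀ s, D' s = D₁' (D₂' s) - D₂' (D₁' s))
    (T : L [⋀^Fin n]→ₗ[ℝ] N) :
    lieDer D D' T = lieDer D₁ D₁' (lieDer D₂ D₂' T) - lieDer D₂ D₂' (lieDer D₁ D₁' T) := by
  induction n with
  | zero =>
    ext v
    simp only [AlternatingMap.sub_apply, lieDer_zero_apply, h']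
  | succ n ih =>
    refine alternatingMap_ext_curryLeft fun X => ?_
    have hs : ∀ A B : L [⋀^Fin (n + 1)]→ₗ[ℝ] N,
        (A - B).curryLeft X = A.curryLeft X - B.curryLeft X := fun _ _ => rfl
    rw [hs]
    simp only [curryLeft_lieDer, lieDer_sub, h, map_sub, ih (T.curryLeft X)]
    abel

/-- The infinitesimal action on alternating maps as a linear map in the acting element. -/
def lieDerHom {L' : Type*} [AddCommGroup L'] [Module ℝ L'] (D : L' →ₗ[ℝ] L →ₗ[ℝ] L)
    (D' : L' →ₗ[ℝ] N →ₗ[ℝ] N) (n : ℕ) :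
    L' →ₗ[ℝ] (L [⋀^Fin n]→ₗ[ℝ] N) →ₗ[ℝ] L [⋀^Fin n]→ₗ[ℝ] N :=
  LinearMap.mk₂ ℝ (fun X T => lieDer (D X) (D' X) T)
    (fun X Y T => by
      ext v
      simp only [AlternatingMap.add_apply, lieDer_apply, map_add, LinearMap.add_apply,
        AlternatingMap.map_update_add, Finset.sum_add_distrib]
      abel)
    (fun c X T => by
      ext v
      simp only [AlternatingMap.smul_apply, lieDer_apply, map_smul, LinearMap.smul_apply,
        AlternatingMap.map_update_smul, ← Finset.smul_sum, smul_sub])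
    (fun X T S => lieDer_add _ _ T S)
    (fun c X T => lieDer_smul _ _ c T)

theorem lieDerHom_apply {L' : Type*} [AddCommGroup L'] [Module ℝ L'] (D : L' →ₗ[ℝ] L →ₗ[ℝ] L)
    (D' : L' →ₗ[ℝ] N →ₗ[ℝ] N) {n : ℕ} (X : L') (T : L [⋀^Fin n]→ₗ[ℝ] N) :
    lieDerHom D D' n X T = lieDer (D X) (D' X) T := rfl

variable (b : L →ₗ[ℝ] L →ₗ[ℝ] L) (hb : ∀ X, b X X = 0) (ρ : L →ₗ[ℝ] N →ₗ[ℝ] N)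

/-- The bilinear map `(X, Y) ↦ ι_[X, Y] T`. -/
def bracketInsert {n : ℕ} (T : L [⋀^Fin (n + 1)]→ₗ[ℝ] N) : L →ₗ[ℝ] L →ₗ[ℝ] L [⋀^Fin n]→ₗ[ℝ] N :=
  LinearMap.mk₂ ℝ (fun X Y => T.curryLeft (b X Y))
    (fun X Y Z => by simp) (fun c X Y => by simp) (fun X Y Z => by simp) (fun c X Y => by simp)

/-- The part of the Chevalley–Eilenberg differential involving the brackets. -/
def ceBracket : ∀ {n : ℕ}, (L [⋀^Fin n]→ₗ[ℝ] N) → L [⋀^Fin (n + 1)]→ₗ[ℝ] N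
  | 0, _ => 0
  | _ + 1, T => pairSum (bracketInsert b T) (fun X => by simp [bracketInsert, hb])

/-- The Chevalley–Eilenberg differential attached to a skew-symmetric bracket `b` on `L` and to
an action `ρ` of `L` on `N`. -/
def ce {n : ℕ} (T : L [⋀^Fin n]→ₗ[ℝ] N) : L [⋀^Fin (n + 1)]→ₗ[ℝ] N :=
  AlternatingMap.alternatizeUncurryFin
    { toFun := fun X => (ρ X).compAlternatingMap T
      map_add' := fun X Y => by ext; simp
      map_smul' := fun c X => by ext; simp } + ceBracket b hb T

theorem ce_apply_succ {n : ℕ} (T : L [⋀^Fin (n + 1)]→ₗ[ℝ] N) (X : Fin (n + 2) → L) :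
    ce b hb ρ T X = ∑ i : Fin (n + 2), (-1 : ℤ) ^ (i : ℕ) • ρ (X i) (T (i.removeNth X)) +
      ∑ i : Fin (n + 1), ∑ j ∈ Finset.Ici i, (-1 : ℤ) ^ ((i : ℕ) + ((j : ℕ) + 1)) •
        T (Matrix.vecCons (b (X i.castSucc) (X j.succ))
          (j.removeNth (i.castSucc.removeNth X))) := by
  rw [ce, AlternatingMap.add_apply, AlternatingMap.alternatizeUncurryFin_apply]
  rfl

theorem ce_apply_zero (T : L [⋀^Fin 0]→ₗ[ℝ] N) (X : Fin 1 → L) :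
    ce b hb ρ T X = ρ (X 0) (T (Fin.removeNth 0 X)) := by
  rw [ce, AlternatingMap.add_apply, AlternatingMap.alternatizeUncurryFin_apply]
  simp [ceBracket]

theorem ce_add {n : ℕ} (T S : L [⋀^Fin n]→ₗ[ℝ] N) :
    ce b hb ρ (T + S) = ce b hb ρ T + ce b hb ρ S := by
  ext X : 1
  cases n with
  | zero => simp [ce_apply_zero]
  | succ n =>
    simp only [ce_apply_succ, AlternatingMap.add_apply, map_add, smul_add,
      Finset.sum_add_distrib]
    abel

theorem ce_smul {n : ℕ} (c : ℝ) (T : L [⋀^Fin n]→ₗ[ℝ] N) :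
    ce b hb ρ (c • T) = c • ce b hb ρ T := by
  ext X : 1
  cases n with
  | zero => simp [ce_apply_zero]
  | succ n =>
    simp only [ce_apply_succ, AlternatingMap.smul_apply, map_smul, smul_add,
      Finset.smul_sum, smul_comm c]

theorem ce_sub {n : ℕ} (T S : L [⋀^Fin n]→ₗ[ℝ] N) :
    ce b hb ρ (T - S) = ce b hb ρ T - ce b hb ρ S := by
  have h : T - S = T + (-1 : ℝ) • S := by rw [neg_one_smul, sub_eq_add_neg]
  rw [h, ce_add, ce_smul, neg_one_smul, sub_eq_add_neg]

/-- Cartan's formula in degree zero, where the term d ι_X T is absent. -/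
theorem curryLeft_ce_zero (T : L [⋀^Fin 0]→ₗ[ℝ] N) (X : L) :
    (ce b hb ρ T).curryLeft X = lieDer (b X) (ρ X) T := by
  ext v
  rw [AlternatingMap.curryLeft_apply_apply, ce_apply_zero, lieDer_zero_apply]
  congr 2

theorem pairSum_vecCons_zero (Ψ : L →ₗ[ℝ] L →ₗ[ℝ] L [⋀^Fin 0]→ₗ[ℝ] N) (hΨ : ∀ v, Ψ v v = 0)
    (X : L) (Y : Fin 1 → L) : pairSum Ψ hΨ (Matrix.vecCons X Y) =
      ∑ j : Fin 1, (-1 : ℤ) ^ ((j : ℕ) + 1) • Ψ X (Y j) (j.removeNth Y) := by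
  rw [pairSum_apply, Fin.sum_univ_one, Fin.sum_univ_one]
  have hI : Finset.Ici (0 : Fin 1) = {0} := by decide
  rw [hI, Finset.sum_singleton]
  simp [Fin.removeNth_zero]

/-- The pairs i < j are separated according to whether i = 0. In the others both indices drop by
one, which leaves the sign (-1)^(i+j) unchanged. -/
theorem pairSum_vecCons_succ {m : ℕ} (Ψ : L →ₗ[ℝ] L →ₗ[ℝ] L [⋀^Fin (m + 1)]→ₗ[ℝ] N)
    (hΨ : ∀ v, Ψ v v = 0) (X : L) (Y : Fin (m + 2) → L) :
    pairSum Ψ hΨ (Matrix.vecCons X Y) =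
      ∑ j : Fin (m + 2), (-1 : ℤ) ^ ((j : ℕ) + 1) • Ψ X (Y j) (j.removeNth Y) +
      pairSum (Ψ.compr₂ (AlternatingMap.curryLeftLinearMap.flip X))
        (fun v => by simp [hΨ]) Y := by
  rw [pairSum_apply, pairSum_apply, Fin.sum_univ_succ]
  have hI : Finset.Ici (0 : Fin (m + 2)) = Finset.univ := by ext; simp
  rw [hI]
  congr 1
  · refine Finset.sum_congr rfl fun j _ => ?_
    simp [Fin.removeNth_zero]
  · refine Finset.sum_congr rfl fun i _ => ?_
    rw [← Fin.map_succEmb_Ici, Finset.sum_map]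
    refine Finset.sum_congr rfl fun j _ => ?_
    have hr : i.succ.castSucc.removeNth (Matrix.vecCons X Y : Fin (m + 3) → L) =
        Matrix.vecCons X (i.castSucc.removeNth Y) := by
      rw [← Fin.succ_castSucc]
      exact removeNth_succ_vecCons _ _ _
    have hs : (-1 : ℤ) ^ ((i.succ : ℕ) + ((j.succ : ℕ) + 1)) =
        (-1 : ℤ) ^ ((i : ℕ) + ((j : ℕ) + 1)) := by
      rw [Fin.val_succ, Fin.val_succ,
        show (i : ℕ) + 1 + ((j : ℕ) + 1 + 1) = (i : ℕ) + ((j : ℕ) + 1) + 2 by ring, pow_add]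
      simp
    rw [Fin.coe_succEmb, hs, hr, removeNth_succ_vecCons]
    rfl

/-- The pairs containing the new argument assemble to the action of `b X` on the arguments of `T`.
In the other pairs `X` is exchanged with the inserted bracket, whence the minus sign of the last
term. -/
theorem ceBracket_vecCons {n : ℕ} (T : L [⋀^Fin (n + 1)]→ₗ[ℝ] N) (X : L) (Y : Fin (n + 1) → L) :
    ceBracket b hb T (Matrix.vecCons X Y) =
      - ∑ j : Fin (n + 1), T (Function.update Y j (b X (Y j))) -
        ceBracket b hb (T.curryLeft X) Y := by
  -- Moving `b X (Y j)` from the front to place j costs (-1)^j; together with (-1)^(j+1) this is the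
  -- sign -1 for every j.
  have hins : ∑ j : Fin (n + 1), (-1 : ℤ) ^ ((j : ℕ) + 1) •
        bracketInsert b T X (Y j) (j.removeNth Y) =
      - ∑ j : Fin (n + 1), T (Function.update Y j (b X (Y j))) := by
    rw [← Finset.sum_neg_distrib]
    refine Finset.sum_congr rfl fun j _ => ?_
    rw [← Fin.insertNth_removeNth, AlternatingMap.map_insertNth, pow_succ, mul_neg_one, neg_smul]
    rfl
  cases n with
  | zero =>
    rw [ceBracket, ceBracket, pairSum_vecCons_zero, hins]
    simp
  | succ n =>
    rw [ceBracket, ceBracket, pairSum_vecCons_succ, hins, sub_eq_add_neg]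
    congr 1
    rw [pairSum_apply, pairSum_apply, ← Finset.sum_neg_distrib]
    refine Finset.sum_congr rfl fun i _ => ?_
    rw [← Finset.sum_neg_distrib]
    refine Finset.sum_congr rfl fun j _ => ?_
    rw [← smul_neg]
    congr 1
    change T (Matrix.vecCons _ (Matrix.vecCons X _)) = - T (Matrix.vecCons X (Matrix.vecCons _ _))
    rw [← T.map_swap _ (i := 0) (j := 1) (by simp)]
    congr 1
    ext k : 1
    refine Fin.cases ?_ (fun k => Fin.cases ?_ (fun k => ?_) k) k
    · simp
    · simp
    · rw [Function.comp_apply, Equiv.swap_apply_of_ne_of_ne] <;> simp [Fin.ext_iff]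

theorem ce_apply {n : ℕ} (T : L [⋀^Fin n]→ₗ[ℝ] N) (X : Fin (n + 1) → L) :
    ce b hb ρ T X = ∑ i : Fin (n + 1), (-1 : ℤ) ^ (i : ℕ) • ρ (X i) (T (i.removeNth X)) +
      ceBracket b hb T X := by
  rw [ce, AlternatingMap.add_apply, AlternatingMap.alternatizeUncurryFin_apply]
  rfl

/-- Cartan's formula. -/
theorem curryLeft_ce_succ {n : ℕ} (T : L [⋀^Fin (n + 1)]→ₗ[ℝ] N) (X : L) :
    (ce b hb ρ T).curryLeft X = lieDer (b X) (ρ X) T - ce b hb ρ (T.curryLeft X) := by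
  ext Y
  have hsum : ∑ i : Fin (n + 2), (-1 : ℤ) ^ (i : ℕ) •
        ρ ((Matrix.vecCons X Y : Fin (n + 2) → L) i)
          (T (i.removeNth (Matrix.vecCons X Y : Fin (n + 2) → L))) =
      ρ X (T Y) - ∑ i : Fin (n + 1), (-1 : ℤ) ^ (i : ℕ) •
        ρ (Y i) (T.curryLeft X (i.removeNth Y)) := by
    rw [Fin.sum_univ_succ, sub_eq_add_neg, ← Finset.sum_neg_distrib]
    congr 1
    · simp [Fin.removeNth_zero]
    · refine Finset.sum_congr rfl fun i _ => ?_
      rw [removeNth_succ_vecCons, Fin.val_succ, pow_succ, mul_neg_one, neg_smul]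
      rfl
  rw [AlternatingMap.curryLeft_apply_apply, AlternatingMap.sub_apply, lieDer_apply, ce_apply,
    ce_apply, hsum, ceBracket_vecCons]
  abel

section Flat

variable (hj : ∀ X Y Z, b X (b Y Z) = b (b X Y) Z + b Y (b X Z))
  (hρ : ∀ X Y s, ρ (b X Y) s = ρ X (ρ Y s) - ρ Y (ρ X s))

include hj hρ

/-- Contraction with `Y` and Cartan's formula reduce the claim to [L_X, L_Y] = L_[X, Y], where the
Jacobi identity and the flatness of `ρ` enter, and to the same claim for ι_Y T. -/
theorem lieDer_ce {n : ℕ} (T : L [⋀^Fin n]→ₗ[ℝ] N) (X : L) :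
    lieDer (b X) (ρ X) (ce b hb ρ T) = ce b hb ρ (lieDer (b X) (ρ X) T) := by
  have hc : ∀ {n : ℕ} (Y : L) (T : L [⋀^Fin n]→ₗ[ℝ] N), lieDer (b (b X Y)) (ρ (b X Y)) T =
      lieDer (b X) (ρ X) (lieDer (b Y) (ρ Y) T) - lieDer (b Y) (ρ Y) (lieDer (b X) (ρ X) T) :=
    fun Y T => lieDer_commutator _ _ _ _ _ _ (fun Z => by rw [hj X Y Z]; abel) (hρ X Y) T
  induction n with
  | zero =>
    refine alternatingMap_ext_curryLeft fun Y => ?_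
    rw [curryLeft_lieDer, curryLeft_ce_zero, curryLeft_ce_zero, curryLeft_ce_zero, hc]
    abel
  | succ n ih =>
    refine alternatingMap_ext_curryLeft fun Y => ?_
    rw [curryLeft_lieDer, curryLeft_ce_succ, curryLeft_ce_succ, curryLeft_ce_succ, hc,
      curryLeft_lieDer, ce_sub, lieDer_sub, ih]
    abel

/-- Cartan's formula applied twice gives ι_X d d T = L_X d T - d L_X T + d d ι_X T. The first two
terms cancel and the last vanishes by induction. -/
theorem ce_ce {n : ℕ} (T : L [⋀^Fin n]→ₗ[ℝ] N) : ce b hb ρ (ce b hb ρ T) = 0 := by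
  induction n with
  | zero =>
    refine alternatingMap_ext_curryLeft fun X => ?_
    rw [curryLeft_ce_succ, curryLeft_ce_zero, lieDer_ce b hb ρ hj hρ, sub_self]
    rfl
  | succ n ih =>
    refine alternatingMap_ext_curryLeft fun X => ?_
    rw [curryLeft_ce_succ, curryLeft_ce_succ, lieDer_ce b hb ρ hj hρ, ce_sub, ih, sub_zero,
      sub_self]
    rfl

end Flat

/-- The Chevalley–Eilenberg differential is natural. -/
theorem ce_map {L' : Type*} [AddCommGroup L'] [Module ℝ L'] {N' : Type*} [AddCommGroup N']
    [Module ℝ N'] (b' : L' →ₗ[ℝ] L' →ₗ[ℝ] L') (hb' : ∀ X, b' X X = 0)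
    (ρ' : L' →ₗ[ℝ] N' →ₗ[ℝ] N') (f : L' →ₗ[ℝ] L) (g : N →ₗ[ℝ] N')
    (hf : ∀ X Y, f (b' X Y) = b (f X) (f Y)) (hg : ∀ X s, g (ρ (f X) s) = ρ' X (g s))
    {n : ℕ} (T : L [⋀^Fin n]→ₗ[ℝ] N) :
    ce b' hb' ρ' (g.compAlternatingMap (T.compLinearMap f)) =
      g.compAlternatingMap ((ce b hb ρ T).compLinearMap f) := by
  ext X
  cases n with
  | zero =>
    simp only [ce_apply_zero, LinearMap.compAlternatingMap_apply, AlternatingMap.compLinearMap_apply,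
      ← hg]
    rfl
  | succ n =>
    simp only [ce_apply_succ, LinearMap.compAlternatingMap_apply,
      AlternatingMap.compLinearMap_apply, ← hg, map_add, map_sum, map_zsmul]
    congr 1
    refine Finset.sum_congr rfl fun i _ => Finset.sum_congr rfl fun j _ => ?_
    congr 3
    ext k : 1
    refine Fin.cases ?_ (fun k => ?_) k
    · exact hf _ _
    · rfl

end ChevalleyEilenberg

/-! ### Block components of the Chevalley–Eilenberg differential -/

section BlockDecomposition

variable {L : Type*} [AddCommGroup L] [Module ℝ L] {N : Type*} [AddCommGroup N] [Module ℝ N]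
  {L₁ : Type*} [AddCommGroup L₁] [Module ℝ L₁] {L₂ : Type*} [AddCommGroup L₂] [Module ℝ L₂]
  (s : L₁ →ₗ[ℝ] L) (t : L₂ →ₗ[ℝ] L)

theorem append_cast_vecCons {α : Type*} {p q n : ℕ} (h : p + q = n) (a : α) (y : Fin p → α)
    (v : Fin q → α) (h' : n + 1 = p + 1 + q) :
    (fun i : Fin (n + 1) => Fin.append (Matrix.vecCons a y : Fin (p + 1) → α) v (Fin.cast h' i)) =
      Matrix.vecCons a (fun i : Fin n => Fin.append y v (Fin.cast h.symm i)) := by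
  subst h
  rw [Matrix.vecCons, Matrix.vecCons, Fin.append_cons]
  funext i
  rfl

theorem comp_vecCons {α β : Type*} (f : α → β) {n : ℕ} (a : α) (v : Fin n → α) :
    (fun i => f ((Matrix.vecCons a v : Fin (n + 1) → α) i)) =
      (Matrix.vecCons (f a) (fun i => f (v i)) : Fin (n + 1) → β) := by
  funext i
  refine Fin.cases ?_ (fun i => ?_) i <;> rfl

theorem curryLeft_blockRestrict {p q n : ℕ} (h : p + q = n) (h' : p + 1 + q = n + 1)
    (T : L [⋀^Fin (n + 1)]→ₗ[ℝ] N) (X : L₁) :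
    (blockRestrict s t h' T).curryLeft X = blockRestrict s t h (T.curryLeft (s X)) := by
  ext Y V
  rw [AlternatingMap.curryLeft_apply_apply, blockRestrict_apply, blockRestrict_apply,
    AlternatingMap.curryLeft_apply_apply, comp_vecCons, append_cast_vecCons h]

/-- The first argument from `L₂` stands at position p of `T`, so bringing it to the front crosses p
arguments. -/
theorem blockRestrict_vecCons {p q n : ℕ} (h : p + q = n) (h' : p + (q + 1) = n + 1)
    (T : L [⋀^Fin (n + 1)]→ₗ[ℝ] N) (Y : Fin p → L₁) (v : L₂) (V : Fin q → L₂) :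
    blockRestrict s t h' T Y (Matrix.vecCons v V) =
      (-1 : ℤ) ^ p • blockRestrict s t h (T.curryLeft (t v)) Y V := by
  subst h
  have key : ∀ a : Fin (p + q + 1), (a : ℕ) = p →
      (fun i => Fin.append (fun j => s (Y j)) (fun j => t ((Matrix.vecCons v V : Fin (q + 1) → L₂) j))
        (Fin.cast h'.symm i)) = a.insertNth (t v)
          (fun i => Fin.append (fun j => s (Y j)) (fun j => t (V j)) (Fin.cast rfl i)) := by
    intro a ha
    rw [Fin.eq_insertNth_iff]
    constructor
    · have : Fin.cast h'.symm a = Fin.natAdd p (0 : Fin (q + 1)) := by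
        apply Fin.ext; simp [ha]
      rw [this, Fin.append_right]
      rfl
    · funext i
      rw [Fin.removeNth]
      refine Fin.addCases (fun i => ?_) (fun i => ?_) i
      · have : Fin.cast h'.symm (a.succAbove (Fin.castAdd q i)) = Fin.castAdd (q + 1) i := by
          apply Fin.ext
          rw [Fin.succAbove_of_castSucc_lt _ _ (by rw [Fin.lt_def]; simp [ha])]
          simp
        rw [this, Fin.append_left]
        simp
      · have : Fin.cast h'.symm (a.succAbove (Fin.natAdd p i)) = Fin.natAdd p i.succ := by
          apply Fin.ext
          rw [Fin.succAbove_of_le_castSucc _ _ (by rw [Fin.le_def]; simp [ha])]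
          simp [add_assoc]
        rw [this, Fin.append_right]
        simp
  rw [blockRestrict_apply, key ⟨p, by omega⟩ rfl, AlternatingMap.map_insertNth]
  rfl

/-- Pulling the substituted vector out of slot j crosses j arguments. It serves for vectors `a` in
the image of `t`, which afterwards are moved to the second block. -/
theorem apply_update_append {p q n : ℕ} (h : p + q = n) (h' : p + 1 + q = n + 1)
    (T : L [⋀^Fin (n + 1)]→ₗ[ℝ] N) (y : Fin (p + 1) → L) (v : Fin q → L) (j : Fin (p + 1)) (a : L) :
    T (Function.update (fun i => Fin.append y v (Fin.cast h'.symm i))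
        (Fin.cast h' (Fin.castAdd q j)) a) =
      (-1 : ℤ) ^ (j : ℕ) • T.curryLeft a
        (fun i => Fin.append (j.removeNth y) v (Fin.cast h.symm i)) := by
  subst h
  rw [← Fin.insertNth_removeNth, AlternatingMap.map_insertNth]
  congr 1
  rw [AlternatingMap.curryLeft_apply_apply]
  congr 2
  funext i
  rw [Fin.removeNth]
  refine Fin.addCases (fun i => ?_) (fun i => ?_) i
  · have : Fin.cast h'.symm ((Fin.cast h' (Fin.castAdd q j)).succAbove (Fin.castAdd q i)) =
        Fin.castAdd q (j.succAbove i) := by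
      apply Fin.ext
      simp [Fin.succAbove, Fin.lt_def]
      split_ifs <;> simp
    rw [this, Fin.append_left]
    simp [Fin.removeNth]
  · have : Fin.cast h'.symm ((Fin.cast h' (Fin.castAdd q j)).succAbove (Fin.natAdd p i)) =
        Fin.natAdd (p + 1) i := by
      apply Fin.ext
      rw [Fin.succAbove_of_le_castSucc _ _ (by rw [Fin.le_def]; simp; omega)]
      simp
      omega
    rw [this, Fin.append_right]
    simp

variable (b : L →ₗ[ℝ] L →ₗ[ℝ] L) (hb : ∀ X, b X X = 0) (ρ : L →ₗ[ℝ] N →ₗ[ℝ] N)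
  (b₁ : L₁ →ₗ[ℝ] L₁ →ₗ[ℝ] L₁) (hb₁ : ∀ X, b₁ X X = 0) (D : L₁ →ₗ[ℝ] L₂ →ₗ[ℝ] L₂)
  (γ : L₁ [⋀^Fin 2]→ₗ[ℝ] L₂)

/-- The Lie derivative along `s X` acts on blocks as the induced one, up to the failure `c` of `s`
to preserve the bracket with `X`; for a splitting `c Y` is γ(X, Y). -/
theorem blockRestrict_lieDer_aux
    (hst : ∀ X V, b (s X) (t V) = t (D X V)) {p q n : ℕ} (h : p + q = n)
    (T : L [⋀^Fin n]→ₗ[ℝ] N) (X : L₁) (c : L₁ → L) (hss : ∀ Y, b (s X) (s Y) = s (b₁ X Y) + c Y)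
    (Y : Fin p → L₁) (V : Fin q → L₂) :
    blockRestrict s t h (lieDer (b (s X)) (ρ (s X)) T) Y V =
      lieDer (b₁ X) (lieDerHom D (ρ ∘ₗ s) q X) (blockRestrict s t h T) Y V -
      ∑ j : Fin p, T (Function.update
        (fun i => Fin.append (fun j => s (Y j)) (fun j => t (V j)) (Fin.cast h.symm i))
        (Fin.cast h (Fin.castAdd q j)) (c (Y j))) := by
  subst h
  rw [blockRestrict_apply, lieDer_apply, lieDer_apply, lieDerHom_apply, AlternatingMap.sub_apply,
    lieDer_apply, Fin.sum_univ_add, sum_alt_apply]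
  have e1 : ∀ j : Fin p, T (Function.update
        (fun i => Fin.append (fun j => s (Y j)) (fun j => t (V j)) (Fin.cast rfl i))
        (Fin.castAdd q j) (b (s X) (Fin.append (fun j => s (Y j)) (fun j => t (V j))
          (Fin.cast rfl (Fin.castAdd q j))))) =
      blockRestrict s t rfl T (Function.update Y j (b₁ X (Y j))) V +
      T (Function.update
        (fun i => Fin.append (fun j => s (Y j)) (fun j => t (V j)) (Fin.cast rfl i))
        (Fin.castAdd q j) (c (Y j))) := by
    intro j
    rw [Fin.cast_refl, id, Fin.append_left, hss, T.map_update_add, blockRestrict_apply,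
      append_update_left s]
    rfl
  have e2 : ∀ j : Fin q, T (Function.update
        (fun i => Fin.append (fun j => s (Y j)) (fun j => t (V j)) (Fin.cast rfl i))
        (Fin.natAdd p j) (b (s X) (Fin.append (fun j => s (Y j)) (fun j => t (V j))
          (Fin.cast rfl (Fin.natAdd p j))))) =
      blockRestrict s t rfl T Y (Function.update V j (D X (V j))) := by
    intro j
    rw [Fin.cast_refl, id, Fin.append_right, hst, blockRestrict_apply, append_update_right t]
    rfl
  simp only [e1, e2, Finset.sum_add_distrib]
  rw [blockRestrict_apply s t rfl T Y V]
  simp only [Fin.cast_refl, LinearMap.comp_apply, id]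
  abel

theorem curryLeft_pairSum_insertPair_zero {q : ℕ} (β : L₁ [⋀^Fin 0]→ₗ[ℝ] L₂ [⋀^Fin (q + 1)]→ₗ[ℝ] N)
    (X : L₁) (Y : Fin 1 → L₁) (V : Fin q → L₂) :
    (pairSum (insertPair γ β) (insertPair_self _ _)).curryLeft X Y V =
      ∑ j : Fin 1, (-1 : ℤ) ^ ((j : ℕ) + 1) •
        β (j.removeNth Y) (Matrix.vecCons (γ ![X, Y j]) V) := by
  rw [AlternatingMap.curryLeft_apply_apply, pairSum_vecCons_zero, sum_alt_apply]
  rfl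

theorem curryLeft_pairSum_insertPair_succ {p q : ℕ}
    (β : L₁ [⋀^Fin (p + 1)]→ₗ[ℝ] L₂ [⋀^Fin (q + 1)]→ₗ[ℝ] N)
    (X : L₁) (Y : Fin (p + 2) → L₁) (V : Fin q → L₂) :
    (pairSum (insertPair γ β) (insertPair_self _ _)).curryLeft X Y V =
      ∑ j : Fin (p + 2), (-1 : ℤ) ^ ((j : ℕ) + 1) •
        β (j.removeNth Y) (Matrix.vecCons (γ ![X, Y j]) V) +
      pairSum (insertPair γ (β.curryLeft X)) (insertPair_self _ _) Y V := by
  rw [AlternatingMap.curryLeft_apply_apply, pairSum_vecCons_succ, AlternatingMap.add_apply,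
    sum_alt_apply]
  rfl

/-- The component of the total differential in bidegree `(p, q)`. -/
def blockDiff {n : ℕ} (T : L [⋀^Fin n]→ₗ[ℝ] N) :
    ∀ p q : ℕ, p + q = n + 1 → L₁ [⋀^Fin p]→ₗ[ℝ] L₂ [⋀^Fin q]→ₗ[ℝ] N
  | 0, _, _ => 0
  | 1, q, _ => ce b₁ hb₁ (lieDerHom D (ρ ∘ₗ s) q) (blockRestrict s t (by omega : 0 + q = n) T)
  | p + 2, q, _ => ce b₁ hb₁ (lieDerHom D (ρ ∘ₗ s) q)
        (blockRestrict s t (by omega : p + 1 + q = n) T) +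
      (-1 : ℝ) ^ p • pairSum (insertPair γ (blockRestrict s t (by omega : p + (q + 1) = n) T))
        (insertPair_self _ _)

/-- Induction on p, by contraction with `s X` and Cartan's formula. The block of L_{sX} T gives the
action of `X` and the terms with γ(X, Yⱼ) in the place of Yⱼ; the block of d ι_{sX} T is known by
induction. Contracting `blockDiff` with `X` produces the same pieces, the γ-terms being the pairs of
`pairSum` that contain `X`. -/
theorem blockRestrict_ce (hst : ∀ X V, b (s X) (t V) = t (D X V))
    (hss : ∀ X Y, b (s X) (s Y) = s (b₁ X Y) + t (γ ![X, Y]))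
    (htt : ∀ V W, b (t V) (t W) = 0) (hρ : ∀ V a, ρ (t V) a = 0)
    {n : ℕ} (T : L [⋀^Fin n]→ₗ[ℝ] N) (p q : ℕ) (h : p + q = n + 1) :
    blockRestrict s t h (ce b hb ρ T) = blockDiff s t ρ b₁ hb₁ D γ T p q h := by
  induction p generalizing n q with
  | zero =>
    ext Y V
    have hq : q = n + 1 := by omega
    subst hq
    rw [blockRestrict_apply, blockDiff]
    -- For p = 0 all arguments lie in the image of `t`, where both the bracket and the action
    -- vanish.
    have : (fun i => Fin.append (fun j => s (Y j)) (fun j => t (V j)) (Fin.cast h.symm i)) =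
        fun i => t (V i) := by
      funext i
      have : Fin.cast h.symm i = Fin.natAdd 0 i := by apply Fin.ext; simp
      rw [this, Fin.append_right]
    rw [this]
    cases n with
    | zero => rw [ce_apply_zero, hρ]; rfl
    | succ n =>
      rw [ce_apply_succ]
      simp only [hρ, htt, smul_zero, Finset.sum_const_zero, zero_add]
      refine Finset.sum_eq_zero fun i _ => Finset.sum_eq_zero fun j _ => ?_
      rw [T.map_coord_zero 0 rfl, smul_zero]
  | succ p ih =>
    refine alternatingMap_ext_curryLeft fun X => ?_
    have hn : p + q = n := by omega
    rw [curryLeft_blockRestrict s t hn]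
    ext Y V
    have hL := blockRestrict_lieDer_aux s t b ρ b₁ D hst hn T X (fun Y => t (γ ![X, Y]))
      (hss X) Y V
    cases p with
    | zero =>
      rw [blockDiff, curryLeft_ce_zero]
      rw [Fin.sum_univ_zero, sub_zero] at hL
      cases n with
      | zero => rw [curryLeft_ce_zero, hL]
      | succ n =>
        rw [curryLeft_ce_succ, ← hL]
        -- In bidegree (0, q) the differential of ι_{sX} T has no component, so only the Lie
        -- derivative contributes.
        have h0 := ih (T.curryLeft (s X)) q hn
        have h1 := congrArg (fun R => R Y V) h0
        have hs : ∀ A B : L [⋀^Fin (n + 1)]→ₗ[ℝ] N, blockRestrict s t hn (A - B) =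
          blockRestrict s t hn A - blockRestrict s t hn B := fun _ _ => rfl
        rw [hs, AlternatingMap.sub_apply, AlternatingMap.sub_apply, h0]
        exact sub_zero _
    | succ p =>
      obtain ⟨m, rfl⟩ : ∃ m, n = m + 1 := ⟨p + q, by omega⟩
      have hm : p + q = m := by omega
      have hs : ∀ A B : L [⋀^Fin (m + 1)]→ₗ[ℝ] N, blockRestrict s t hn (A - B) =
          blockRestrict s t hn A - blockRestrict s t hn B := fun _ _ => rfl
      -- Bringing γ(X, Yⱼ) to the front costs (-1)^j, and moving it past the p remaining arguments
      -- from `L₁` into the second block costs (-1)^p. The latter is the sign in δ₂.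
      have hG : ∑ j : Fin (p + 1), T (Function.update
          (fun i => Fin.append (fun j => s (Y j)) (fun j => t (V j)) (Fin.cast hn.symm i))
          (Fin.cast hn (Fin.castAdd q j)) (t (γ ![X, Y j]))) =
        (-1 : ℝ) ^ p • ∑ j : Fin (p + 1), (-1 : ℤ) ^ (j : ℕ) •
          blockRestrict s t (by omega : p + (q + 1) = m + 1) T (j.removeNth Y)
            (Matrix.vecCons (γ ![X, Y j]) V) := by
        rw [Finset.smul_sum]
        refine Finset.sum_congr rfl fun j _ => ?_
        rw [apply_update_append hm, blockRestrict_vecCons s t hm, smul_comm,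
          ← Int.cast_smul_eq_zsmul ℝ ((-1) ^ p), smul_smul]
        push_cast
        rw [← mul_pow, neg_one_mul, neg_neg, one_pow, one_smul]
        rfl
      rw [curryLeft_ce_succ, hs, AlternatingMap.sub_apply, AlternatingMap.sub_apply, hL, hG,
        ih (T.curryLeft (s X)) q (by omega)]
      have hc : ∀ A B : L₁ [⋀^Fin (p + 2)]→ₗ[ℝ] L₂ [⋀^Fin q]→ₗ[ℝ] N,
        (A + B).curryLeft X = A.curryLeft X + B.curryLeft X := fun _ _ => rfl
      have hc' : ∀ (c : ℝ) (A : L₁ [⋀^Fin (p + 2)]→ₗ[ℝ] L₂ [⋀^Fin q]→ₗ[ℝ] N),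
        (c • A).curryLeft X = c • A.curryLeft X := fun _ _ => rfl
      rw [blockDiff, hc, hc', curryLeft_ce_succ, curryLeft_blockRestrict s t hm]
      simp only [AlternatingMap.add_apply, AlternatingMap.sub_apply, AlternatingMap.smul_apply]
      cases p with
      | zero =>
        rw [curryLeft_pairSum_insertPair_zero, blockDiff]
        simp only [pow_succ, mul_neg_one, neg_smul, Finset.sum_neg_distrib, smul_neg]
        abel
      | succ p =>
        rw [curryLeft_pairSum_insertPair_succ, blockDiff,
          curryLeft_blockRestrict s t (by omega : p + (q + 1) = m)]
        simp only [pow_succ, mul_neg_one, neg_smul, Finset.sum_neg_distrib, smul_neg, smul_add,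
          AlternatingMap.add_apply, AlternatingMap.smul_apply]
        abel

end BlockDecomposition

/-! ### Alternating maps with prescribed blocks -/

section BlockIsomorphism

variable {L : Type*} [AddCommGroup L] [Module ℝ L] {N : Type*} [AddCommGroup N] [Module ℝ N]
  {L₁ : Type*} [AddCommGroup L₁] [Module ℝ L₁] {L₂ : Type*} [AddCommGroup L₂] [Module ℝ L₂]
  (s : L₁ →ₗ[ℝ] L) (t : L₂ →ₗ[ℝ] L)

/-- A permutation that puts the positions in `U` first turns the value into a value of a block of
`T`, up to sign. -/
theorem apply_piecewise_eq_zero {n : ℕ} (T : L [⋀^Fin n]→ₗ[ℝ] N) (U : Finset (Fin n))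
    (hT : ∀ (q : ℕ) (h : U.card + q = n), blockRestrict s t h T = 0) (y : Fin n → L₁)
    (w : Fin n → L₂) : T (U.piecewise (fun i => s (y i)) (fun i => t (w i))) = 0 := by
  have h : U.card + Uᶜ.card = n := by rw [Finset.card_add_card_compl, Fintype.card_fin]
  let e : Fin U.card ⊕ Fin Uᶜ.card ≃ Fin n := finSumEquivOfFinset rfl rfl
  let τ : Equiv.Perm (Fin n) := (finCongr h.symm).trans (finSumFinEquiv.symm.trans e)
  have h0 := congrArg (fun R => R (fun j => y (e (Sum.inl j))) (fun j => w (e (Sum.inr j))))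
    (hT _ h)
  have h1 : (U.piecewise (fun i => s (y i)) (fun i => t (w i))) ∘ τ =
      fun i => Fin.append (fun j => s (y (e (Sum.inl j)))) (fun j => t (w (e (Sum.inr j))))
        (Fin.cast h.symm i) := by
    funext i
    obtain ⟨k, rfl⟩ : ∃ k, i = Fin.cast h k := ⟨Fin.cast h.symm i, by simp⟩
    refine Fin.addCases (fun k => ?_) (fun k => ?_) k
    · have : τ (Fin.cast h (Fin.castAdd _ k)) = e (Sum.inl k) := by simp [τ]
      rw [Function.comp_apply, this, Finset.piecewise_eq_of_mem]
      · simp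
      · simp [e]
    · have : τ (Fin.cast h (Fin.natAdd _ k)) = e (Sum.inr k) := by simp [τ]
      rw [Function.comp_apply, this, Finset.piecewise_eq_of_notMem]
      · simp
      · rw [finSumEquivOfFinset_inr]
        exact Finset.mem_compl.1 (Finset.orderEmbOfFin_mem Uᶜ rfl k)
  have h2 := T.map_perm (U.piecewise (fun i => s (y i)) (fun i => t (w i))) τ
  rw [h1] at h2
  have h3 := h2.symm.trans h0
  change _ = (0 : N) at h3
  exact (smul_eq_zero_iff_eq _).1 h3

/-- An alternating map with enough vanishing blocks vanishes on vectors many of which are in the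
image of `t`. -/
theorem apply_eq_zero_of_blockRestrict {n : ℕ} (T : L [⋀^Fin n]→ₗ[ℝ] N) (S : Finset (Fin n))
    (hT : ∀ (p q : ℕ) (h : p + q = n), p + S.card ≤ n → blockRestrict s t h T = 0)
    (y : Fin n → L₁) (w : Fin n → L₂) (v : Fin n → L) (hv : ∀ i, v i = s (y i) + t (w i))
    (hS : ∀ i ∈ S, y i = 0) : T v = 0 := by
  have h : v = (fun i => s (y i)) + fun i => t (w i) := funext hv
  rw [h]
  -- Multilinear expansion over the sets `U` of slots filled from the image of `s`. Either `U` meets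
  -- `S` and some entry is zero, or `U.card + S.card ≤ n` and the corresponding block vanishes.
  refine (T.toMultilinearMap.map_add_univ _ _).trans (Finset.sum_eq_zero fun U _ => ?_)
  by_cases hU : Disjoint U S
  · refine apply_piecewise_eq_zero s t T U (fun q h => hT _ q h ?_) y w
    rw [← Finset.card_union_of_disjoint hU]
    exact (Finset.card_le_univ _).trans (by simp)
  · obtain ⟨i, hi, hi'⟩ := Finset.not_disjoint_iff.1 hU
    refine T.map_coord_zero i ?_
    rw [Finset.piecewise_eq_of_mem _ _ _ hi, hS i hi', map_zero]

variable (P₁ : L →ₗ[ℝ] L₁) (P₂ : L →ₗ[ℝ] L₂)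

theorem update_castAdd_left {α β : Type*} {p q : ℕ} (f : α → β) (v : Fin (p + q) → α) (i : Fin p)
    (x : α) : (fun k => f (Function.update v (Fin.castAdd q i) x (Fin.cast rfl (Fin.castAdd q k)))) =
      Function.update (fun k => f (v (Fin.cast rfl (Fin.castAdd q k)))) i (f x) := by
  funext k
  rcases eq_or_ne k i with rfl | hk
  · simp
  · rw [Function.update_of_ne hk, Function.update_of_ne (by simpa using hk)]

theorem update_castAdd_right {α β : Type*} {p q : ℕ} (f : α → β) (v : Fin (p + q) → α) (i : Fin p)
    (x : α) : (fun k => f (Function.update v (Fin.castAdd q i) x (Fin.cast rfl (Fin.natAdd p k)))) =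
      fun k => f (v (Fin.cast rfl (Fin.natAdd p k))) := by
  funext k
  rw [Function.update_of_ne (by simp [Fin.ext_iff]; omega)]

theorem update_natAdd_left {α β : Type*} {p q : ℕ} (f : α → β) (v : Fin (p + q) → α) (i : Fin q)
    (x : α) : (fun k => f (Function.update v (Fin.natAdd p i) x (Fin.cast rfl (Fin.castAdd q k)))) =
      fun k => f (v (Fin.cast rfl (Fin.castAdd q k))) := by
  funext k
  rw [Function.update_of_ne (by simp [Fin.ext_iff]; omega)]

theorem update_natAdd_right {α β : Type*} {p q : ℕ} (f : α → β) (v : Fin (p + q) → α) (i : Fin q)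
    (x : α) : (fun k => f (Function.update v (Fin.natAdd p i) x (Fin.cast rfl (Fin.natAdd p k)))) =
      Function.update (fun k => f (v (Fin.cast rfl (Fin.natAdd p k)))) i (f x) := by
  funext k
  rcases eq_or_ne k i with rfl | hk
  · simp
  · rw [Function.update_of_ne hk, Function.update_of_ne (by simpa using hk)]

/-- The multilinear map `v ↦ β(P₁ v₁, …, P₁ vₚ)(P₂ vₚ₊₁, …, P₂ vₙ)`. -/
def blockMultilinear {p q n : ℕ} (h : p + q = n) (β : L₁ [⋀^Fin p]→ₗ[ℝ] L₂ [⋀^Fin q]→ₗ[ℝ] N) :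
    MultilinearMap ℝ (fun _ : Fin n => L) N where
  toFun v := β (fun i => P₁ (v (Fin.cast h (Fin.castAdd q i))))
    (fun j => P₂ (v (Fin.cast h (Fin.natAdd p j))))
  map_update_add' v i x y := by
    rename_i inst
    obtain rfl : inst = instDecidableEqFin n := Subsingleton.elim _ _
    subst h
    refine Fin.addCases (fun i => ?_) (fun i => ?_) i
    · simp only [update_castAdd_left P₁, update_castAdd_right P₂, map_add, β.map_update_add,
        AlternatingMap.add_apply]
    · simp only [update_natAdd_left P₁, update_natAdd_right P₂, map_add,
        AlternatingMap.map_update_add]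
  map_update_smul' v i c x := by
    rename_i inst
    obtain rfl : inst = instDecidableEqFin n := Subsingleton.elim _ _
    subst h
    refine Fin.addCases (fun i => ?_) (fun i => ?_) i
    · simp only [update_castAdd_left P₁, update_castAdd_right P₂, map_smul, β.map_update_smul,
        AlternatingMap.smul_apply]
    · simp only [update_natAdd_left P₁, update_natAdd_right P₂, map_smul,
        AlternatingMap.map_update_smul]

theorem blockMultilinear_apply {p q n : ℕ} (h : p + q = n)
    (β : L₁ [⋀^Fin p]→ₗ[ℝ] L₂ [⋀^Fin q]→ₗ[ℝ] N) (v : Fin n → L) :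
    blockMultilinear P₁ P₂ h β v = β (fun i => P₁ (v (Fin.cast h (Fin.castAdd q i))))
    (fun j => P₂ (v (Fin.cast h (Fin.natAdd p j)))) := rfl

/-- The permutations preserving the first `p` elements. -/
def blockPerms (p n : ℕ) : Finset (Equiv.Perm (Fin n)) :=
  {τ | ∀ i, (τ i : ℕ) < p ↔ (i : ℕ) < p}

theorem blockPerms_card_ne_zero (p n : ℕ) : ((blockPerms p n).card : ℝ) ≠ 0 := by
  have : (1 : Equiv.Perm (Fin n)) ∈ blockPerms p n := by simp [blockPerms]
  exact_mod_cast (Finset.card_pos.2 ⟨_, this⟩).ne'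

/-- The alternating map with the single nonzero block `β`. -/
def blockExtend {p q n : ℕ} (h : p + q = n) (β : L₁ [⋀^Fin p]→ₗ[ℝ] L₂ [⋀^Fin q]→ₗ[ℝ] N) :
    L [⋀^Fin n]→ₗ[ℝ] N :=
  ((blockPerms p n).card : ℝ)⁻¹ • MultilinearMap.alternatization (blockMultilinear P₁ P₂ h β)

theorem blockExtend_apply {p q n : ℕ} (h : p + q = n)
    (β : L₁ [⋀^Fin p]→ₗ[ℝ] L₂ [⋀^Fin q]→ₗ[ℝ] N) (v : Fin n → L) :
    blockExtend P₁ P₂ h β v = ((blockPerms p n).card : ℝ)⁻¹ • ∑ τ : Equiv.Perm (Fin n),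
      Equiv.Perm.sign τ • β (fun i => P₁ (v (τ (Fin.cast h (Fin.castAdd q i)))))
        (fun j => P₂ (v (τ (Fin.cast h (Fin.natAdd p j))))) := by
  rw [blockExtend, AlternatingMap.smul_apply, MultilinearMap.alternatization_apply]
  rfl

variable (h₁s : ∀ y, P₁ (s y) = y) (h₁t : ∀ w, P₁ (t w) = 0) (h₂s : ∀ y, P₂ (s y) = 0)
  (h₂t : ∀ w, P₂ (t w) = w)

include h₁t h₂s in
-- Some slot of `β` receives an argument of the wrong kind: `P₁` of a vector in the image of `t`, or
-- `P₂` of a vector in the image of `s`.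
theorem blockMultilinear_perm_eq_zero {p q p' q' n : ℕ} (h : p + q = n) (h' : p' + q' = n)
    (β : L₁ [⋀^Fin p]→ₗ[ℝ] L₂ [⋀^Fin q]→ₗ[ℝ] N) (Y : Fin p' → L₁) (V : Fin q' → L₂)
    (τ : Equiv.Perm (Fin n)) (hτ : ¬ ∀ i, (τ i : ℕ) < p' ↔ (i : ℕ) < p) :
    blockMultilinear P₁ P₂ h β (fun i => (fun i => Fin.append (fun j => s (Y j)) (fun j => t (V j))
        (Fin.cast h'.symm i)) (τ i)) = 0 := by
  subst h'
  push Not at hτ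
  obtain ⟨i, hi⟩ := hτ
  rw [blockMultilinear_apply]
  rcases hi with ⟨hi, hi'⟩ | ⟨hi, hi'⟩
  · obtain ⟨j, hj⟩ : ∃ j : Fin q, Fin.cast h (Fin.natAdd p j) = i :=
      ⟨⟨i - p, by omega⟩, by apply Fin.ext; simp; omega⟩
    refine AlternatingMap.map_coord_zero _ j ?_
    obtain ⟨k, hk⟩ : ∃ k : Fin p', Fin.castAdd q' k = τ i := ⟨⟨τ i, hi⟩, by apply Fin.ext; simp⟩
    rw [hj, ← hk]
    simp [h₂s]
  · obtain ⟨j, hj⟩ : ∃ j : Fin p, Fin.cast h (Fin.castAdd q j) = i :=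
      ⟨⟨i, hi'⟩, by apply Fin.ext; simp⟩
    rw [β.map_coord_zero j, AlternatingMap.zero_apply]
    obtain ⟨k, hk⟩ : ∃ k : Fin q', Fin.natAdd p' k = τ i :=
      ⟨⟨τ i - p', by omega⟩, by apply Fin.ext; simp; omega⟩
    rw [hj, ← hk]
    simp [h₁t]

include h₁t h₂s in
theorem blockRestrict_blockExtend_of_ne {p q p' q' n : ℕ} (h : p + q = n) (h' : p' + q' = n)
    (hp : p' ≠ p) (β : L₁ [⋀^Fin p]→ₗ[ℝ] L₂ [⋀^Fin q]→ₗ[ℝ] N) :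
    blockRestrict s t h' (blockExtend P₁ P₂ h β) = 0 := by
  ext Y V
  rw [blockRestrict_apply, blockExtend_apply]
  refine (congrArg _ (Finset.sum_eq_zero fun τ _ => ?_)).trans (smul_zero _)
  have h0 := blockMultilinear_perm_eq_zero s t P₁ P₂ h₁t h₂s h h' β Y V τ ?_
  · rw [blockMultilinear_apply] at h0
    rw [h0, smul_zero]
  · intro hτ
    apply hp
    -- A permutation matching the two block shapes would force p = p' by counting, so every term of
    -- the antisymmetrization vanishes.
    have h1 : (Finset.univ.filter fun i : Fin n => (i : ℕ) < p).map τ.toEmbedding =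
        Finset.univ.filter fun i : Fin n => (i : ℕ) < p' := by
      ext i
      simp only [Finset.mem_map_equiv, Finset.mem_filter, Finset.mem_univ, true_and, ← hτ,
        Equiv.apply_symm_apply]
    have h2 := congrArg Finset.card h1
    rw [Finset.card_map, Fin.card_filter_val_lt, Fin.card_filter_val_lt] at h2
    omega

include h₁s h₂t in
-- A block-preserving permutation is a pair of permutations of the two blocks. Its sign is the
-- product of their signs, and the alternation of `β` in each block cancels it.
theorem blockMultilinear_perm {p q n : ℕ} (h : p + q = n)
    (β : L₁ [⋀^Fin p]→ₗ[ℝ] L₂ [⋀^Fin q]→ₗ[ℝ] N) (Y : Fin p → L₁) (V : Fin q → L₂)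
    (τ : Equiv.Perm (Fin n)) (hτ : ∀ i, (τ i : ℕ) < p ↔ (i : ℕ) < p) :
    Equiv.Perm.sign τ • blockMultilinear P₁ P₂ h β
      (fun i => (fun i => Fin.append (fun j => s (Y j)) (fun j => t (V j))
        (Fin.cast h.symm i)) (τ i)) = β Y V := by
  subst h
  have hmem := Equiv.Perm.mem_sumCongrHom_range_of_perm_mapsTo_inl
    (σ := finSumFinEquiv.symm.permCongr τ) (by
      rintro _ ⟨i, rfl⟩
      refine ⟨⟨τ (Fin.castAdd q i), (hτ _).2 (by simp)⟩, ?_⟩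
      rw [Equiv.permCongr_apply, Equiv.symm_symm, Equiv.eq_symm_apply]
      apply Fin.ext
      simp)
  obtain ⟨⟨σ₁, σ₂⟩, hσ⟩ := hmem
  have hs : Equiv.Perm.sign τ = Equiv.Perm.sign σ₁ * Equiv.Perm.sign σ₂ := by
    rw [← Equiv.Perm.sign_sumCongr, ← Equiv.Perm.sign_permCongr finSumFinEquiv.symm τ, ← hσ]
    rfl
  have hl : ∀ i, τ (Fin.castAdd q i) = Fin.castAdd q (σ₁ i) := by
    intro i
    have := DFunLike.congr_fun hσ (Sum.inl i)
    rw [Equiv.permCongr_apply, Equiv.symm_symm, Equiv.eq_symm_apply] at this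
    simpa using this.symm
  have hr : ∀ i, τ (Fin.natAdd p i) = Fin.natAdd p (σ₂ i) := by
    intro i
    have := DFunLike.congr_fun hσ (Sum.inr i)
    rw [Equiv.permCongr_apply, Equiv.symm_symm, Equiv.eq_symm_apply] at this
    simpa using this.symm
  rw [blockMultilinear_apply]
  simp only [Fin.cast_refl, id, hl, hr, Fin.append_left, Fin.append_right, h₁s, h₂t]
  have h1 := β.map_perm Y σ₁
  have h2 := (β Y).map_perm V σ₂
  change Equiv.Perm.sign τ • β (Y ∘ σ₁) (V ∘ σ₂) = _
  rw [h1, AlternatingMap.smul_apply, h2, hs, smul_smul, smul_smul]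
  rcases Int.units_eq_one_or (Equiv.Perm.sign σ₁) with e1 | e1 <;>
  rcases Int.units_eq_one_or (Equiv.Perm.sign σ₂) with e2 | e2 <;> simp [e1, e2]

include h₁s h₁t h₂s h₂t in
-- In the antisymmetrization only block-preserving permutations survive, and each contributes `β`;
-- this is why `blockExtend` divides by their number.
theorem blockRestrict_blockExtend {p q n : ℕ} (h : p + q = n)
    (β : L₁ [⋀^Fin p]→ₗ[ℝ] L₂ [⋀^Fin q]→ₗ[ℝ] N) :
    blockRestrict s t h (blockExtend P₁ P₂ h β) = β := by
  ext Y V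
  rw [blockRestrict_apply, blockExtend_apply, inv_smul_eq_iff₀ (blockPerms_card_ne_zero p n),
    ← Finset.sum_subset (Finset.subset_univ (blockPerms p n)), Finset.sum_congr rfl
      (g := fun _ => β Y V), Finset.sum_const, Nat.cast_smul_eq_nsmul]
  · intro τ hτ
    exact blockMultilinear_perm s t P₁ P₂ h₁s h₂t h β Y V τ (by simpa [blockPerms] using hτ)
  · intro τ _ hτ
    have h0 := blockMultilinear_perm_eq_zero s t P₁ P₂ h₁t h₂s h h β Y V τ
      (by simpa [blockPerms] using hτ)
    rw [blockMultilinear_apply] at h0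
    rw [h0, smul_zero]

end BlockIsomorphism

/-! ### Pages of the spectral sequence of a filtered complex -/

section SpectralSequence

universe u

/-- The factorization of a linear map through a surjective linear map. -/
def liftOfSurjective {A B D : Type*} [AddCommGroup A] [Module ℝ A] [AddCommGroup B] [Module ℝ B]
    [AddCommGroup D] [Module ℝ D] (g : A →ₗ[ℝ] B) (hg : Function.Surjective g) (f : A →ₗ[ℝ] D)
    (h : ∀ a, g a = 0 → f a = 0) : B →ₗ[ℝ] D :=
  (LinearMap.ker g).liftQ f (fun a ha => h a ha) ∘ₗ
    (g.quotKerEquivOfSurjective hg).symm.toLinearMap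

theorem liftOfSurjective_apply {A B D : Type*} [AddCommGroup A] [Module ℝ A] [AddCommGroup B]
    [Module ℝ B] [AddCommGroup D] [Module ℝ D] (g : A →ₗ[ℝ] B) (hg : Function.Surjective g)
    (f : A →ₗ[ℝ] D) (h : ∀ a, g a = 0 → f a = 0) (a : A) :
    liftOfSurjective g hg f h (g a) = f a := by
  have : (g.quotKerEquivOfSurjective hg).symm (g a) = Submodule.Quotient.mk a := by
    rw [LinearEquiv.symm_apply_eq]
    rfl
  rw [liftOfSurjective, LinearMap.comp_apply, LinearEquiv.coe_coe, this]
  rfl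

/-- Two surjections with the same kernel have isomorphic targets. -/
def equivOfSurjective {A B D : Type*} [AddCommGroup A] [Module ℝ A] [AddCommGroup B] [Module ℝ B]
    [AddCommGroup D] [Module ℝ D] (g : A →ₗ[ℝ] B) (hg : Function.Surjective g) (f : A →ₗ[ℝ] D)
    (hf : Function.Surjective f) (h : ∀ a, g a = 0 ↔ f a = 0) : B ≃ₗ[ℝ] D :=
  LinearEquiv.ofLinearMap (liftOfSurjective g hg f fun a => (h a).1)
    (liftOfSurjective f hf g fun a => (h a).2)
    (LinearMap.ext fun x => by
      obtain ⟨a, rfl⟩ := hf x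
      rw [LinearMap.comp_apply, liftOfSurjective_apply, liftOfSurjective_apply]
      rfl)
    (LinearMap.ext fun x => by
      obtain ⟨a, rfl⟩ := hg x
      rw [LinearMap.comp_apply, liftOfSurjective_apply, liftOfSurjective_apply]
      rfl)

theorem equivOfSurjective_apply {A B D : Type*} [AddCommGroup A] [Module ℝ A] [AddCommGroup B]
    [Module ℝ B] [AddCommGroup D] [Module ℝ D] (g : A →ₗ[ℝ] B) (hg : Function.Surjective g)
    (f : A →ₗ[ℝ] D) (hf : Function.Surjective f) (h : ∀ a, g a = 0 ↔ f a = 0) (a : A) :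
    equivOfSurjective g hg f hf h (g a) = f a :=
  liftOfSurjective_apply g hg f _ a

variable {C : ℕ → Type u} [∀ n, AddCommGroup (C n)] [∀ n, Module ℝ (C n)]
  (d : ∀ n, C n →ₗ[ℝ] C (n + 1)) (Fil : ℤ → ∀ n, Submodule ℝ (C n))

/-- A complex with a decreasing filtration, with `F^p Cⁿ = Cⁿ` for `p ≤ 0` and `F^p Cⁿ = 0` for
`p > n`. -/
structure IsFirstQuadrant : Prop where
  d_d : ∀ n a, d (n + 1) (d n a) = 0
  anti : ∀ p n, Fil (p + 1) n ≤ Fil p n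
  d_mem : ∀ p n a, a ∈ Fil p n → d n a ∈ Fil p (n + 1)
  top : ∀ p n, p ≤ 0 → Fil p n = ⊤
  bot : ∀ (p : ℤ) (n : ℕ), n < p → Fil p n = ⊥

variable {d Fil}

theorem mem_approxCocycles {r p : ℤ} {n : ℕ} {a : C n} :
    a ∈ approxCocycles d Fil r p n ↔ a ∈ Fil p n ∧ d n a ∈ Fil (p + r) (n + 1) := Iff.rfl

theorem mem_approxCoboundaries {r p : ℤ} {n : ℕ} {a : C (n + 1)} :
    a ∈ approxCoboundaries d Fil r p (n + 1) ↔
      ∃ w ∈ approxCocycles d Fil (r - 1) (p - r + 1) n, d n w = a := Iff.rfl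

namespace IsFirstQuadrant

variable (hC : IsFirstQuadrant d Fil)
include hC

theorem mono {p p' : ℤ} (h : p ≤ p') (n : ℕ) : Fil p' n ≤ Fil p n := by
  obtain ⟨k, rfl⟩ := Int.le.dest h
  induction k with
  | zero => simp
  | succ k ih =>
    refine le_trans ?_ (ih (by lia))
    have := hC.anti (p + k) n
    push_cast
    rwa [← add_assoc]

theorem approxCocycles_le {r p r' p' : ℤ} (h : p' ≤ p) (h' : p' + r' ≤ p + r) (n : ℕ) :
    approxCocycles d Fil r p n ≤ approxCocycles d Fil r' p' n :=
  fun _ ha => ⟨hC.mono h n ha.1, hC.mono h' (n + 1) ha.2⟩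

theorem d_approxCoboundaries {r p : ℤ} {n : ℕ} {a : C n}
    (ha : a ∈ approxCoboundaries d Fil r p n) : d n a = 0 := by
  cases n with
  | zero =>
    have : a = 0 := ha
    rw [this, map_zero]
  | succ n =>
    obtain ⟨w, -, rfl⟩ := ha
    exact hC.d_d n w

theorem approxCoboundaries_le_succ (r p : ℤ) (n : ℕ) :
    approxCoboundaries d Fil r p n ≤ approxCoboundaries d Fil (r + 1) p n := by
  cases n with
  | zero => exact le_rfl
  | succ n => exact Submodule.map_mono (hC.approxCocycles_le (by lia) (by lia) n)

/-- For p < r the index p - r + 1 is at most 0, so the filtration no longer restricts the primitives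
and the approximate coboundaries have stopped growing. -/
theorem approxCoboundaries_succ_le {r p : ℤ} (h : p < r) (n : ℕ) :
    approxCoboundaries d Fil (r + 1) p n ≤ approxCoboundaries d Fil r p n := by
  cases n with
  | zero => exact le_rfl
  | succ n =>
    refine Submodule.map_mono fun a ha => ⟨?_, ?_⟩
    · rw [hC.top _ _ (by lia)]
      trivial
    · have := ha.2
      have e : p - (r + 1) + 1 + (r + 1 - 1) = p - r + 1 + (r - 1) := by ring
      rwa [e] at this

theorem d_mem_approxCocycles {r p p' r' : ℤ} {n : ℕ} {a : C n}
    (ha : a ∈ approxCocycles d Fil r p n) (h : p + r = p') :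
    d n a ∈ approxCocycles d Fil r' p' (n + 1) :=
  mem_approxCocycles.2 ⟨h ▸ ha.2, by rw [hC.d_d]; exact Submodule.zero_mem _⟩

/-- The kernel of the map from `Z_(r+1)` to the homology of the `r`-th page. -/
theorem mem_boundary_succ_iff {r p : ℤ} {n : ℕ} {a : C n}
    (ha : a ∈ approxCocycles d Fil (r + 1) p n) :
    a ∈ approxCocycles d Fil (r + 1 - 1) (p + 1) n ⊔ approxCoboundaries d Fil (r + 1) p n ↔
      ∃ c ∈ approxCoboundaries d Fil (r + 1) p n,
        a - c ∈ approxCocycles d Fil (r - 1) (p + 1) n ⊔ approxCoboundaries d Fil r p n := by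
  constructor
  · intro h
    obtain ⟨z, hz, c, hc, rfl⟩ := Submodule.mem_sup.1 h
    refine ⟨c, hc, Submodule.mem_sup_left ?_⟩
    rw [add_sub_cancel_right]
    exact hC.approxCocycles_le (by lia) (by lia) n hz
  · rintro ⟨c, hc, h⟩
    obtain ⟨z, hz, c', hc', hzc⟩ := Submodule.mem_sup.1 h
    have hc'' := hC.approxCoboundaries_le_succ r p n hc'
    refine Submodule.mem_sup.2 ⟨z, mem_approxCocycles.2 ⟨hz.1, ?_⟩, c + c',
      Submodule.add_mem _ hc hc'', ?_⟩
    -- Since `c` and `c'` are closed, d z = d a lies in F^(p+r+1). So `z`, known only to be in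
    -- Z_(r-1)^(p+1), is in fact in Z_r^(p+1).
    · have e : z = a - c - c' := by rw [← hzc]; abel
      rw [e, map_sub, map_sub, hC.d_approxCoboundaries hc, hC.d_approxCoboundaries hc'',
        sub_zero, sub_zero]
      have e : p + 1 + (r + 1 - 1) = p + (r + 1) := by ring
      rw [e]
      exact ha.2
    · rw [add_left_comm, hzc]
      abel

end IsFirstQuadrant

variable (d Fil)

/-- A page of the spectral sequence of a filtered complex. -/
structure FiltrationPage (r : ℤ) where
  K : HomologicalComplex (ModuleCat.{u} ℝ) (ComplexShape.spectralSequenceNat (r, 1 - r))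
  proj : ∀ {p q n : ℕ}, p + q = n → (approxCocycles d Fil r p n →ₗ[ℝ] K.X (p, q))
  proj_surjective : ∀ {p q n : ℕ} (h : p + q = n), Function.Surjective (proj h)
  proj_eq_zero_iff : ∀ {p q n : ℕ} (h : p + q = n) (a : approxCocycles d Fil r p n),
    proj h a = 0 ↔
      (a : C n) ∈ approxCocycles d Fil (r - 1) (p + 1) n ⊔ approxCoboundaries d Fil r p n
  d_proj : ∀ {p q p' q' n : ℕ} (h : p + q = n) (h' : p' + q' = n + 1)
    (_ : (p : ℤ) + r = p') (a : approxCocycles d Fil r p n)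
    (b : approxCocycles d Fil r p' (n + 1)), (b : C (n + 1)) = d n a →
      (K.d (p, q) (p', q')).hom (proj h a) = proj h' b

variable {d Fil}

/-- The pages of a spectral sequence of a filtered complex. -/
def FiltrationSpectralSequence.toPage (S : FiltrationSpectralSequence d Fil) (r : ℤ) (hr : 2 ≤ r) :
    FiltrationPage d Fil r where
  K := S.E.page r hr
  proj := S.proj r hr
  proj_surjective := S.proj_surjective r hr
  proj_eq_zero_iff := S.proj_eq_zero_iff r hr
  d_proj := S.d_proj r hr

namespace FiltrationPage

variable {r : ℤ} (P : FiltrationPage d Fil r) (hC : IsFirstQuadrant d Fil)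
include hC

/-- For `a` in Z_(r+1)^p the element d a is closed and lies one step deeper than the target
Z_r^(p+r) asks, hence in the part Z_(r-1)^(p+r+1) of the denominator. -/
theorem proj_d_eq_zero {p q n : ℕ} (h : p + q = n) (a : approxCocycles d Fil r p n)
    (ha : (a : C n) ∈ approxCocycles d Fil (r + 1) p n) (j : ℕ × ℕ) :
    (P.K.d (p, q) j).hom (P.proj h a) = 0 := by
  by_cases hj : (ComplexShape.spectralSequenceNat (r, 1 - r)).Rel (p, q) j
  · obtain ⟨p', q'⟩ := j
    obtain ⟨h1, h2⟩ := hj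
    dsimp at h1 h2
    rw [P.d_proj h (by lia : p' + q' = n + 1) h1 a
      ⟨d n a, hC.d_mem_approxCocycles a.2 h1⟩ rfl, P.proj_eq_zero_iff]
    refine Submodule.mem_sup_left (mem_approxCocycles.2 ⟨?_, ?_⟩)
    · have := (mem_approxCocycles.1 ha).2
      have e : (p : ℤ) + (r + 1) = p' + 1 := by lia
      rwa [e] at this
    · rw [hC.d_d]
      exact Submodule.zero_mem _
  · rw [P.K.shape _ _ hj]
    rfl

/-- The closed elements of a page come from the approximate cocycles of the next page. -/
theorem exists_proj_eq {p q n : ℕ} (h : p + q = n) (x : P.K.X (p, q))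
    (hx : ∀ j, (P.K.d (p, q) j).hom x = 0) :
    ∃ (a : approxCocycles d Fil r p n), (a : C n) ∈ approxCocycles d Fil (r + 1) p n ∧
      P.proj h a = x := by
  obtain ⟨a, rfl⟩ := P.proj_surjective h x
  -- Here the differential would end below the quadrant: p + r > n + 1, so F^(p+r) is zero in degree
  -- n + 1 and `a` is closed.
  by_cases hq : (q : ℤ) + 1 < r
  · refine ⟨a, mem_approxCocycles.2 ⟨a.2.1, ?_⟩, rfl⟩
    have := (mem_approxCocycles.1 a.2).2
    rw [hC.bot _ _ (by lia), Submodule.mem_bot] at this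
    rw [this]
    exact Submodule.zero_mem _
  · obtain ⟨q', hq'⟩ : ∃ q' : ℕ, (q : ℤ) + (1 - r) = q' := ⟨(q + (1 - r)).toNat, by lia⟩
    by_cases hp : 0 ≤ (p : ℤ) + r
    · obtain ⟨p', hp'⟩ : ∃ p' : ℕ, (p : ℤ) + r = p' := ⟨(p + r).toNat, by lia⟩
      have h0 := hx (p', q')
      rw [P.d_proj h (by lia : p' + q' = n + 1) hp' a
        ⟨d n a, hC.d_mem_approxCocycles a.2 hp'⟩ rfl, P.proj_eq_zero_iff] at h0
      -- The vanishing of the class of d a means d a = z + d w with z in F^(p+r+1) and w in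
      -- Z_(r-1)^(p+1). Replacing `a` by a - w keeps the class and moves the differential into
      -- F^(p+r+1).
      obtain ⟨z, hz, c, hc, hzc⟩ := Submodule.mem_sup.1 h0
      obtain ⟨w, hw, rfl⟩ := hc
      have e : (p' : ℤ) - r + 1 = p + 1 := by lia
      rw [e] at hw
      have hw1 := hC.approxCocycles_le (r' := r) (p' := p) (by lia) (by lia) n hw
      have hdz : d n (a - w) = z := by
        rw [map_sub]
        exact sub_eq_of_eq_add hzc.symm
      refine ⟨a - ⟨w, hw1⟩, mem_approxCocycles.2 ⟨Submodule.sub_mem _ a.2.1 hw1.1, ?_⟩, ?_⟩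
      · have e : (p : ℤ) + (r + 1) = p' + 1 := by lia
        rw [e]
        exact hdz ▸ hz.1
      · rw [map_sub, sub_eq_self, P.proj_eq_zero_iff]
        exact Submodule.mem_sup_left hw
    -- As `r` is an arbitrary integer here, p + r may be negative; then F^(p+r+1) is the whole
    -- space.
    · refine ⟨a, mem_approxCocycles.2 ⟨a.2.1, ?_⟩, rfl⟩
      rw [hC.top _ _ (by lia)]
      trivial

/-- An element of the next approximate cocycles defines a boundary of the page exactly when it
defines the zero element of the next page. -/
theorem proj_mem_boundary_iff {p q n : ℕ} (h : p + q = n) (a : approxCocycles d Fil r p n)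
    (ha : (a : C n) ∈ approxCocycles d Fil (r + 1) p n) (hr : 1 ≤ r) (i : ℕ × ℕ)
    (hi : (ComplexShape.spectralSequenceNat (r, 1 - r)).prev (p, q) = i) :
    (∃ y : P.K.X i, (P.K.d i (p, q)).hom y = P.proj h a) ↔
      (a : C n) ∈ approxCocycles d Fil (r + 1 - 1) (p + 1) n ⊔
        approxCoboundaries d Fil (r + 1) p n := by
  rw [hC.mem_boundary_succ_iff ha]
  by_cases hrel : (ComplexShape.spectralSequenceNat (r, 1 - r)).Rel i (p, q)
  · obtain ⟨p', q'⟩ := i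
    obtain ⟨h1, h2⟩ := hrel
    dsimp at h1 h2
    obtain ⟨m, rfl⟩ : ∃ m, n = m + 1 := ⟨p' + q', by lia⟩
    have hm : p' + q' = m := by lia
    -- The approximate coboundaries for r + 1 are d Z_r^(p-r), and p - r = p'. Their primitives are
    -- therefore exactly the lifts of the source of the incoming differential.
    have e : (p : ℤ) - (r + 1) + 1 = p' := by lia
    have e' : r + 1 - 1 = r := by lia
    have key : ∀ w : approxCocycles d Fil r p' m,
        (P.K.d (p', q') (p, q)).hom (P.proj hm w) = P.proj h a ↔
          (a : C (m + 1)) - d m w ∈ approxCocycles d Fil (r - 1) (p + 1) (m + 1) ⊔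
            approxCoboundaries d Fil r p (m + 1) := by
      intro w
      rw [P.d_proj hm h h1 w ⟨d m w, hC.d_mem_approxCocycles w.2 h1⟩ rfl, eq_comm, ← sub_eq_zero,
        ← map_sub, P.proj_eq_zero_iff]
      rfl
    constructor
    · rintro ⟨y, hy⟩
      obtain ⟨w, rfl⟩ := P.proj_surjective hm y
      refine ⟨d m w, ⟨w, ?_, rfl⟩, (key w).1 hy⟩
      rw [e, e']
      exact w.2
    · rintro ⟨_, ⟨w, hw, rfl⟩, hc⟩
      rw [e, e'] at hw
      exact ⟨P.proj hm ⟨w, hw⟩, (key ⟨w, hw⟩).2 hc⟩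
  -- No differential arrives at (p, q), since for r ≤ p the point (p - r, q + r - 1) would be a
  -- source in the quadrant. With p < r the approximate coboundaries for r and r + 1 agree.
  · have hp : (p : ℤ) < r := by
      by_contra hp
      have hrel' : (ComplexShape.spectralSequenceNat (r, 1 - r)).Rel
          (((p : ℤ) - r).toNat, ((q : ℤ) + r - 1).toNat) (p, q) := by
        constructor <;> dsimp <;> lia
      rw [ComplexShape.prev_eq' _ hrel'] at hi
      exact hrel (hi ▸ hrel')
    rw [P.K.shape _ _ hrel]
    constructor
    · rintro ⟨y, hy⟩
      refine ⟨0, Submodule.zero_mem _, ?_⟩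
      rw [sub_zero, ← P.proj_eq_zero_iff h, ← hy]
      rfl
    · rintro ⟨c, hc, hac⟩
      refine ⟨0, ?_⟩
      rw [map_zero, eq_comm, P.proj_eq_zero_iff]
      have := Submodule.add_mem _ hac
        (Submodule.mem_sup_right (hC.approxCoboundaries_succ_le hp n hc))
      rwa [sub_add_cancel] at this

/-- The map from the approximate cocycles of the next page to the cycles of a page. -/
def toCycles {p q n : ℕ} (h : p + q = n) :
    ModuleCat.of ℝ (approxCocycles d Fil (r + 1) p n) ⟶ P.K.cycles (p, q) :=
  P.K.liftCycles (ModuleCat.ofHom (P.proj h ∘ₗ Submodule.inclusion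
    (hC.approxCocycles_le (r := r + 1) (r' := r) le_rfl (by lia) n))) _ rfl (by
      ext a
      exact P.proj_d_eq_zero hC h _ a.2 _)

theorem iCycles_toCycles {p q n : ℕ} (h : p + q = n) (a : approxCocycles d Fil r p n)
    (a' : approxCocycles d Fil (r + 1) p n) (haa' : (a' : C n) = a) :
    (P.K.iCycles (p, q)).hom ((P.toCycles hC h).hom a') = P.proj h a := by
  have := P.K.liftCycles_i (ModuleCat.ofHom (P.proj h ∘ₗ Submodule.inclusion
    (hC.approxCocycles_le (r := r + 1) (r' := r) le_rfl (by lia) n))) _ rfl (by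
      ext a
      exact P.proj_d_eq_zero hC h _ a.2 _)
  refine (CategoryTheory.ConcreteCategory.congr_hom this a').trans ?_
  change P.proj h _ = _
  congr 1
  exact Subtype.ext haa'

omit hC in
theorem iCycles_injective (i : ℕ × ℕ) : Function.Injective (P.K.iCycles i).hom :=
  (ModuleCat.mono_iff_injective _).1 inferInstance

theorem toCycles_surjective {p q n : ℕ} (h : p + q = n) :
    Function.Surjective (P.toCycles hC h).hom := by
  intro z
  obtain ⟨a, ha, haz⟩ := P.exists_proj_eq hC h ((P.K.iCycles (p, q)).hom z) fun j =>
    CategoryTheory.ConcreteCategory.congr_hom (P.K.iCycles_d (p, q) j) z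
  refine ⟨⟨a, ha⟩, P.iCycles_injective _ ?_⟩
  rw [P.iCycles_toCycles hC h a _ rfl, haz]

omit hC in
-- Homology is the cokernel of the map from the preceding term to the cycles, and the cycles embed
-- into the page.
theorem homologyπ_eq_zero_iff (i : ℕ × ℕ) (z : P.K.cycles i) :
    (P.K.homologyπ i).hom z = 0 ↔
      ∃ y, (P.K.d ((ComplexShape.spectralSequenceNat (r, 1 - r)).prev i) i).hom y =
        (P.K.iCycles i).hom z := by
  have hex : (CategoryTheory.ShortComplex.mk _ _ (P.K.toCycles_comp_homologyπ
      ((ComplexShape.spectralSequenceNat (r, 1 - r)).prev i) i)).Exact :=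
    CategoryTheory.ShortComplex.exact_of_g_is_cokernel _
      (P.K.homologyIsCokernel _ i rfl)
  rw [CategoryTheory.ShortComplex.moduleCat_exact_iff] at hex
  have hi : ∀ y, (P.K.iCycles i).hom ((P.K.toCycles
      ((ComplexShape.spectralSequenceNat (r, 1 - r)).prev i) i).hom y) =
      (P.K.d ((ComplexShape.spectralSequenceNat (r, 1 - r)).prev i) i).hom y := fun y =>
    CategoryTheory.ConcreteCategory.congr_hom (P.K.toCycles_i _ i) y
  constructor
  · intro hz
    obtain ⟨y, hy⟩ := hex z hz
    refine ⟨y, ?_⟩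
    rw [← hi]
    exact congrArg _ hy
  · rintro ⟨y, hy⟩
    rw [← hi] at hy
    rw [← P.iCycles_injective _ hy]
    exact CategoryTheory.ConcreteCategory.congr_hom (P.K.toCycles_comp_homologyπ _ i) y

/-- The homology of a page is the next page. -/
def homologyEquiv (P' : FiltrationPage d Fil (r + 1)) (hr : 1 ≤ r) (p q : ℕ) :
    P.K.homology (p, q) ≃ₗ[ℝ] P'.K.X (p, q) :=
  -- Both modules are quotients of Z_(r+1)^p, the homology by way of the cycles and the next page by
  -- its own projection; `proj_mem_boundary_iff` says that the kernels agree.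
  equivOfSurjective ((P.K.homologyπ (p, q)).hom ∘ₗ (P.toCycles hC rfl).hom)
    (((ModuleCat.epi_iff_surjective (P.K.homologyπ (p, q))).1 inferInstance).comp
      (P.toCycles_surjective hC rfl))
    (P'.proj rfl) (P'.proj_surjective rfl) (fun a => by
      rw [P'.proj_eq_zero_iff, LinearMap.comp_apply, P.homologyπ_eq_zero_iff,
        P.iCycles_toCycles hC rfl ⟨a, hC.approxCocycles_le (r := r + 1) le_rfl (by lia) _ a.2⟩ a rfl,
        P.proj_mem_boundary_iff hC rfl _ a.2 hr _ rfl])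

theorem homologyEquiv_apply (P' : FiltrationPage d Fil (r + 1)) (hr : 1 ≤ r) {p q n : ℕ}
    (h : p + q = n) (z : P.K.cycles (p, q)) (a : approxCocycles d Fil r p n)
    (a' : approxCocycles d Fil (r + 1) p n) (haa' : (a' : C n) = a)
    (hz : (P.K.iCycles (p, q)).hom z = P.proj h a) :
    P.homologyEquiv hC P' hr p q ((P.K.homologyπ (p, q)).hom z) = P'.proj h a' := by
  subst h
  rw [← P.iCycles_toCycles hC rfl a a' haa'] at hz
  rw [P.iCycles_injective _ hz]
  exact equivOfSurjective_apply _ _ _ _ _ a'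

end FiltrationPage

end SpectralSequence

/-! ### Construction and convergence of the spectral sequence -/

section SpectralSequenceConstruction

universe u

variable {C : ℕ → Type u} [∀ n, AddCommGroup (C n)] [∀ n, Module ℝ (C n)]
  (d : ∀ n, C n →ₗ[ℝ] C (n + 1)) (Fil : ℤ → ∀ n, Submodule ℝ (C n))

/-- The quotient `Z_r^p / (Z_(r-1)^(p+1) + d Z_(r-1)^(p-r+1))` in degree `n`. -/
abbrev pageTerm (r p : ℤ) (n : ℕ) : Type u :=
  approxCocycles d Fil r p n ⧸ (approxCocycles d Fil (r - 1) (p + 1) n ⊔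
    approxCoboundaries d Fil r p n).submoduleOf (approxCocycles d Fil r p n)

/-- The projection to the terms of a page. -/
def pageProj (r p : ℤ) {m n : ℕ} (h : m = n) :
    approxCocycles d Fil r p n →ₗ[ℝ] pageTerm d Fil r p m := by
  subst h
  exact Submodule.mkQ _

theorem pageProj_surjective (r p : ℤ) {m n : ℕ} (h : m = n) :
    Function.Surjective (pageProj d Fil r p h) := by
  subst h
  exact Submodule.mkQ_surjective _

theorem pageProj_eq_zero_iff (r p : ℤ) {m n : ℕ} (h : m = n) (a : approxCocycles d Fil r p n) :
    pageProj d Fil r p h a = 0 ↔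
      (a : C n) ∈ approxCocycles d Fil (r - 1) (p + 1) n ⊔ approxCoboundaries d Fil r p n := by
  subst h
  exact Submodule.Quotient.mk_eq_zero _

variable {d Fil} (hC : IsFirstQuadrant d Fil)
include hC

/-- The map induced by `d` on approximate cocycles. -/
def approxD (r p : ℤ) {p' : ℤ} (hp : p + r = p') (n : ℕ) :
    approxCocycles d Fil r p n →ₗ[ℝ] approxCocycles d Fil r p' (n + 1) :=
  ((d n) ∘ₗ (approxCocycles d Fil r p n).subtype).codRestrict _
    fun a => hC.d_mem_approxCocycles a.2 hp

/-- The differential on the terms of a page. -/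
def pageD (r p : ℤ) {p' : ℤ} (hp : p + r = p') {m m' : ℕ} (hm : m + 1 = m') :
    pageTerm d Fil r p m →ₗ[ℝ] pageTerm d Fil r p' m' :=
  Submodule.liftQ _ (pageProj d Fil r p' hm.symm ∘ₗ approxD hC r p hp m) (by
    -- If a = z + c with z in Z_(r-1)^(p+1) and c an approximate coboundary, then d a = d z. This
    -- belongs to d Z_(r-1)^(p'-r+1), a part of the denominator at p', because p' - r + 1 = p + 1.
    intro a ha
    rw [LinearMap.mem_ker, LinearMap.comp_apply, pageProj_eq_zero_iff]
    obtain ⟨z, hz, c, hc, hzc⟩ := Submodule.mem_sup.1 (show (a : C m) ∈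
      approxCocycles d Fil (r - 1) (p + 1) m ⊔ approxCoboundaries d Fil r p m from ha)
    refine Submodule.mem_sup_right ⟨z, ?_, ?_⟩
    · have e : p' - r + 1 = p + 1 := by lia
      rw [e]
      exact hz
    · change d m z = d m a
      rw [← hzc, map_add, hC.d_approxCoboundaries hc, add_zero])

theorem pageD_pageProj (r p : ℤ) {p' : ℤ} (hp : p + r = p') {m m' n : ℕ} (hm : m + 1 = m')
    (h : m = n) (h' : m' = n + 1) (a : approxCocycles d Fil r p n)
    (b : approxCocycles d Fil r p' (n + 1)) (hab : (b : C (n + 1)) = d n a) :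
    pageD hC r p hp hm (pageProj d Fil r p h a) = pageProj d Fil r p' h' b := by
  subst h
  subst hm
  obtain rfl : b = approxD hC r p hp m a := Subtype.ext hab
  rfl

omit hC in
theorem add_eq_of_rel {r : ℤ} {i j : ℕ × ℕ}
    (h : (ComplexShape.spectralSequenceNat (r, 1 - r)).Rel i j) : i.1 + i.2 + 1 = j.1 + j.2 := by
  obtain ⟨h1, h2⟩ := h
  dsimp at h1 h2
  lia

theorem pageD_pageD {r : ℤ} {i j k : ℕ × ℕ}
    (hij : (ComplexShape.spectralSequenceNat (r, 1 - r)).Rel i j)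
    (hjk : (ComplexShape.spectralSequenceNat (r, 1 - r)).Rel j k)
    (x : pageTerm d Fil r i.1 (i.1 + i.2)) :
    pageD hC r j.1 hjk.1 (add_eq_of_rel hjk) (pageD hC r i.1 hij.1 (add_eq_of_rel hij) x) = 0 := by
  obtain ⟨a, rfl⟩ := pageProj_surjective d Fil r i.1 rfl x
  have hj := add_eq_of_rel hij
  have hk := add_eq_of_rel hjk
  rw [pageD_pageProj hC r _ hij.1 hj rfl hj.symm a (approxD hC r _ hij.1 _ a) rfl,
    pageD_pageProj hC r _ hjk.1 hk hj.symm (by lia) _ 0 (hC.d_d _ _).symm, map_zero]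

open Classical in
/-- The complexes underlying the pages of the spectral sequence of a filtered complex. -/
def pageComplex (r : ℤ) :
    HomologicalComplex (ModuleCat.{u} ℝ) (ComplexShape.spectralSequenceNat (r, 1 - r)) where
  X pq := ModuleCat.of ℝ (pageTerm d Fil r pq.1 (pq.1 + pq.2))
  d i j := if h : (ComplexShape.spectralSequenceNat (r, 1 - r)).Rel i j then
    ModuleCat.ofHom (pageD hC r i.1 h.1 (add_eq_of_rel h)) else 0
  shape i j h := dif_neg h
  d_comp_d' i j k hij hjk := by
    rw [dif_pos hij, dif_pos hjk]
    exact ModuleCat.hom_ext (LinearMap.ext fun x => pageD_pageD hC hij hjk x)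

theorem pageComplex_d {r : ℤ} {i j : ℕ × ℕ}
    (h : (ComplexShape.spectralSequenceNat (r, 1 - r)).Rel i j) :
    (pageComplex hC r).d i j = ModuleCat.ofHom (pageD hC r i.1 h.1 (add_eq_of_rel h)) :=
  dif_pos h

/-- The pages of the spectral sequence of a filtered complex. -/
def filtrationPage (r : ℤ) : FiltrationPage d Fil r where
  K := pageComplex hC r
  proj {p _ _} h := pageProj d Fil r p h
  proj_surjective {p _ _} h := pageProj_surjective d Fil r p h
  proj_eq_zero_iff {p _ _} h := pageProj_eq_zero_iff d Fil r p h
  d_proj {p q p' q' n} h h' hp a b hab := by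
    have hrel : (ComplexShape.spectralSequenceNat (r, 1 - r)).Rel (p, q) (p', q') := by
      constructor <;> dsimp <;> lia
    rw [pageComplex_d hC hrel]
    exact pageD_pageProj hC r p hp (add_eq_of_rel hrel) h h' a b hab

/-- The spectral sequence of a filtered complex. -/
def filtrationSpectralSequence : FiltrationSpectralSequence d Fil where
  E :=
    { page := fun r _ => (filtrationPage hC r).K
      iso := fun r r' pq hrr' hr => by
        subst hrr'
        exact ((filtrationPage hC r).homologyEquiv hC (filtrationPage hC (r + 1))
          (by lia) pq.1 pq.2).toModuleIso }
  proj r _ _ _ _ h := (filtrationPage hC r).proj h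
  proj_surjective r _ _ _ _ h := (filtrationPage hC r).proj_surjective h
  proj_eq_zero_iff r _ _ _ _ h := (filtrationPage hC r).proj_eq_zero_iff h
  d_proj r _ _ _ _ _ _ h h' := (filtrationPage hC r).d_proj h h'
  iso_proj r hr _ _ _ h z a a' haa' hz :=
    (filtrationPage hC r).homologyEquiv_apply hC (filtrationPage hC (r + 1)) (by lia) h z a a' haa' hz

omit hC in
theorem cohClass_eq_zero_iff {n : ℕ} (a : C n) (ha : d n a = 0) :
    cohClass d a ha = 0 ↔ a ∈ coboundaries d n :=
  Submodule.Quotient.mk_eq_zero _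

omit hC in
theorem cohClass_surjective {n : ℕ} (x : Cohomology d n) :
    ∃ a ha, cohClass d (n := n) a ha = x := by
  obtain ⟨⟨a, ha⟩, rfl⟩ := Submodule.mkQ_surjective _ x
  exact ⟨a, ha, rfl⟩

omit hC in
theorem cohClass_eq_iff {n : ℕ} (a a' : C n) (ha : d n a = 0) (ha' : d n a' = 0) :
    cohClass d a ha = cohClass d a' ha' ↔ a - a' ∈ coboundaries d n :=
  Submodule.Quotient.eq _

omit hC in
theorem mem_filCohomology {p : ℤ} {n : ℕ} {x : Cohomology d n} :
    x ∈ filCohomology d Fil p n ↔ ∃ a ∈ Fil p n, ∃ ha : d n a = 0, cohClass d a ha = x := by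
  constructor
  · rintro ⟨⟨a, ha⟩, ha', rfl⟩
    exact ⟨a, ha', ha, rfl⟩
  · rintro ⟨a, ha', ha, rfl⟩
    exact ⟨⟨a, ha⟩, ha', rfl⟩

/-- The condition r > q + 1 gives p + r > n + 1, so F^(p+r) is zero in degree n + 1 and all of Z_r^p
is closed. The condition r > p makes F^(p-r+1) the whole space, so every coboundary lying in F^p is
an approximate one. Hence an element of Z_r^p dies in E_r exactly when it is cohomologous to a
closed element of F^(p+1). -/
theorem FiltrationSpectralSequence.converges (S : FiltrationSpectralSequence d Fil) :
    S.Converges := by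
  refine ⟨fun n => ?_, fun n p => ?_, fun n => ?_, ?_⟩
  · refine top_unique fun x _ => ?_
    obtain ⟨a, ha, rfl⟩ := cohClass_surjective x
    exact mem_filCohomology.2 ⟨a, by rw [hC.top 0 n le_rfl]; trivial, ha, rfl⟩
  · intro x hx
    obtain ⟨a, ha, ha', rfl⟩ := mem_filCohomology.1 hx
    exact mem_filCohomology.2 ⟨a, hC.anti p n ha, ha', rfl⟩
  · refine bot_unique fun x hx => ?_
    obtain ⟨a, ha, ha', rfl⟩ := mem_filCohomology.1 hx
    rw [hC.bot _ _ (by lia), Submodule.mem_bot] at ha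
    subst ha
    exact (cohClass_eq_zero_iff _ _).2 (Submodule.zero_mem _)
  · intro r hr p q n h hpr hqr
    have hd : ∀ a : approxCocycles d Fil r p n, d n a = 0 := by
      intro a
      have := (mem_approxCocycles.1 a.2).2
      rwa [hC.bot _ _ (by lia), Submodule.mem_bot] at this
    let f₀ : approxCocycles d Fil r p n →ₗ[ℝ] filCohomology d Fil p n :=
      (cohProj d n ∘ₗ (approxCocycles d Fil r p n).subtype.codRestrict (LinearMap.ker (d n))
        hd).codRestrict _ fun a => mem_filCohomology.2 ⟨a, a.2.1, hd a, rfl⟩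
    let f : approxCocycles d Fil r p n →ₗ[ℝ] grCohomology d Fil p n := Submodule.mkQ _ ∘ₗ f₀
    have hf : Function.Surjective f := by
      refine (Submodule.mkQ_surjective _).comp ?_
      rintro ⟨x, hx⟩
      obtain ⟨a, ha, ha', rfl⟩ := mem_filCohomology.1 hx
      refine ⟨⟨a, mem_approxCocycles.2 ⟨ha, ?_⟩⟩, rfl⟩
      rw [ha']
      exact Submodule.zero_mem _
    refine ⟨equivOfSurjective (S.proj r hr h) (S.proj_surjective r hr h) f hf fun a => ?_,
      fun a => ⟨hd a, mem_filCohomology.2 ⟨a, a.2.1, hd a, rfl⟩, equivOfSurjective_apply _ _ _ _ _ a⟩⟩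
    have h0 : f a = 0 ↔ cohClass d (a : C n) (hd a) ∈ filCohomology d Fil (p + 1) n :=
      Submodule.Quotient.mk_eq_zero _
    rw [h0, S.proj_eq_zero_iff, mem_filCohomology]
    constructor
    · intro hab
      obtain ⟨z, hz, c, hc, hzc⟩ := Submodule.mem_sup.1 hab
      have hz' : d n z = 0 := by
        have := hd a
        rwa [← hzc, map_add, hC.d_approxCoboundaries hc, add_zero] at this
      refine ⟨z, hz.1, hz', ?_⟩
      rw [cohClass_eq_iff, ← hzc, sub_add_cancel_left]
      refine Submodule.neg_mem _ ?_
      cases n with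
      | zero => exact hc
      | succ n =>
        obtain ⟨w, -, rfl⟩ := hc
        exact ⟨w, rfl⟩
    · rintro ⟨z, hz, hz', hza⟩
      rw [eq_comm, cohClass_eq_iff] at hza
      refine Submodule.mem_sup.2 ⟨z, mem_approxCocycles.2 ⟨hz, ?_⟩, a - z, ?_,
        add_sub_cancel _ _⟩
      · rw [hz']
        exact Submodule.zero_mem _
      · cases n with
        | zero => exact hza
        | succ n =>
          obtain ⟨w, hw⟩ := hza
          refine ⟨w, mem_approxCocycles.2 ⟨?_, ?_⟩, hw⟩
          · rw [hC.top _ _ (by lia)]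
            trivial
          · have e : (p : ℤ) - r + 1 + (r - 1) = p := by ring
            rw [e, hw]
            exact Submodule.sub_mem _ a.2.1 (hC.anti _ _ hz)

/-! ### Morphisms of filtered complexes -/

section Naturality

variable {C' : ℕ → Type u} [∀ n, AddCommGroup (C' n)] [∀ n, Module ℝ (C' n)]
  {d' : ∀ n, C' n →ₗ[ℝ] C' (n + 1)} {Fil' : ℤ → ∀ n, Submodule ℝ (C' n)}
  (hC' : IsFirstQuadrant d' Fil') (φ : ∀ n, C' n →ₗ[ℝ] C n)
  (hφ : ∀ n a, φ (n + 1) (d' n a) = d n (φ n a)) (hF : ∀ p n, ∀ a ∈ Fil' p n, φ n a ∈ Fil p n)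

omit hC
include hφ hF

theorem map_mem_approxCocycles {r p : ℤ} {n : ℕ} {a : C' n}
    (ha : a ∈ approxCocycles d' Fil' r p n) : φ n a ∈ approxCocycles d Fil r p n :=
  mem_approxCocycles.2 ⟨hF _ _ _ ha.1, hφ n a ▸ hF _ _ _ ha.2⟩

theorem map_mem_approxCoboundaries {r p : ℤ} {n : ℕ} {a : C' n}
    (ha : a ∈ approxCoboundaries d' Fil' r p n) : φ n a ∈ approxCoboundaries d Fil r p n := by
  cases n with
  | zero =>
    have : a = 0 := ha
    rw [this, map_zero]
    exact Submodule.zero_mem _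
  | succ n =>
    obtain ⟨w, hw, rfl⟩ := ha
    exact ⟨φ n w, map_mem_approxCocycles φ hφ hF hw, (hφ n w).symm⟩

/-- The map of approximate cocycles induced by a morphism of filtered complexes. -/
def approxCocyclesMap (r p : ℤ) (n : ℕ) :
    approxCocycles d' Fil' r p n →ₗ[ℝ] approxCocycles d Fil r p n :=
  (φ n).restrict fun _ ha => map_mem_approxCocycles φ hφ hF ha

include hC' in
-- A morphism of filtered complexes preserves approximate cocycles and coboundaries, so it descends
-- to the quotients. It commutes with the differentials because these are computed on
-- representatives.
theorem exists_pageMap {r : ℤ} (P' : FiltrationPage d' Fil' r) (P : FiltrationPage d Fil r) :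
    ∃ Ψ : P'.K ⟶ P.K, ∀ {p q n : ℕ} (h : p + q = n) (a : approxCocycles d' Fil' r p n),
      (Ψ.f (p, q)).hom (P'.proj h a) = P.proj h (approxCocyclesMap φ hφ hF r p n a) := by
  have hker : ∀ {p q n : ℕ} (h : p + q = n) (a : approxCocycles d' Fil' r p n),
      P'.proj h a = 0 → (P.proj h ∘ₗ approxCocyclesMap φ hφ hF r p n) a = 0 := by
    intro p q n h a ha
    rw [P'.proj_eq_zero_iff] at ha
    rw [LinearMap.comp_apply, P.proj_eq_zero_iff]
    obtain ⟨z, hz, c, hc, hzc⟩ := Submodule.mem_sup.1 ha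
    exact Submodule.mem_sup.2 ⟨φ n z, map_mem_approxCocycles φ hφ hF hz, φ n c,
      map_mem_approxCoboundaries φ hφ hF hc, by rw [← map_add, hzc]; rfl⟩
  let g : ∀ p q : ℕ, P'.K.X (p, q) →ₗ[ℝ] P.K.X (p, q) := fun p q =>
    liftOfSurjective (P'.proj rfl) (P'.proj_surjective rfl) _ (hker rfl)
  have hg : ∀ {p q n : ℕ} (h : p + q = n) (a : approxCocycles d' Fil' r p n),
      g p q (P'.proj h a) = P.proj h (approxCocyclesMap φ hφ hF r p n a) := by
    intro p q n h a
    subst h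
    exact liftOfSurjective_apply _ _ _ _ a
  refine ⟨{ f := fun pq => ModuleCat.ofHom (g pq.1 pq.2), comm' := ?_ }, hg⟩
  rintro ⟨p, q⟩ ⟨p', q'⟩ ⟨h1, h2⟩
  dsimp at h1 h2
  refine ModuleCat.hom_ext (LinearMap.ext fun x => ?_)
  obtain ⟨a, rfl⟩ := P'.proj_surjective rfl x
  have hn : p' + q' = p + q + 1 := by lia
  change (P.K.d (p, q) (p', q')).hom (g p q (P'.proj rfl a)) =
    g p' q' ((P'.K.d (p, q) (p', q')).hom (P'.proj rfl a))
  rw [hg, P'.d_proj rfl hn h1 a ⟨d' _ a, hC'.d_mem_approxCocycles a.2 h1⟩ rfl, hg]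
  exact P.d_proj rfl hn h1 _ _ (hφ _ _)

include hC' in
/-- The spectral sequence of a filtered complex is natural. -/
theorem FiltrationSpectralSequence.exists_hom (S' : FiltrationSpectralSequence d' Fil')
    (S : FiltrationSpectralSequence d Fil) :
    ∃ Ψ : CategoryTheory.SpectralSequence.Hom S'.E S.E,
      ∀ (r : ℤ) (hr : 2 ≤ r) {p q n : ℕ} (h : p + q = n) (a : approxCocycles d' Fil' r p n),
        ((Ψ.hom r hr).f (p, q)).hom (S'.proj r hr h a) =
          S.proj r hr h (approxCocyclesMap φ hφ hF r p n a) := by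
  have hex : ∀ (r : ℤ) (hr : 2 ≤ r), ∃ Ψ : S'.E.page r hr ⟶ S.E.page r hr,
      ∀ {p q n : ℕ} (h : p + q = n) (a : approxCocycles d' Fil' r p n),
        (Ψ.f (p, q)).hom (S'.proj r hr h a) =
          S.proj r hr h (approxCocyclesMap φ hφ hF r p n a) := fun r hr =>
    exists_pageMap hC' φ hφ hF (S'.toPage r hr) (S.toPage r hr)
  choose Ψ hΨ using hex
  refine ⟨⟨Ψ, ?_⟩, fun r hr _ _ _ h a => hΨ r hr h a⟩
  rintro r _ ⟨p, q⟩ rfl hr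
  -- The projection from cycles to homology is an epimorphism, so compatibility with the
  -- isomorphisms between pages can be tested on cycles. A cycle has a representative in Z_(r+1), to
  -- which `iso_proj` applies on both sides.
  rw [← CategoryTheory.cancel_epi ((S'.E.page r hr).homologyπ (p, q)),
    HomologicalComplex.homologyπ_naturality_assoc]
  refine ModuleCat.hom_ext (LinearMap.ext fun z => ?_)
  obtain ⟨a, ha, haz⟩ := (S'.toPage r hr).exists_proj_eq hC' rfl
    (((S'.E.page r hr).iCycles (p, q)).hom z) fun j =>
      CategoryTheory.ConcreteCategory.congr_hom ((S'.E.page r hr).iCycles_d (p, q) j) z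
  have h1 := S'.iso_proj r hr rfl z a ⟨a, ha⟩ rfl haz.symm
  have h2 : ((S.E.page r hr).iCycles (p, q)).hom
      ((HomologicalComplex.cyclesMap (Ψ r hr) (p, q)).hom z) =
        S.proj r hr rfl (approxCocyclesMap φ hφ hF r p _ a) := by
    refine (CategoryTheory.ConcreteCategory.congr_hom
      (HomologicalComplex.cyclesMap_i (Ψ r hr) (p, q)) z).trans ?_
    change ((Ψ r hr).f (p, q)).hom (((S'.E.page r hr).iCycles (p, q)).hom z) = _
    rw [← haz]
    exact hΨ r hr rfl a
  have h3 := S.iso_proj r hr rfl ((HomologicalComplex.cyclesMap (Ψ r hr) (p, q)).hom z)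
    (approxCocyclesMap φ hφ hF r p _ a) (approxCocyclesMap φ hφ hF (r + 1) p _ ⟨a, ha⟩) rfl h2
  refine h3.trans ?_
  rw [← hΨ (r + 1) (by lia) rfl]
  exact congrArg _ h1.symm

end Naturality

end SpectralSequenceConstruction

/-! ### Flat connections and the vanishing of d² on forms -/

section Flatness

variable {E : Type*} [NormedAddCommGroup E] [NormedSpace ℝ E]
  {M : Type*} [TopologicalSpace M] [ChartedSpace E M] [IsManifold 𝓘(ℝ, E) ∞ M]
  {V : M → Type*} [∀ x, AddCommGroup (V x)] [∀ x, Module ℝ (V x)]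
  {W : M → Type*} [∀ x, AddCommGroup (W x)] [∀ x, Module ℝ (W x)]
  {U : M → Type*} [∀ x, AddCommGroup (U x)] [∀ x, Module ℝ (U x)]
  {ΓU : SectionSpace E U} {ΓV : SectionSpace E V} {ΓW : SectionSpace E W}

/-- The Koszul formula is the Chevalley–Eilenberg differential of the real vector space of sections,
which makes the algebra above available. -/
theorem koszul_eq_ce {B : AnchoredBracket ΓV} (D : Connection B ΓW) {n : ℕ}
    (T : ΓV.carrier [⋀^Fin n]→ₗ[ℝ] ΓW.carrier) :
    koszul D T = ce B.bracket B.bracket_self D.nabla T := by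
  cases n <;> rfl

/-- The Jacobi identity for an anchored bracket. -/
def AnchoredBracket.Jacobi (B : AnchoredBracket ΓV) : Prop :=
  ∀ X Y Z, B.bracket X (B.bracket Y Z) = B.bracket (B.bracket X Y) Z + B.bracket Y (B.bracket X Z)

/-- Flatness of a connection along an anchored bracket. -/
def Connection.IsFlat {B : AnchoredBracket ΓV} (D : Connection B ΓW) : Prop :=
  ∀ X Y s, D.nabla (B.bracket X Y) s = D.nabla X (D.nabla Y s) - D.nabla Y (D.nabla X s)

theorem dForm_dForm [IsFull ΓV] {B : AnchoredBracket ΓV} {D : Connection B ΓW} (hB : B.Jacobi)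
    (hD : D.IsFlat) (n : ℕ) (α : (altForms ΓV ΓW n).carrier) :
    dForm D (n + 1) (dForm D n α) = 0 := by
  apply onSections_injective
  rw [onSections_dForm, onSections_dForm, koszul_eq_ce, koszul_eq_ce, ce_ce _ _ _ hB hD]
  rfl

theorem onSections_altConnection_eq_lieDer {B : AnchoredBracket ΓU} [IsFull ΓV]
    (D : Connection B ΓV) (D' : Connection B ΓW) {n : ℕ} (X : ΓU.carrier)
    (T : (altForms ΓV ΓW n).carrier) :
    onSections ((altConnection D D' n).nabla X T) =
      lieDer (D.nabla X) (D'.nabla X) (onSections T) := by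
  ext1 v
  rw [onSections_altConnection, lieDer_apply]

theorem onSections_sub (α η : (altForms ΓV ΓW n).carrier) :
    onSections (α - η) = onSections α - onSections η := rfl

theorem Connection.IsFlat.altConnection {B : AnchoredBracket ΓU} [IsFull ΓV]
    {D : Connection B ΓV} {D' : Connection B ΓW} (hD : D.IsFlat) (hD' : D'.IsFlat) (n : ℕ) :
    (LieAlgd.altConnection D D' n).IsFlat := by
  intro X Y T
  apply onSections_injective
  simp only [onSections_sub, onSections_altConnection_eq_lieDer]
  exact lieDer_commutator _ _ _ _ _ _ (hD X Y) (hD' X Y) _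

theorem trivialConnection_nabla_apply (B : AnchoredBracket ΓV) (X : ΓV.carrier)
    (g : (smoothFunctions E M).carrier) (x : M) :
    ((trivialConnection B).nabla X g).1 x = mvfderiv 𝓘(ℝ, E) g.1 x (B.anchor x (X.1 x)) := rfl

/-- The Jacobi identity for X, Y and f Z, expanded by the Leibniz rule, contains f times the Jacobi
identity for X, Y, Z and mixed terms that cancel. What remains says that [X, Y] f - X(Y f) + Y(X f)
annihilates Z, and Z can be chosen nonzero at the given point. So compatibility of the anchor with
brackets, as far as functions see it, follows from Jacobi and Leibniz. -/
theorem trivialConnection_isFlat (B : AnchoredBracket ΓV) [IsFull ΓV] (hB : B.Jacobi) :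
    (trivialConnection B).IsFlat := by
  intro X Y g
  apply Subtype.ext; funext x
  -- In a zero fiber there is no Z to test with, but there the anchor vanishes and both sides are
  -- zero.
  by_cases h0 : ∀ v : V x, v = 0
  · have hz : ∀ (X : ΓV.carrier) (g : (smoothFunctions E M).carrier),
        ((trivialConnection B).nabla X g).1 x = 0 := fun X g => by
      rw [trivialConnection_nabla_apply, h0 (X.1 x), map_zero, map_zero]
    rw [Submodule.coe_sub, Pi.sub_apply, hz, hz, hz, sub_zero]
  · push Not at h0
    obtain ⟨v, hv⟩ := h0
    obtain ⟨Z, rfl⟩ := IsFull.exists_eq (Γ := ΓV) x v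
    let f : C^∞⟮𝓘(ℝ, E), M; 𝓘(ℝ, ℝ), ℝ⟯ := ⟨g.1, g.2⟩
    have h := hB X Y (f • Z)
    simp only [B.leibniz, map_add] at h
    have hx := congrFun (congrArg Subtype.val h) x
    have hJ := congrFun (congrArg Subtype.val (hB X Y Z)) x
    simp only [Submodule.coe_add, Pi.add_apply, smul_apply'] at hx hJ
    rw [hJ] at hx
    have key : ((trivialConnection B).nabla (B.bracket X Y) g).1 x • Z.1 x =
        (((trivialConnection B).nabla X ((trivialConnection B).nabla Y g)).1 x -
          ((trivialConnection B).nabla Y ((trivialConnection B).nabla X g)).1 x) • Z.1 x := by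
      change dirDeriv (B.toVF (B.bracket X Y)) f x • Z.1 x =
        (dirDeriv (B.toVF X) (dirDeriv (B.toVF Y) f) x -
          dirDeriv (B.toVF Y) (dirDeriv (B.toVF X) f) x) • Z.1 x
      change f x • _ + dirDeriv (B.toVF X) f x • (B.bracket Y Z).1 x +
        (dirDeriv (B.toVF Y) f x • (B.bracket X Z).1 x +
          dirDeriv (B.toVF X) (dirDeriv (B.toVF Y) f) x • Z.1 x) =
        f x • (B.bracket (B.bracket X Y) Z).1 x + dirDeriv (B.toVF (B.bracket X Y)) f x • Z.1 x +
        (f x • (B.bracket Y (B.bracket X Z)).1 x + dirDeriv (B.toVF Y) f x • (B.bracket X Z).1 x +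
        (dirDeriv (B.toVF X) f x • (B.bracket Y Z).1 x +
          dirDeriv (B.toVF Y) (dirDeriv (B.toVF X) f) x • Z.1 x)) at hx
      rw [sub_smul, eq_sub_iff_add_eq, ← sub_eq_zero]
      rw [eq_comm, ← sub_eq_zero] at hx
      refine Eq.trans ?_ hx
      rw [smul_add]
      abel
    exact smul_left_injective ℝ hv key

end Flatness

/-! ### The differentials of a regular Lie algebroid with abelian isotropy -/

namespace LieAlgebroid

variable {E : Type*} [NormedAddCommGroup E] [NormedSpace ℝ E] [FiniteDimensional ℝ E]
  {M : Type*} [TopologicalSpace M] [ChartedSpace E M] [IsManifold 𝓘(ℝ, E) ∞ M]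
  [T2Space M] [SigmaCompactSpace M]
  {F : Type*} [NormedAddCommGroup F] [NormedSpace ℝ F] [FiniteDimensional ℝ F]
  {A : M → Type*} [TopologicalSpace (TotalSpace F A)] [∀ x, TopologicalSpace (A x)]
  [∀ x, AddCommGroup (A x)] [∀ x, Module ℝ (A x)]
  [∀ x, IsTopologicalAddGroup (A x)] [∀ x, ContinuousSMul ℝ (A x)]
  [FiberBundle F A] [VectorBundle ℝ F A] [ContMDiffVectorBundle ∞ F A 𝓘(ℝ, E)]
  (𝒜 : LieAlgebroid E F A)

theorem bracketA_jacobi : 𝒜.bracketA.Jacobi := 𝒜.jacobi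

theorem dA_dA (n : ℕ) (α : 𝒜.Form n) : 𝒜.dA (n + 1) (𝒜.dA n α) = 0 :=
  dForm_dForm 𝒜.bracketA_jacobi (trivialConnection_isFlat _ 𝒜.bracketA_jacobi) n α

variable [𝒜.IsRegular]

theorem anchorTF_surjective : Function.Surjective 𝒜.anchorTF := by
  obtain ⟨σ⟩ := 𝒜.exists_splitting
  exact fun Y => ⟨σ.onSec Y, σ.anchorTF_onSec Y⟩

theorem bracketTF_anchorTF (X Y : (smoothSections E F A).carrier) :
    𝒜.bracketTF.bracket (𝒜.anchorTF X) (𝒜.anchorTF Y) = 𝒜.anchorTF (𝒜.bracket X Y) :=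
  (𝒜.anchorTF_bracket X Y).symm

/-- Sections of T𝓕 lift to sections of A, and the anchor respects brackets, so the identity descends
from A. -/
theorem bracketTF_jacobi : 𝒜.bracketTF.Jacobi := by
  intro X Y Z
  obtain ⟨X, rfl⟩ := 𝒜.anchorTF_surjective X
  obtain ⟨Y, rfl⟩ := 𝒜.anchorTF_surjective Y
  obtain ⟨Z, rfl⟩ := 𝒜.anchorTF_surjective Z
  simp only [bracketTF_anchorTF, ← map_add]
  rw [𝒜.jacobi]

variable [𝒜.HasAbelianIsotropy]

theorem inclK_connK (X : (smoothSections E F A).carrier) (V : 𝒜.sectionsK.carrier) :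
    𝒜.inclK (𝒜.connK.nabla (𝒜.anchorTF X) V) = 𝒜.bracket X (𝒜.inclK V) :=
  𝒜.inclK_nablaK rfl V

/-- For lifts X, Y to A, flatness is the Jacobi identity [[X, Y], V] = [X, [Y, V]] - [Y, [X, V]]. -/
theorem connK_isFlat : 𝒜.connK.IsFlat := by
  intro X Y V
  obtain ⟨X, rfl⟩ := 𝒜.anchorTF_surjective X
  obtain ⟨Y, rfl⟩ := 𝒜.anchorTF_surjective Y
  apply 𝒜.inclK_injective
  rw [bracketTF_anchorTF, map_sub]
  simp only [inclK_connK]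
  rw [𝒜.jacobi X Y]
  abel

theorem dK_dK (p : ℕ) (κ : 𝒜.KForm p) : 𝒜.dK (p + 1) (𝒜.dK p κ) = 0 :=
  dForm_dForm 𝒜.bracketTF_jacobi 𝒜.connK_isFlat p κ

theorem dF_dF (p q : ℕ) (β : 𝒜.BiForm p q) : 𝒜.dF q (p + 1) (𝒜.dF q p β) = 0 :=
  dForm_dForm 𝒜.bracketTF_jacobi (𝒜.connK_isFlat.altConnection
    (trivialConnection_isFlat _ 𝒜.bracketTF_jacobi) q) p β

end LieAlgebroid

/-! ### Forms with values in alternating forms, evaluated on sections -/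

section Curried

variable {E : Type*} [NormedAddCommGroup E] [NormedSpace ℝ E]
  {M : Type*} [TopologicalSpace M] [ChartedSpace E M] [IsManifold 𝓘(ℝ, E) ∞ M]
  {V : M → Type*} [∀ x, AddCommGroup (V x)] [∀ x, Module ℝ (V x)]
  {W : M → Type*} [∀ x, AddCommGroup (W x)] [∀ x, Module ℝ (W x)]
  {U : M → Type*} [∀ x, AddCommGroup (U x)] [∀ x, Module ℝ (U x)]
  {ΓU : SectionSpace E U} {ΓV : SectionSpace E V} {ΓW : SectionSpace E W}

/-- The value of forms on sections, as a linear map. -/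
def onSectionsHom (ΓV : SectionSpace E V) (ΓW : SectionSpace E W) (n : ℕ) :
    (altForms ΓV ΓW n).carrier →ₗ[ℝ] ΓV.carrier [⋀^Fin n]→ₗ[ℝ] ΓW.carrier where
  toFun := onSections
  map_add' := onSections_add
  map_smul' := onSections_smul

/-- The value on sections of a form with values in alternating forms. -/
def onSections₂ {p q : ℕ} (β : (altForms ΓU (altForms ΓV ΓW q) p).carrier) :
    ΓU.carrier [⋀^Fin p]→ₗ[ℝ] ΓV.carrier [⋀^Fin q]→ₗ[ℝ] ΓW.carrier :=
  (onSectionsHom ΓV ΓW q).compAlternatingMap (onSections β)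

theorem onSections₂_apply {p q : ℕ} (β : (altForms ΓU (altForms ΓV ΓW q) p).carrier)
    (Y : Fin p → ΓU.carrier) (v : Fin q → ΓV.carrier) (x : M) :
    (onSections₂ β Y v).1 x = β.1 x (fun i => (Y i).1 x) (fun i => (v i).1 x) := rfl

theorem onSections₂_injective [IsFull ΓU] [IsFull ΓV] {p q : ℕ} :
    Function.Injective (onSections₂ : (altForms ΓU (altForms ΓV ΓW q) p).carrier → _) := by
  intro β β' h
  apply onSections_injective
  ext1 Y
  apply onSections_injective
  exact congrArg (fun R => R Y) h

/-- Evaluation on sections intertwines the induced connection with the Lie derivative, so this is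
the naturality `ce_map` in the coefficients. It brings d_𝓕 into the form in which it occurs in
`blockDiff`. -/
theorem onSections₂_dForm [IsFull ΓU] [IsFull ΓV] {B : AnchoredBracket ΓU} (D : Connection B ΓV)
    (D' : Connection B ΓW) {p q : ℕ} (β : (altForms ΓU (altForms ΓV ΓW q) p).carrier) :
    onSections₂ (dForm (altConnection D D' q) p β) =
      ce (N := ΓV.carrier [⋀^Fin q]→ₗ[ℝ] ΓW.carrier) B.bracket B.bracket_self
        (lieDerHom D.nabla D'.nabla q) (onSections₂ β) := by
  have h0 : ∀ (X : ΓU.carrier) (s : (altForms ΓV ΓW q).carrier),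
      onSectionsHom ΓV ΓW q ((altConnection D D' q).nabla X s) =
      lieDerHom D.nabla D'.nabla q X (onSectionsHom ΓV ΓW q s) := fun X s =>
    onSections_altConnection_eq_lieDer D D' X s
  have h := ce_map (N' := ΓV.carrier [⋀^Fin q]→ₗ[ℝ] ΓW.carrier) B.bracket B.bracket_self
    (altConnection D D' q).nabla B.bracket B.bracket_self
    (lieDerHom D.nabla D'.nabla q) LinearMap.id (onSectionsHom ΓV ΓW q) (fun _ _ => rfl)
    h0 (onSections β)
  rw [AlternatingMap.compLinearMap_id, AlternatingMap.compLinearMap_id] at h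
  rw [onSections₂, onSections_dForm, koszul_eq_ce, ← h]
  rfl

/-- The contraction is defined fiberwise, while `blockDiff` works with sections; this matches the
two. -/
theorem onSections₂_contraction (γ : (altForms ΓU ΓV 2).carrier) {p q : ℕ}
    (β : (altForms ΓU (altForms ΓV ΓW (q + 1)) p).carrier) :
    onSections₂ (contraction γ p q β) =
      pairSum (insertPair (onSections γ) (onSections₂ β)) (insertPair_self _ _) := by
  ext Y v x
  rw [onSections₂_apply, contraction_apply, pairSum_apply, sum_alt_apply, Submodule.coe_sum,
    Finset.sum_apply]
  refine Finset.sum_congr rfl fun i _ => ?_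
  rw [sum_alt_apply, Submodule.coe_sum, Finset.sum_apply]
  refine Finset.sum_congr rfl fun j _ => ?_
  rw [AlternatingMap.smul_apply, Submodule.coe_smul_of_tower, Pi.smul_apply]
  congr 1
  change _ = (onSections₂ β _ (Matrix.vecCons (onSections γ _) v)).1 x
  rw [onSections₂_apply]
  congr 1
  funext k
  refine Fin.cases ?_ (fun k => rfl) k
  rw [Matrix.cons_val_zero, Matrix.cons_val_zero, onSections_apply]
  congr 1
  funext l
  fin_cases l <;> rfl

end Curried

/-! ### Components and filtration of the forms on a Lie algebroid -/

namespace LieAlgebroid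

variable {E : Type*} [NormedAddCommGroup E] [NormedSpace ℝ E] [FiniteDimensional ℝ E]
  {M : Type*} [TopologicalSpace M] [ChartedSpace E M] [IsManifold 𝓘(ℝ, E) ∞ M]
  [T2Space M] [SigmaCompactSpace M]
  {F : Type*} [NormedAddCommGroup F] [NormedSpace ℝ F] [FiniteDimensional ℝ F]
  {A : M → Type*} [TopologicalSpace (TotalSpace F A)] [∀ x, TopologicalSpace (A x)]
  [∀ x, AddCommGroup (A x)] [∀ x, Module ℝ (A x)]
  [∀ x, IsTopologicalAddGroup (A x)] [∀ x, ContinuousSMul ℝ (A x)]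
  [FiberBundle F A] [VectorBundle ℝ F A] [ContMDiffVectorBundle ∞ F A 𝓘(ℝ, E)]
  {𝒜 : LieAlgebroid E F A}

theorem Splitting.onSections₂_component (σ : 𝒜.Splitting) {p q n : ℕ} (h : p + q = n)
    (α : 𝒜.Form n) :
    onSections₂ (σ.component h α) = blockRestrict σ.onSec 𝒜.inclK h (onSections α) := by
  subst h
  ext Y V x
  rw [onSections₂_apply, blockRestrict_apply, onSections_apply]
  change α.1 x _ = _
  congr 1
  funext i
  refine Fin.addCases (fun i => ?_) (fun i => ?_) i
  · simp
    rfl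
  · simp
    rfl

/-- The component in bidegree `(p, q)` of `δ₁ + δ₂`, applied to the components of a form. -/
theorem Splitting.component_dA [𝒜.IsRegular] [𝒜.HasAbelianIsotropy] (σ : 𝒜.Splitting)
    {n : ℕ} (α : 𝒜.Form n) (p q : ℕ) (h : p + q = n + 1) :
    σ.component h (𝒜.dA n α) =
      𝒜.totalComponent σ.curvature n p q h (fun pq => σ.component pq.2 α) := by
  apply onSections₂_injective
  have hγ : ∀ X Y, onSections σ.curvature ![X, Y] = σ.curvatureFun X Y := fun X Y => by
    rw [curvature, onSections_descend]
    rfl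
  -- The hypotheses of `blockRestrict_ce` are the structure equations of the splitting: [σX, V] =
  -- ∇_X V, [σX, σY] = σ[X, Y] + γ(X, Y), [V, W] = 0, and the trivial action of K on functions.
  rw [σ.onSections₂_component, dA, onSections_dForm, koszul_eq_ce,
    blockRestrict_ce σ.onSec 𝒜.inclK 𝒜.bracketA.bracket 𝒜.bracketA.bracket_self
      (trivialConnection 𝒜.bracketA).nabla 𝒜.bracketTF.bracket 𝒜.bracketTF.bracket_self
      𝒜.connK.nabla (onSections σ.curvature)
      (fun X V => by
        conv_rhs => rw [← σ.anchorTF_onSec X]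
        rw [inclK_connK]
        rfl)
      (fun X Y => by
        rw [hγ, inclK_curvatureFun, add_sub_cancel]
        rfl)
      (fun V W => HasAbelianIsotropy.bracket_eq_zero _ _ (fun x => (V.1 x).2) fun x => (W.1 x).2)
      (fun V a => by
        apply Subtype.ext; funext x
        rw [trivialConnection_nabla_apply]
        have h0 : 𝒜.bracketA.anchor x ((𝒜.inclK V).1 x) = 0 := (V.1 x).2
        rw [h0, map_zero]
        rfl)]
  -- As ♯ ∘ σ = id, a section σX of A differentiates functions as the vector field X does.
  have hρ : (trivialConnection 𝒜.bracketA).nabla ∘ₗ σ.onSec =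
      (trivialConnection 𝒜.bracketTF).nabla := by
    ext X g x
    rw [LinearMap.comp_apply, trivialConnection_nabla_apply, trivialConnection_nabla_apply]
    congr 1
    exact σ.anchor_apply x _
  match p, h with
  | 0, h => rfl
  | 1, h =>
    rw [blockDiff, hρ, ← σ.onSections₂_component]
    exact (onSections₂_dForm _ _ _).symm
  | p + 2, h =>
    rw [blockDiff, hρ]
    have h1 := congrArg (ce (N := 𝒜.sectionsK.carrier [⋀^Fin q]→ₗ[ℝ] (smoothFunctions E M).carrier)
      𝒜.bracketTF.bracket 𝒜.bracketTF.bracket_self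
      (lieDerHom 𝒜.connK.nabla (trivialConnection 𝒜.bracketTF).nabla q))
      (σ.onSections₂_component (by omega : p + 1 + q = n) α)
    have h2 := congrArg (fun β => pairSum (insertPair (onSections σ.curvature) β)
      (insertPair_self _ _)) (σ.onSections₂_component (by omega : p + (q + 1) = n) α)
    rw [← onSections₂_dForm] at h1
    have h3 := (onSections₂_contraction _ _).trans h2
    exact (congrArg₂ (fun a b => a + (-1 : ℝ) ^ p • b) h1 h3).symm

/-- The projection of `A` to `K` along a splitting. -/
def Splitting.projK (σ : 𝒜.Splitting) (x : M) : A x →ₗ[ℝ] 𝒜.K x :=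
  (LinearMap.id - σ.toFun x ∘ₗ
    (𝒜.anchor x : A x →ₗ[ℝ] TangentSpace 𝓘(ℝ, E) x).rangeRestrict).codRestrict
    (𝒜.K x) (fun v => by
      change 𝒜.anchor x (v - σ.toFun x _) = 0
      rw [map_sub, σ.anchor_apply]
      exact sub_self _)

/-- The anchor as a map to `T𝓕`. -/
def anchorRange (𝒜 : LieAlgebroid E F A) (x : M) : A x →ₗ[ℝ] 𝒜.TF x :=
  (𝒜.anchor x : A x →ₗ[ℝ] TangentSpace 𝓘(ℝ, E) x).rangeRestrict

theorem anchorRange_eq_zero {x : M} {v : A x} (hv : v ∈ 𝒜.K x) : 𝒜.anchorRange x v = 0 :=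
  Subtype.ext hv

theorem Splitting.anchorRange_toFun (σ : 𝒜.Splitting) (x : M) (y : 𝒜.TF x) :
    𝒜.anchorRange x (σ.toFun x y) = y := Subtype.ext (σ.anchor_apply x y)

theorem Splitting.coe_projK (σ : 𝒜.Splitting) (x : M) (v : A x) :
    (σ.projK x v : A x) = v - σ.toFun x (𝒜.anchorRange x v) := rfl

theorem Splitting.projK_toFun (σ : 𝒜.Splitting) (x : M) (y : 𝒜.TF x) :
    σ.projK x (σ.toFun x y) = 0 := by
  apply Subtype.ext
  rw [coe_projK, anchorRange_toFun, sub_self]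
  rfl

theorem Splitting.projK_coe (σ : 𝒜.Splitting) (x : M) (v : 𝒜.K x) : σ.projK x v = v := by
  apply Subtype.ext
  rw [coe_projK, anchorRange_eq_zero v.2, map_zero, sub_zero]

/-- The form whose only nonzero component with respect to a splitting is `β`. -/
def Splitting.extend (σ : 𝒜.Splitting) {p q n : ℕ} (h : p + q = n) (β : 𝒜.BiForm p q) :
    𝒜.Form n :=
  ⟨fun x => blockExtend (𝒜.anchorRange x) (σ.projK x) h (β.1 x), fun X => by
    let P₂ : (smoothSections E F A).carrier → 𝒜.sectionsK.carrier := fun X =>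
      𝒜.toK (X - σ.onSec (𝒜.anchorTF X)) (by simp)
    have h1 : (fun x => blockExtend (𝒜.anchorRange x) (σ.projK x) h (β.1 x)
        (fun i => (X i).1 x)) = ((blockPerms p n).card : ℝ)⁻¹ • ∑ τ : Equiv.Perm (Fin n),
      Equiv.Perm.sign τ • (onSections₂ β
        (fun i => 𝒜.anchorTF (X (τ (Fin.cast h (Fin.castAdd q i)))))
        (fun j => P₂ (X (τ (Fin.cast h (Fin.natAdd p j)))))).1 := by
      funext x
      rw [blockExtend_apply, Pi.smul_apply, Finset.sum_apply]
      rfl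
    rw [h1]
    exact Submodule.smul_mem _ _ (Submodule.sum_mem _ fun τ _ =>
      zsmul_mem (Subtype.property _) _)⟩

theorem Splitting.component_extend (σ : 𝒜.Splitting) {p q n : ℕ} (h : p + q = n)
    (β : 𝒜.BiForm p q) : σ.component h (σ.extend h β) = β := by
  apply Subtype.ext; funext x
  exact blockRestrict_blockExtend _ _ _ _ (σ.anchorRange_toFun x)
    (fun w => anchorRange_eq_zero w.2) (σ.projK_toFun x) (σ.projK_coe x) h (β.1 x)

theorem Splitting.component_extend_of_ne (σ : 𝒜.Splitting) {p q p' q' n : ℕ} (h : p + q = n)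
    (h' : p' + q' = n) (hp : p' ≠ p) (β : 𝒜.BiForm p q) :
    σ.component h' (σ.extend h β) = 0 := by
  apply Subtype.ext; funext x
  exact blockRestrict_blockExtend_of_ne _ _ _ _
    (fun w => anchorRange_eq_zero w.2) (σ.projK_toFun x) h h' hp (β.1 x)

/-- The filtration in terms of components. -/
theorem Splitting.mem_filtration_iff (σ : 𝒜.Splitting) {p : ℤ} {n : ℕ} {α : 𝒜.Form n} :
    α ∈ 𝒜.filtration p n ↔
      ∀ (p' q' : ℕ) (h : p' + q' = n), (p' : ℤ) < p → σ.component h α = 0 := by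
  constructor
  · intro hα p' q' h hp
    apply Subtype.ext; funext x
    ext Y V
    -- The last q' arguments of a component are in K, and n < p + q' because p' < p.
    refine hα x _ (Finset.univ.filter fun i : Fin n => p' ≤ (i : ℕ)) (fun i hi => ?_) ?_
    · subst h
      obtain ⟨j, hj⟩ : ∃ j : Fin q', Fin.natAdd p' j = i :=
        ⟨⟨i - p', by have := (Finset.mem_filter.1 hi).2; omega⟩, by
          apply Fin.ext
          have := (Finset.mem_filter.1 hi).2
          simp
          omega⟩
      rw [← hj]
      simp
    · have h1 : (Finset.univ.filter fun i : Fin n => p' ≤ (i : ℕ)).card = n - p' := by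
        have h2 := Finset.card_filter_add_card_filter_not (s := (Finset.univ : Finset (Fin n)))
          (fun i : Fin n => (i : ℕ) < p')
        simp only [not_lt] at h2
        rw [Fin.card_filter_val_lt, Finset.card_univ, Fintype.card_fin] at h2
        omega
      rw [h1]
      omega
  · intro hα x v S hS hn
    -- Each vector is σ of its anchor plus its projection to K, and at the slots in `S` the first
    -- part is zero. A block that matters has p' + #S ≤ n < p + #S, hence p' < p.
    refine apply_eq_zero_of_blockRestrict (σ.toFun x) (𝒜.K x).subtype (α.1 x) S
      (fun p' q' h hp => congrFun (congrArg Subtype.val (hα p' q' h (by omega))) x)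
      (fun i => 𝒜.anchorRange x (v i)) (fun i => σ.projK x (v i)) v (fun i => ?_)
      fun i hi => anchorRange_eq_zero (hS i hi)
    rw [Submodule.subtype_apply, coe_projK, add_sub_cancel]

/-- If all components vanish the form lies in F^(n+1) Ωⁿ(A), whose defining condition already holds
for the empty set of arguments in K. -/
theorem Splitting.eq_zero_of_component (σ : 𝒜.Splitting) {n : ℕ} {α : 𝒜.Form n}
    (h : ∀ (p q : ℕ) (h : p + q = n), σ.component h α = 0) : α = 0 := by
  have h1 : α ∈ 𝒜.filtration (n + 1) n := σ.mem_filtration_iff.2 fun p q hpq _ => h p q hpq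
  apply Subtype.ext; funext x
  ext v
  exact h1 x v ∅ (by simp) (by simp)

/-- The decomposition of the forms on `A` along a splitting. -/
def Splitting.components (σ : 𝒜.Splitting) (n : ℕ) : 𝒜.Form n →ₗ[ℝ] 𝒜.Total n :=
  LinearMap.pi fun pq => σ.component pq.2

/-- A preimage is the sum of the extensions of the given components: each extension has a single
nonzero component. -/
theorem Splitting.components_bijective (σ : 𝒜.Splitting) (n : ℕ) :
    Function.Bijective (σ.components n) := by
  constructor
  · rw [← LinearMap.ker_eq_bot, LinearMap.ker_eq_bot']
    exact fun α hα => σ.eq_zero_of_component fun p q h => congrFun hα ⟨(p, q), h⟩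
  · intro τ
    have : Fintype {pq : ℕ × ℕ // pq.1 + pq.2 = n} :=
      Fintype.subtype (Finset.HasAntidiagonal.antidiagonal n) (by simp)
    refine ⟨∑ pq, σ.extend pq.2 (τ pq), funext fun pq => ?_⟩
    change σ.component pq.2 _ = _
    rw [map_sum, Finset.sum_eq_single pq, σ.component_extend]
    · intro pq' _ hne
      refine σ.component_extend_of_ne _ _ (fun hp => hne ?_) _
      apply Subtype.ext
      have h1 := pq.2
      have h2 := pq'.2
      exact Prod.ext hp.symm (by omega)
    · simp

/-- On `F^p`, the component in bidegree `(p, q)` does not depend on the splitting. -/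
theorem Splitting.component_eq_of_mem (σ σ' : 𝒜.Splitting) {p q n : ℕ} (h : p + q = n)
    {α : 𝒜.Form n} (hα : α ∈ 𝒜.filtration p n) : σ.component h α = σ'.component h α := by
  apply Subtype.ext; funext x
  ext Y V
  subst h
  -- The arguments built from σ are those built from σ', namely `v`, plus the differences `k`, which
  -- take values in K and vanish in the last q slots. In the multilinear expansion only the term
  -- without differences should survive.
  let k : Fin (p + q) → A x := Fin.append (fun j => σ.toFun x (Y j) - σ'.toFun x (Y j)) 0
  let v : Fin (p + q) → A x := Fin.append (fun j => σ'.toFun x (Y j)) fun j => (V j : A x)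
  have hv : (fun i : Fin (p + q) => Fin.append (fun j => σ.toFun x (Y j)) (fun j => (V j : A x))
      (Fin.cast rfl i)) = k + v := by
    funext i
    refine Fin.addCases (fun i => ?_) (fun i => ?_) i <;> simp [k, v]
  change α.1 x (fun i : Fin (p + q) => Fin.append (fun j => σ.toFun x (Y j))
    (fun j => (V j : A x)) (Fin.cast rfl i)) = α.1 x v
  rw [hv]
  refine ((α.1 x).toMultilinearMap.map_add_univ k v).trans ?_
  rw [Finset.sum_eq_single ∅]
  · rw [Finset.piecewise_empty]
    rfl
  · intro U _ hU
    by_cases hUp : ∃ j : Fin q, Fin.natAdd p j ∈ U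
    · obtain ⟨j, hj⟩ := hUp
      refine (α.1 x).map_coord_zero (Fin.natAdd p j) ?_
      rw [Finset.piecewise_eq_of_mem _ _ _ hj]
      simp [k]
    · push Not at hUp
      let R : Finset (Fin (p + q)) := Finset.univ.map (Fin.natAddEmb p)
      have hd : Disjoint U R := by
        rw [Finset.disjoint_left]
        intro i hi hiR
        obtain ⟨j, -, rfl⟩ := Finset.mem_map.1 hiR
        exact hUp j hi
      -- A nonempty `U` of differences and the last q slots together give more than q = n - p
      -- arguments in K.
      refine hα x _ (U ∪ R) (fun i hi => ?_) ?_
      · rcases Finset.mem_union.1 hi with hi | hi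
        · rw [Finset.piecewise_eq_of_mem _ _ _ hi]
          refine Fin.addCases (fun j => ?_) (fun j => ?_) i
          · simp only [k, Fin.append_left]
            change 𝒜.anchor x _ = 0
            rw [map_sub, σ.anchor_apply, σ'.anchor_apply, sub_self]
          · simp [k]
        · rw [Finset.piecewise_eq_of_notMem _ _ _ (Finset.disjoint_right.1 hd hi)]
          obtain ⟨j, -, rfl⟩ := Finset.mem_map.1 hi
          simp [v]
      · rw [Finset.card_union_of_disjoint hd]
        have : 0 < U.card := Finset.card_pos.2 (Finset.nonempty_iff_ne_empty.2 hU)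
        rw [Finset.card_map, Finset.card_univ, Fintype.card_fin]
        push_cast
        omega
  · simp

/-- The differential raises the T𝓕-degree by one or two. Hence the components of d_A α of degree
less than p only involve components of α of still lower degree, which vanish for α in F^p. -/
theorem filtration_isFirstQuadrant (𝒜 : LieAlgebroid E F A) [𝒜.IsRegular]
    [𝒜.HasAbelianIsotropy] : IsFirstQuadrant 𝒜.dA 𝒜.filtration where
  d_d := 𝒜.dA_dA
  anti p n α hα x v S hS hn := hα x v S hS (by omega)
  d_mem p n α hα := by
    obtain ⟨σ⟩ := 𝒜.exists_splitting
    rw [σ.mem_filtration_iff] at hα ⊢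
    intro p' q' h hp
    rw [σ.component_dA]
    match p', h with
    | 0, h => rfl
    | 1, h =>
      change 𝒜.dF q' 0 (σ.component _ α) = 0
      rw [hα 0 q' (by omega) (by omega), map_zero]
    | p' + 2, h =>
      change 𝒜.dF q' (p' + 1) (σ.component _ α) +
        (-1 : ℝ) ^ p' • 𝒜.iGamma σ.curvature p' q' (σ.component _ α) = 0
      rw [hα (p' + 1) q' (by omega) (by push_cast at hp ⊢; omega),
        hα p' (q' + 1) (by omega) (by push_cast at hp ⊢; omega), map_zero, map_zero, smul_zero,
        add_zero]
  top p n hp := by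
    refine top_unique fun α _ x v S hS hn => ?_
    have : S.card ≤ n := (Finset.card_le_univ S).trans (by simp)
    omega
  bot p n hp := by
    refine bot_unique fun α hα => ?_
    rw [Submodule.mem_bot]
    apply Subtype.ext; funext x
    ext v
    exact hα x v ∅ (by simp) (by simpa using hp)

end LieAlgebroid

namespace LieAlgebroid

/-! ### Curvature of splittings and the extension class -/

section Extension

variable {E : Type*} [NormedAddCommGroup E] [NormedSpace ℝ E] [FiniteDimensional ℝ E]
  {M : Type*} [TopologicalSpace M] [ChartedSpace E M] [IsManifold 𝓘(ℝ, E) ∞ M]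
  [T2Space M] [SigmaCompactSpace M]
  {F : Type*} [NormedAddCommGroup F] [NormedSpace ℝ F] [FiniteDimensional ℝ F]
  {A : M → Type*} [TopologicalSpace (TotalSpace F A)] [∀ x, TopologicalSpace (A x)]
  [∀ x, AddCommGroup (A x)] [∀ x, Module ℝ (A x)]
  [∀ x, IsTopologicalAddGroup (A x)] [∀ x, ContinuousSMul ℝ (A x)]
  [FiberBundle F A] [VectorBundle ℝ F A] [ContMDiffVectorBundle ∞ F A 𝓘(ℝ, E)]
  {𝒜 : LieAlgebroid E F A} [𝒜.IsRegular] [𝒜.HasAbelianIsotropy]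

theorem Splitting.inclK_connK_nabla (σ : 𝒜.Splitting) (Y : 𝒜.sectionsTF.carrier)
    (V : 𝒜.sectionsK.carrier) :
    𝒜.inclK (𝒜.connK.nabla Y V) = 𝒜.bracket (σ.onSec Y) (𝒜.inclK V) :=
  𝒜.inclK_nablaK (σ.anchorTF_onSec Y) V

theorem bracket_skew (𝒜 : LieAlgebroid E F A) (X Y : (smoothSections E F A).carrier) :
    𝒜.bracket X Y = -𝒜.bracket Y X := by
  have h := 𝒜.bracket_self (X + Y)
  simp only [map_add, LinearMap.add_apply, 𝒜.bracket_self, zero_add, add_zero] at h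
  exact eq_neg_of_add_eq_zero_right h

/-- The left-hand side is dγ written out on three sections. The double brackets in A cancel by one
Jacobi identity, those in T𝓕 by the other, and the mixed terms in pairs by skew-symmetry. -/
theorem bianchi_sum {L L' : Type*} [AddCommGroup L] (B : L → L → L) (b : L' → L' → L') (s : L' → L)
    (hB : ∀ X Y, B X Y = -B Y X) (hb : ∀ Y Z, s (b Y Z) = -s (b Z Y)) (x y z : L')
    (hJ : B (s x) (B (s y) (s z)) = B (B (s x) (s y)) (s z) + B (s y) (B (s x) (s z)))
    (hJ' : s (b x (b y z)) = s (b (b x y) z) + s (b y (b x z))) :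
    (1 : ℤ) • (B (s x) (B (s y) (s z)) - B (s x) (s (b y z))) +
      (-1 : ℤ) • (B (s y) (B (s x) (s z)) - B (s y) (s (b x z))) +
      (1 : ℤ) • (B (s z) (B (s x) (s y)) - B (s z) (s (b x y))) +
      ((-1 : ℤ) • (B (s (b x y)) (s z) - s (b (b x y) z)) +
        (1 : ℤ) • (B (s (b x z)) (s y) - s (b (b x z) y)) +
        (-1 : ℤ) • (B (s (b y z)) (s x) - s (b (b y z) x))) = 0 := by
  rw [hJ, hB (s z) (B (s x) (s y)), hB (s z) (s (b x y)), hB (s y) (s (b x z)),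
    hB (s x) (s (b y z)), hb (b x z) y, hb (b y z) x, hJ']
  simp only [one_smul, neg_smul]
  abel

/-- The Bianchi identity. -/
theorem Splitting.dK_curvature (σ : 𝒜.Splitting) : 𝒜.dK 2 σ.curvature = 0 := by
  apply onSections_injective
  rw [dK, onSections_dForm]
  ext1 X
  apply 𝒜.inclK_injective
  have h1 : Finset.Ici (0 : Fin 2) = {0, 1} := by decide
  have h2 : Finset.Ici (1 : Fin 2) = {1} := by decide
  have hJ := 𝒜.jacobi (σ.onSec (X 0)) (σ.onSec (X 1)) (σ.onSec (X 2))
  have hJ' : σ.onSec (𝒜.bracketTF.bracket (X 0) (𝒜.bracketTF.bracket (X 1) (X 2))) =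
      σ.onSec (𝒜.bracketTF.bracket (𝒜.bracketTF.bracket (X 0) (X 1)) (X 2)) +
        σ.onSec (𝒜.bracketTF.bracket (X 1) (𝒜.bracketTF.bracket (X 0) (X 2))) := by
    rw [𝒜.bracketTF_jacobi (X 0) (X 1) (X 2)]
    exact map_add σ.onSec _ _
  have hs : ∀ Y Z, 𝒜.bracketTF.bracket Y Z = -𝒜.bracketTF.bracket Z Y := fun Y Z => by
    rw [← σ.anchorTF_onSec Y, ← σ.anchorTF_onSec Z, bracketTF_anchorTF, bracketTF_anchorTF,
      bracket_skew, map_neg]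
  rw [koszul_apply_succ, Fin.sum_univ_three, Fin.sum_univ_two, h1, h2,
    Finset.sum_pair (by decide), Finset.sum_singleton]
  simp only [map_add, map_zsmul, σ.inclK_connK_nabla, σ.onSections_curvature, map_sub]
  change (1 : ℤ) • (𝒜.bracket (σ.onSec (X 0)) (𝒜.bracket (σ.onSec (X 1)) (σ.onSec (X 2))) -
      𝒜.bracket (σ.onSec (X 0)) (σ.onSec (𝒜.bracketTF.bracket (X 1) (X 2)))) +
    (-1 : ℤ) • (𝒜.bracket (σ.onSec (X 1)) (𝒜.bracket (σ.onSec (X 0)) (σ.onSec (X 2))) -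
      𝒜.bracket (σ.onSec (X 1)) (σ.onSec (𝒜.bracketTF.bracket (X 0) (X 2)))) +
    (1 : ℤ) • (𝒜.bracket (σ.onSec (X 2)) (𝒜.bracket (σ.onSec (X 0)) (σ.onSec (X 1))) -
      𝒜.bracket (σ.onSec (X 2)) (σ.onSec (𝒜.bracketTF.bracket (X 0) (X 1)))) +
    ((-1 : ℤ) • (𝒜.bracket (σ.onSec (𝒜.bracketTF.bracket (X 0) (X 1))) (σ.onSec (X 2)) -
        σ.onSec (𝒜.bracketTF.bracket (𝒜.bracketTF.bracket (X 0) (X 1)) (X 2))) +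
      (1 : ℤ) • (𝒜.bracket (σ.onSec (𝒜.bracketTF.bracket (X 0) (X 2))) (σ.onSec (X 1)) -
        σ.onSec (𝒜.bracketTF.bracket (𝒜.bracketTF.bracket (X 0) (X 2)) (X 1))) +
      (-1 : ℤ) • (𝒜.bracket (σ.onSec (𝒜.bracketTF.bracket (X 1) (X 2))) (σ.onSec (X 0)) -
        σ.onSec (𝒜.bracketTF.bracket (𝒜.bracketTF.bracket (X 1) (X 2)) (X 0)))) = 0
  have hn : ∀ Y Z, σ.onSec (𝒜.bracketTF.bracket Y Z) = -σ.onSec (𝒜.bracketTF.bracket Z Y) :=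
    fun Y Z => (congrArg σ.onSec (hs Y Z)).trans (map_neg σ.onSec _)
  exact bianchi_sum (fun X Y => 𝒜.bracket X Y) (fun Y Z => 𝒜.bracketTF.bracket Y Z) σ.onSec
    𝒜.bracket_skew hn (X 0) (X 1) (X 2) hJ hJ'

/-- A splitting which differs from `σ` by a form `κ` has curvature `γ_σ + d κ`. -/
theorem Splitting.curvature_eq_add_dK (σ σ' : 𝒜.Splitting) (κ : 𝒜.KForm 1)
    (h : ∀ Y : 𝒜.sectionsTF.carrier,
      σ'.onSec Y = σ.onSec Y + 𝒜.inclK (onSections κ fun _ => Y)) :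
    σ'.curvature = σ.curvature + 𝒜.dK 1 κ := by
  apply onSections_injective
  rw [onSections_add, dK, onSections_dForm]
  ext1 Y
  apply 𝒜.inclK_injective
  have h1 : Finset.Ici (0 : Fin 1) = {0} := by decide
  -- This kills the term [κ(Y₀), κ(Y₁)], the only one quadratic in κ; it is the reason why the
  -- curvature changes by an exact form.
  have h0 : ∀ V W, 𝒜.bracket (𝒜.inclK V) (𝒜.inclK W) = 0 := fun V W =>
    HasAbelianIsotropy.bracket_eq_zero _ _ (fun x => (V.1 x).2) fun x => (W.1 x).2
  have hκ : ∀ Z : Fin 1 → 𝒜.sectionsTF.carrier, onSections κ Z = onSections κ fun _ => Z 0 :=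
    fun Z => congrArg _ (funext fun i => by rw [Subsingleton.elim i 0])
  rw [AlternatingMap.add_apply, koszul_apply_succ, Fin.sum_univ_two, Fin.sum_univ_one, h1,
    Finset.sum_singleton]
  simp only [map_add, map_zsmul, σ.inclK_connK_nabla, onSections_curvature, h,
    LinearMap.add_apply, h0]
  rw [hκ (Fin.removeNth 0 Y), hκ (Fin.removeNth 1 Y), hκ (Matrix.vecCons _ _)]
  change 𝒜.bracket (σ.onSec (Y 0)) (σ.onSec (Y 1)) +
      𝒜.bracket (𝒜.inclK (onSections κ fun _ => Y 0)) (σ.onSec (Y 1)) +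
      (𝒜.bracket (σ.onSec (Y 0)) (𝒜.inclK (onSections κ fun _ => Y 1)) + 0) -
      (σ.onSec (𝒜.bracketTF.bracket (Y 0) (Y 1)) +
        𝒜.inclK (onSections κ fun _ => 𝒜.bracketTF.bracket (Y 0) (Y 1))) =
    𝒜.bracket (σ.onSec (Y 0)) (σ.onSec (Y 1)) - σ.onSec (𝒜.bracketTF.bracket (Y 0) (Y 1)) +
      ((1 : ℤ) • 𝒜.bracket (σ.onSec (Y 0)) (𝒜.inclK (onSections κ fun _ => Y 1)) +
        (-1 : ℤ) • 𝒜.bracket (σ.onSec (Y 1)) (𝒜.inclK (onSections κ fun _ => Y 0)) +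
        (-1 : ℤ) • 𝒜.inclK (onSections κ fun _ => 𝒜.bracketTF.bracket (Y 0) (Y 1)))
  rw [𝒜.bracket_skew (𝒜.inclK _) (σ.onSec (Y 1))]
  simp only [one_smul, neg_smul]
  abel

/-- The splitting which differs from `σ` by the form `κ`. -/
def Splitting.addForm (σ : 𝒜.Splitting) (κ : 𝒜.KForm 1) : 𝒜.Splitting where
  toFun x := σ.toFun x + (𝒜.K x).subtype ∘ₗ
    (AlternatingMap.ofSubsingleton ℝ (𝒜.TF x) (𝒜.K x) (0 : Fin 1)).symm (κ.1 x)
  smooth Y := (smoothSections E F A).carrier.add_mem (σ.smooth Y) (κ.2 fun _ => Y)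
  anchor_apply x y := by
    rw [LinearMap.add_apply, map_add, σ.anchor_apply]
    exact add_eq_left.2 ((AlternatingMap.ofSubsingleton ℝ (𝒜.TF x) (𝒜.K x) (0 : Fin 1)).symm
      (κ.1 x) y).2

theorem Splitting.curvature_addForm (σ : 𝒜.Splitting) (κ : 𝒜.KForm 1) :
    (σ.addForm κ).curvature = σ.curvature + 𝒜.dK 1 κ :=
  σ.curvature_eq_add_dK _ κ fun _ => rfl

/-- The difference of two splittings. -/
def Splitting.difference (σ' σ : 𝒜.Splitting) : 𝒜.KForm 1 :=
  ⟨fun x => AlternatingMap.ofSubsingleton ℝ (𝒜.TF x) (𝒜.K x) (0 : Fin 1)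
    ((σ'.toFun x - σ.toFun x).codRestrict (𝒜.K x) fun y => by
      change 𝒜.anchor x (σ'.toFun x y - σ.toFun x y) = 0
      rw [map_sub, σ'.anchor_apply, σ.anchor_apply, sub_self]), fun Y =>
    (smoothSections E F A).carrier.sub_mem (σ'.smooth (Y 0)) (σ.smooth (Y 0))⟩

theorem Splitting.curvature_eq_add_dK_difference (σ σ' : 𝒜.Splitting) :
    σ'.curvature = σ.curvature + 𝒜.dK 1 (σ'.difference σ) :=
  σ.curvature_eq_add_dK σ' _ fun Y => by
    apply Subtype.ext; funext x
    exact (add_sub_cancel (σ.toFun x (Y.1 x)) (σ'.toFun x (Y.1 x))).symm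

/-- The classes of the curvatures of any two splittings agree. -/
theorem Splitting.cohClass_curvature (σ σ' : 𝒜.Splitting) :
    cohClass 𝒜.dK σ'.curvature σ'.dK_curvature = cohClass 𝒜.dK σ.curvature σ.dK_curvature := by
  rw [cohClass_eq_iff, σ.curvature_eq_add_dK_difference σ', add_sub_cancel_left]
  exact LinearMap.mem_range_self _ _

/-- Every representative of the extension class is the curvature of a splitting. -/
theorem Splitting.exists_curvature_eq (σ : 𝒜.Splitting) {γ : 𝒜.KForm 2} (hγ : 𝒜.dK 2 γ = 0)
    (h : cohClass 𝒜.dK γ hγ = cohClass 𝒜.dK σ.curvature σ.dK_curvature) :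
    ∃ σ' : 𝒜.Splitting, σ'.curvature = γ := by
  rw [cohClass_eq_iff] at h
  obtain ⟨κ, hκ⟩ := h
  exact ⟨σ.addForm κ, by rw [curvature_addForm, hκ, add_sub_cancel]⟩

/-- The isomorphism of `Ωⁿ(A)` with the total space attached to a splitting. -/
def Splitting.componentsEquiv (σ : 𝒜.Splitting) (n : ℕ) : 𝒜.Form n ≃ₗ[ℝ] 𝒜.Total n :=
  LinearEquiv.ofBijective (σ.components n) (σ.components_bijective n)

theorem Splitting.componentsEquiv_dA (σ : 𝒜.Splitting) (n : ℕ) (α : 𝒜.Form n) :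
    σ.componentsEquiv (n + 1) (𝒜.dA n α) = 𝒜.totalD σ.curvature n (σ.componentsEquiv n α) :=
  funext fun pq => σ.component_dA α pq.1.1 pq.1.2 pq.2

/-- The isomorphism with the de Rham complex transports d_A² = 0 to the total differential. -/
theorem Splitting.totalD_totalD (σ : 𝒜.Splitting) (n : ℕ) (τ : 𝒜.Total n) :
    𝒜.totalD σ.curvature (n + 1) (𝒜.totalD σ.curvature n τ) = 0 := by
  obtain ⟨α, rfl⟩ := (σ.componentsEquiv n).surjective τ
  rw [← componentsEquiv_dA, ← componentsEquiv_dA, dA_dA, map_zero]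

end Extension

/-! ### The second page and its differential -/

section SecondPage

variable {E : Type*} [NormedAddCommGroup E] [NormedSpace ℝ E] [FiniteDimensional ℝ E]
  {M : Type*} [TopologicalSpace M] [ChartedSpace E M] [IsManifold 𝓘(ℝ, E) ∞ M]
  [T2Space M] [SigmaCompactSpace M]
  {F : Type*} [NormedAddCommGroup F] [NormedSpace ℝ F] [FiniteDimensional ℝ F]
  {A : M → Type*} [TopologicalSpace (TotalSpace F A)] [∀ x, TopologicalSpace (A x)]
  [∀ x, AddCommGroup (A x)] [∀ x, Module ℝ (A x)]
  [∀ x, IsTopologicalAddGroup (A x)] [∀ x, ContinuousSMul ℝ (A x)]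
  [FiberBundle F A] [VectorBundle ℝ F A] [ContMDiffVectorBundle ∞ F A 𝓘(ℝ, E)]
  {𝒜 : LieAlgebroid E F A} [𝒜.IsRegular] [𝒜.HasAbelianIsotropy]

theorem Splitting.extend_mem_filtration (σ : 𝒜.Splitting) {p q n : ℕ} (h : p + q = n)
    (β : 𝒜.BiForm p q) : σ.extend h β ∈ 𝒜.filtration p n :=
  σ.mem_filtration_iff.2 fun _ _ h' hp => σ.component_extend_of_ne h h' (by omega) β

/-- The leading component of the differential of a form in `F^p`. -/
theorem Splitting.component_succ_dA (σ : 𝒜.Splitting) {p q n : ℕ} (h : p + q = n)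
    (h' : p + 1 + q = n + 1) {α : 𝒜.Form n} (hα : α ∈ 𝒜.filtration p n) :
    σ.component h' (𝒜.dA n α) = 𝒜.dF q p (σ.component h α) := by
  rw [component_dA]
  match p, h, h', hα with
  | 0, h, h', hα => rfl
  | p + 1, h, h', hα =>
    change 𝒜.dF q (p + 1) (σ.component h α) +
      (-1 : ℝ) ^ p • 𝒜.iGamma σ.curvature p q (σ.component (by omega : p + (q + 1) = n) α) = _
    -- The contribution of i_γ comes from the component of T𝓕-degree p, which vanishes since the
    -- form is in F^(p+1).
    rw [σ.mem_filtration_iff.1 hα p (q + 1) (by omega) (by push_cast; omega), map_zero, smul_zero,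
      add_zero]

/-- For α in Z_2^p the form d_A α lies in F^(p+2), so its component of degree p + 1, which is d_𝓕 of
the leading component, is zero. -/
theorem Splitting.dF_component (σ : 𝒜.Splitting) {p q n : ℕ} (h : p + q = n) {α : 𝒜.Form n}
    (hα : α ∈ approxCocycles 𝒜.dA 𝒜.filtration 2 p n) : 𝒜.dF q p (σ.component h α) = 0 := by
  rw [← σ.component_succ_dA h (by omega) hα.1]
  exact σ.mem_filtration_iff.1 hα.2 _ _ _ (by push_cast; omega)

/-- The extension by zero of a d_𝓕-closed β has a differential that comes from i_γ β alone, and this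
has T𝓕-degree p + 2. -/
theorem Splitting.extend_mem_approxCocycles (σ : 𝒜.Splitting) {p q n : ℕ} (h : p + q = n)
    {β : 𝒜.BiForm p q} (hβ : 𝒜.dF q p β = 0) :
    σ.extend h β ∈ approxCocycles 𝒜.dA 𝒜.filtration 2 p n := by
  have key : ∀ (p' q' : ℕ) (h' : p' + q' = n),
      𝒜.dF q' p' (σ.component h' (σ.extend h β)) = 0 := by
    intro p' q' h'
    rcases eq_or_ne p' p with rfl | hp
    · obtain rfl : q' = q := by omega
      rw [component_extend, hβ]
    · rw [σ.component_extend_of_ne h h' hp, map_zero]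
  refine ⟨σ.extend_mem_filtration h β, σ.mem_filtration_iff.2 fun p' q' h' hp => ?_⟩
  rw [component_dA]
  match p', h' with
  | 0, h' => rfl
  | 1, h' => exact key _ _ _
  | p' + 2, h' =>
    refine (congrArg₂ (· + ·) (key (p' + 1) q' (by omega))
      (congrArg (fun η => (-1 : ℝ) ^ p' • 𝒜.iGamma σ.curvature p' q' η)
        (σ.component_extend_of_ne h (by omega : p' + (q' + 1) = n)
          (by push_cast at hp; omega) β))).trans ?_
    simp only [map_zero, smul_zero, add_zero]

/-- This is the origin of the formula for d₂: the extension of β has no component of degree p + 1,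
so only the insertion of γ into β contributes. -/
theorem Splitting.component_dA_extend (σ : 𝒜.Splitting) {p q n : ℕ} (h : p + (q + 1) = n)
    (h' : p + 2 + q = n + 1) (β : 𝒜.BiForm p (q + 1)) :
    σ.component h' (𝒜.dA n (σ.extend h β)) = (-1 : ℝ) ^ p • 𝒜.iGamma σ.curvature p q β := by
  rw [component_dA]
  change 𝒜.dF q (p + 1) (σ.component (by omega : p + 1 + q = n) (σ.extend h β)) +
    (-1 : ℝ) ^ p • 𝒜.iGamma σ.curvature p q (σ.component h (σ.extend h β)) = _
  rw [component_extend, σ.component_extend_of_ne h _ (by omega), map_zero, zero_add]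

/-- The denominator of E_2^{p,q} is what the leading component sends to exact forms: an element of
F^(p+1) has leading component zero, and d_A w, for w in F^(p-1), has leading component d_𝓕 of that
of w. Conversely an exact leading component is removed by subtracting such a d_A w. -/
theorem Splitting.component_mem_coboundaries_iff (σ : 𝒜.Splitting) {p q n : ℕ} (h : p + q = n)
    {α : 𝒜.Form n} (hα : α ∈ approxCocycles 𝒜.dA 𝒜.filtration 2 p n) :
    α ∈ approxCocycles 𝒜.dA 𝒜.filtration (2 - 1) (p + 1) n ⊔
        approxCoboundaries 𝒜.dA 𝒜.filtration 2 p n ↔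
      σ.component h α ∈ coboundaries (𝒜.dF q) p := by
  constructor
  · intro hmem
    obtain ⟨z, hz, c, hc, rfl⟩ := Submodule.mem_sup.1 hmem
    rw [map_add, σ.mem_filtration_iff.1 hz.1 p q h (by omega), zero_add]
    clear hα hmem
    match n, h, c, hc with
    | 0, h, c, hc =>
      obtain rfl : c = 0 := hc
      rw [map_zero]
      exact Submodule.zero_mem _
    | n + 1, h, _, hc =>
      obtain ⟨w, hw, rfl⟩ := hc
      match p, h, hw with
      | 0, h, hw =>
        rw [component_dA]
        exact Submodule.zero_mem _
      | p + 1, h, hw =>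
        rw [σ.component_succ_dA (by omega : p + q = n) h
          (by have := hw.1; rwa [show ((p + 1 : ℕ) : ℤ) - 2 + 1 = p by push_cast; ring] at this)]
        exact LinearMap.mem_range_self _ _
  · intro hmem
    -- It suffices to find an approximate coboundary `c` with the same leading component as α. Then
    -- α - c lies in F^(p+1), and its differential d_A α lies in F^(p+2), so α - c is in Z_1^(p+1).
    have hsub : ∀ c : 𝒜.Form n, c ∈ approxCoboundaries 𝒜.dA 𝒜.filtration 2 p n →
        𝒜.dA n c = 0 → c ∈ 𝒜.filtration p n → σ.component h α = σ.component h c →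
        α ∈ approxCocycles 𝒜.dA 𝒜.filtration (2 - 1) (p + 1) n ⊔
          approxCoboundaries 𝒜.dA 𝒜.filtration 2 p n := by
      intro c hc hdc hcF heq
      refine Submodule.mem_sup.2 ⟨α - c, ⟨σ.mem_filtration_iff.2 fun p' q' h' hp => ?_, ?_⟩, c, hc,
        sub_add_cancel _ _⟩
      · rcases eq_or_ne p' p with rfl | hne
        · obtain rfl : q' = q := by omega
          rw [map_sub, heq, sub_self]
        · exact σ.mem_filtration_iff.1 (sub_mem hα.1 hcF) p' q' h' (by omega)
      · change 𝒜.dA n (α - c) ∈ 𝒜.filtration _ _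
        rw [map_sub, hdc, sub_zero]
        have := hα.2
        rwa [show (p : ℤ) + 1 + (2 - 1) = p + 2 by ring]
    match p, h, hα, hmem, hsub with
    | 0, h, hα, hmem, hsub =>
      -- In degree p = 0 the only coboundary is zero, so the leading component itself vanishes.
      refine hsub 0 (Submodule.zero_mem _) (map_zero _) (Submodule.zero_mem _) ?_
      rw [map_zero]
      exact hmem
    | p + 1, h, hα, hmem, hsub =>
      obtain ⟨η, hη⟩ := hmem
      obtain ⟨n, rfl⟩ : ∃ m, n = m + 1 := ⟨n - 1, by omega⟩
      have hn : p + q = n := by omega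
      -- When the leading component is d_𝓕 η, the form to subtract is d_A of the extension of η by
      -- zero.
      have hw := σ.extend_mem_filtration hn η
      have hdw : 𝒜.dA n (σ.extend hn η) ∈ 𝒜.filtration (p + 1 : ℕ) (n + 1) := by
        refine σ.mem_filtration_iff.2 fun p' q' h' hp => ?_
        rcases eq_or_ne p' 0 with rfl | h0
        · rw [component_dA]
          rfl
        obtain ⟨m, rfl⟩ : ∃ m, p' = m + 1 := ⟨p' - 1, by omega⟩
        have hm := (filtration_isFirstQuadrant 𝒜).mono (by omega : (m : ℤ) ≤ p) n hw
        rw [σ.component_succ_dA (by omega : m + q' = n) h' hm,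
          σ.component_extend_of_ne hn _ (by omega), map_zero]
      refine hsub (𝒜.dA n (σ.extend hn η)) (mem_approxCoboundaries.2 ⟨_, ⟨?_, ?_⟩, rfl⟩)
        (𝒜.dA_dA _ _) hdw ?_
      · rwa [show ((p + 1 : ℕ) : ℤ) - 2 + 1 = p by push_cast; ring]
      · change 𝒜.dA n _ ∈ 𝒜.filtration _ _
        rwa [show ((p + 1 : ℕ) : ℤ) - 2 + 1 + (2 - 1) = (p + 1 : ℕ) by ring]
      · rw [σ.component_succ_dA hn h hw, component_extend, hη]

/-- The map from `Z_2^{p,q}` to the foliated cohomology. -/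
def Splitting.componentClass (σ : 𝒜.Splitting) {p q n : ℕ} (h : p + q = n) :
    approxCocycles 𝒜.dA 𝒜.filtration 2 p n →ₗ[ℝ] 𝒜.HF p q :=
  cohProj (𝒜.dF q) p ∘ₗ (σ.component h ∘ₗ Submodule.subtype _).codRestrict
    (LinearMap.ker (𝒜.dF q p)) fun α => σ.dF_component h α.2

theorem Splitting.componentClass_apply (σ : 𝒜.Splitting) {p q n : ℕ} (h : p + q = n)
    (α : approxCocycles 𝒜.dA 𝒜.filtration 2 p n) :
    σ.componentClass h α =
      cohClass (𝒜.dF q) (σ.component h α) (σ.dF_component h α.2) := rfl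

theorem Splitting.componentClass_surjective (σ : 𝒜.Splitting) {p q n : ℕ} (h : p + q = n) :
    Function.Surjective (σ.componentClass h : _ → 𝒜.HF p q) := by
  intro x
  obtain ⟨β, hβ, rfl⟩ := cohClass_surjective x
  refine ⟨⟨_, σ.extend_mem_approxCocycles h hβ⟩, ?_⟩
  rw [componentClass_apply]
  congr 1
  exact σ.component_extend h β

/-- The identification of the second page with the foliated cohomology. -/
def Splitting.secondPageEquiv (σ : 𝒜.Splitting)
    (S : FiltrationSpectralSequence 𝒜.dA 𝒜.filtration) (p q : ℕ) :
    (S.E.page 2 le_rfl).X (p, q) ≃ₗ[ℝ] 𝒜.HF p q :=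
  equivOfSurjective (A := approxCocycles 𝒜.dA 𝒜.filtration 2 p (p + q))
    (S.proj 2 le_rfl rfl) (S.proj_surjective 2 le_rfl rfl)
    (σ.componentClass rfl) (σ.componentClass_surjective rfl) fun α => by
      rw [S.proj_eq_zero_iff, componentClass_apply, cohClass_eq_zero_iff,
        σ.component_mem_coboundaries_iff rfl α.2]

/-- The isomorphism is built from σ but computed by any σ', because on F^p the leading components
for the two splittings coincide. -/
theorem Splitting.secondPageEquiv_proj (σ σ' : 𝒜.Splitting)
    (S : FiltrationSpectralSequence 𝒜.dA 𝒜.filtration) {p q n : ℕ} (h : p + q = n)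
    (α : approxCocycles 𝒜.dA 𝒜.filtration 2 p n) :
    σ.secondPageEquiv S p q (S.proj 2 le_rfl h α) =
      cohClass (𝒜.dF q) (σ'.component h α) (σ'.dF_component h α.2) := by
  subst h
  rw [secondPageEquiv, equivOfSurjective_apply, componentClass_apply]
  congr 1
  exact σ.component_eq_of_mem σ' rfl α.2.1

/-- The differential of the second page. -/
theorem Splitting.secondPageEquiv_d (σ σ' : 𝒜.Splitting)
    (S : FiltrationSpectralSequence 𝒜.dA 𝒜.filtration) (p q : ℕ) (β : 𝒜.BiForm p (q + 1))
    (hβ : 𝒜.dF (q + 1) p β = 0) :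
    ∃ h : 𝒜.dF q (p + 2) ((-1 : ℝ) ^ p • 𝒜.iGamma σ'.curvature p q β) = 0,
      ∀ x : (S.E.page 2 le_rfl).X (p, q + 1),
        σ.secondPageEquiv S p (q + 1) x = cohClass (𝒜.dF (q + 1)) β hβ →
        σ.secondPageEquiv S (p + 2) q (((S.E.page 2 le_rfl).d (p, q + 1) (p + 2, q)).hom x) =
          cohClass (𝒜.dF q) ((-1 : ℝ) ^ p • 𝒜.iGamma σ'.curvature p q β) h := by
  have h' : p + 2 + q = p + (q + 1) + 1 := by omega
  -- The extension of β by zero along σ' represents the class of β, and d₂ of it is the class of its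
  -- differential `b`, with leading component (-1)^p i_γ β for the curvature γ of σ'.
  let α : approxCocycles 𝒜.dA 𝒜.filtration 2 p (p + (q + 1)) :=
    ⟨_, σ'.extend_mem_approxCocycles rfl hβ⟩
  let b : approxCocycles 𝒜.dA 𝒜.filtration 2 (p + 2 : ℕ) (p + (q + 1) + 1) :=
    ⟨𝒜.dA _ α, (filtration_isFirstQuadrant 𝒜).d_mem_approxCocycles α.2 (by push_cast; rfl)⟩
  have hb : σ'.component h' b = (-1 : ℝ) ^ p • 𝒜.iGamma σ'.curvature p q β :=
    σ'.component_dA_extend rfl h' β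
  refine ⟨hb ▸ σ'.dF_component h' b.2, fun x hx => ?_⟩
  have hxα : x = S.proj 2 le_rfl rfl α := by
    apply (σ.secondPageEquiv S p (q + 1)).injective
    rw [hx, σ.secondPageEquiv_proj σ']
    congr 1
    exact (σ'.component_extend rfl β).symm
  rw [hxα, S.d_proj 2 le_rfl rfl h' (by push_cast; rfl) α b rfl, σ.secondPageEquiv_proj σ']
  congr 1

end SecondPage

/-! ### Pullback of forms along morphisms of Lie algebroids -/

section Naturality

variable {E : Type*} [NormedAddCommGroup E] [NormedSpace ℝ E] [FiniteDimensional ℝ E]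
  {M : Type*} [TopologicalSpace M] [ChartedSpace E M] [IsManifold 𝓘(ℝ, E) ∞ M]
  [T2Space M] [SigmaCompactSpace M]
  {F : Type*} [NormedAddCommGroup F] [NormedSpace ℝ F] [FiniteDimensional ℝ F]
  {A : M → Type*} [TopologicalSpace (TotalSpace F A)] [∀ x, TopologicalSpace (A x)]
  [∀ x, AddCommGroup (A x)] [∀ x, Module ℝ (A x)]
  [∀ x, IsTopologicalAddGroup (A x)] [∀ x, ContinuousSMul ℝ (A x)]
  [FiberBundle F A] [VectorBundle ℝ F A] [ContMDiffVectorBundle ∞ F A 𝓘(ℝ, E)]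
  {F' : Type*} [NormedAddCommGroup F'] [NormedSpace ℝ F'] [FiniteDimensional ℝ F']
  {A' : M → Type*} [TopologicalSpace (TotalSpace F' A')] [∀ x, TopologicalSpace (A' x)]
  [∀ x, AddCommGroup (A' x)] [∀ x, Module ℝ (A' x)]
  [∀ x, IsTopologicalAddGroup (A' x)] [∀ x, ContinuousSMul ℝ (A' x)]
  [FiberBundle F' A'] [VectorBundle ℝ F' A'] [ContMDiffVectorBundle ∞ F' A' 𝓘(ℝ, E)]
  {𝒜 : LieAlgebroid E F A} {ℬ : LieAlgebroid E F' A'}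

/-- A morphism of Lie algebroids as a map of sections. -/
def Hom.onSec (φ : 𝒜.Hom ℬ) :
    (smoothSections E F A).carrier →ₗ[ℝ] (smoothSections E F' A').carrier where
  toFun X := ⟨fun x => φ.toFun x (X.1 x), φ.smooth X⟩
  map_add' X Y := by
    apply Subtype.ext; funext x
    exact map_add (φ.toFun x) _ _
  map_smul' c X := by
    apply Subtype.ext; funext x
    exact map_smul (φ.toFun x) _ _

theorem Hom.onSections_pullback (φ : 𝒜.Hom ℬ) {n : ℕ} (β : ℬ.Form n) :
    onSections (φ.pullback n β) = LinearMap.id.compAlternatingMap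
      ((onSections β).compLinearMap φ.onSec) := rfl

theorem Hom.pullback_dA (φ : 𝒜.Hom ℬ) (n : ℕ) (β : ℬ.Form n) :
    φ.pullback (n + 1) (ℬ.dA n β) = 𝒜.dA n (φ.pullback n β) := by
  apply onSections_injective
  rw [dA, dA, onSections_dForm, φ.onSections_pullback, φ.onSections_pullback, onSections_dForm,
    koszul_eq_ce, koszul_eq_ce]
  refine (ce_map _ _ _ _ _ _ _ _ (fun X Y => ?_) (fun X s => ?_) _).symm
  · apply Subtype.ext; funext x
    exact φ.bracket_apply X Y x
  · apply Subtype.ext; funext x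
    exact congrArg (mvfderiv 𝓘(ℝ, E) s.1 x) (φ.anchor_apply x (X.1 x))

/-- Compatibility with the anchors makes φ map the kernel of one anchor to the kernel of the other,
so arguments in K stay in K. -/
theorem Hom.pullback_mem_filtration (φ : 𝒜.Hom ℬ) (p : ℤ) (n : ℕ) (β : ℬ.Form n)
    (hβ : β ∈ ℬ.filtration p n) : φ.pullback n β ∈ 𝒜.filtration p n :=
  fun x v S hS hn => hβ x (fun i => φ.toFun x (v i)) S
    (fun i hi => (φ.anchor_apply x (v i)).trans (hS i hi)) hn

end Naturality

end LieAlgebroid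
end LieAlgd

end

theorem proposition4p2
    {E : Type*} [NormedAddCommGroup E] [NormedSpace ℝ E] [FiniteDimensional ℝ E]
    {M : Type*} [TopologicalSpace M] [ChartedSpace E M] [IsManifold 𝓘(ℝ, E) ∞ M]
    [T2Space M] [SigmaCompactSpace M]
    {F : Type*} [NormedAddCommGroup F] [NormedSpace ℝ F] [FiniteDimensional ℝ F]
    {A : M → Type uA} [TopologicalSpace (TotalSpace F A)] [∀ x, TopologicalSpace (A x)]
    [∀ x, AddCommGroup (A x)] [∀ x, Module ℝ (A x)]
    [∀ x, IsTopologicalAddGroup (A x)] [∀ x, ContinuousSMul ℝ (A x)]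
    [FiberBundle F A] [VectorBundle ℝ F A] [ContMDiffVectorBundle ∞ F A 𝓘(ℝ, E)]
    (𝒜 : LieAlgd.LieAlgebroid E F A) [𝒜.IsRegular] [𝒜.HasAbelianIsotropy] :
    -- the differentials square to zero
    ((∀ n (α : 𝒜.Form n), 𝒜.dA (n + 1) (𝒜.dA n α) = 0) ∧
      (∀ p (κ : 𝒜.KForm p), 𝒜.dK (p + 1) (𝒜.dK p κ) = 0) ∧
      (∀ p q (β : 𝒜.BiForm p q), 𝒜.dF q (p + 1) (𝒜.dF q p β) = 0) ∧
      ∀ (σ : 𝒜.Splitting) n (τ : 𝒜.Total n),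
        𝒜.totalD σ.curvature (n + 1) (𝒜.totalD σ.curvature n τ) = 0) ∧
    -- a splitting identifies the de Rham complex of `A` with the total complex
    (∀ σ : 𝒜.Splitting, ∃ Φ : ∀ n, 𝒜.Form n ≃ₗ[ℝ] 𝒜.Total n,
      (∀ n (α : 𝒜.Form n) (pq : {pq : ℕ × ℕ // pq.1 + pq.2 = n}),
        Φ n α pq = σ.component pq.2 α) ∧
      ∀ n (α : 𝒜.Form n), Φ (n + 1) (𝒜.dA n α) = 𝒜.totalD σ.curvature n (Φ n α)) ∧
    -- splittings exist and their curvatures represent one class `c`, the extension class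
    Nonempty 𝒜.Splitting ∧
    ∃ c : 𝒜.HK 2,
      (∀ σ : 𝒜.Splitting, ∃ h : 𝒜.dK 2 σ.curvature = 0,
        LieAlgd.cohClass 𝒜.dK σ.curvature h = c) ∧
      -- the spectral sequence of the filtration, its second page, and its convergence to `H(A)`
      (∃ (S : LieAlgd.FiltrationSpectralSequence 𝒜.dA 𝒜.filtration)
        (e : ∀ p q : ℕ, (S.E.page 2 le_rfl).X (p, q) ≃ₗ[ℝ] 𝒜.HF p q),
        S.Converges ∧
        (∀ (σ : 𝒜.Splitting) (p q n : ℕ) (h : p + q = n)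
          (α : LieAlgd.approxCocycles 𝒜.dA 𝒜.filtration 2 p n),
          ∃ hα : 𝒜.dF q p (σ.component h α) = 0,
            e p q (S.proj 2 le_rfl h α) = LieAlgd.cohClass (𝒜.dF q) (σ.component h α) hα) ∧
        -- the differential of the second page
        ∀ (γ : 𝒜.KForm 2) (hγ : 𝒜.dK 2 γ = 0), LieAlgd.cohClass 𝒜.dK γ hγ = c →
          ∀ (p q : ℕ) (β : 𝒜.BiForm p (q + 1)) (hβ : 𝒜.dF (q + 1) p β = 0),
            ∃ h : 𝒜.dF q (p + 2) ((-1 : ℝ) ^ p • 𝒜.iGamma γ p q β) = 0,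
              ∀ x : (S.E.page 2 le_rfl).X (p, q + 1),
                e p (q + 1) x = LieAlgd.cohClass (𝒜.dF (q + 1)) β hβ →
                e (p + 2) q (((S.E.page 2 le_rfl).d (p, q + 1) (p + 2, q)).hom x) =
                  LieAlgd.cohClass (𝒜.dF q) ((-1 : ℝ) ^ p • 𝒜.iGamma γ p q β) h) ∧
      -- naturality of the spectral sequence
      ∀ {F' : Type*} [NormedAddCommGroup F'] [NormedSpace ℝ F'] [FiniteDimensional ℝ F']
        {A' : M → Type uA} [TopologicalSpace (TotalSpace F' A')] [∀ x, TopologicalSpace (A' x)]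
        [∀ x, AddCommGroup (A' x)] [∀ x, Module ℝ (A' x)]
        [∀ x, IsTopologicalAddGroup (A' x)] [∀ x, ContinuousSMul ℝ (A' x)]
        [FiberBundle F' A'] [VectorBundle ℝ F' A'] [ContMDiffVectorBundle ∞ F' A' 𝓘(ℝ, E)]
        (ℬ : LieAlgd.LieAlgebroid E F' A') [ℬ.IsRegular] [ℬ.HasAbelianIsotropy] (φ : 𝒜.Hom ℬ)
        (S : LieAlgd.FiltrationSpectralSequence 𝒜.dA 𝒜.filtration)
        (S' : LieAlgd.FiltrationSpectralSequence ℬ.dA ℬ.filtration),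
        ∃ Ψ : CategoryTheory.SpectralSequence.Hom S'.E S.E,
          ∀ (r : ℤ) (hr : 2 ≤ r) (p q n : ℕ) (h : p + q = n)
          (β : LieAlgd.approxCocycles ℬ.dA ℬ.filtration r p n),
          ∃ hβ : φ.pullback n β ∈ LieAlgd.approxCocycles 𝒜.dA 𝒜.filtration r p n,
            ((Ψ.hom r hr).f (p, q)).hom (S'.proj r hr h β) = S.proj r hr h ⟨_, hβ⟩ := by
  obtain ⟨σ₀⟩ := 𝒜.exists_splitting
  refine ⟨⟨𝒜.dA_dA, 𝒜.dK_dK, 𝒜.dF_dF, fun σ => σ.totalD_totalD⟩,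
    fun σ => ⟨σ.componentsEquiv, fun _ _ _ => rfl, σ.componentsEquiv_dA⟩, ⟨σ₀⟩,
    LieAlgd.cohClass 𝒜.dK σ₀.curvature σ₀.dK_curvature,
    fun σ => ⟨σ.dK_curvature, σ₀.cohClass_curvature σ⟩, ?_, ?_⟩
  · let S := LieAlgd.filtrationSpectralSequence 𝒜.filtration_isFirstQuadrant
    refine ⟨S, σ₀.secondPageEquiv S,
      LieAlgd.FiltrationSpectralSequence.converges 𝒜.filtration_isFirstQuadrant S,
      fun σ p q n h α => ⟨σ.dF_component h α.2, σ₀.secondPageEquiv_proj σ S h α⟩, ?_⟩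
    intro γ hγ hc p q β hβ
    -- Every closed representative of the extension class is the curvature of a splitting, which
    -- reduces the claim to curvatures; the isomorphism `e`, built from `σ₀`, can be computed with
    -- this other splitting.
    obtain ⟨σ, rfl⟩ := σ₀.exists_curvature_eq hγ hc
    exact σ₀.secondPageEquiv_d σ S p q β hβ
  · intro F' _ _ _ A' _ _ _ _ _ _ _ _ _ ℬ _ _ φ S S'
    obtain ⟨Ψ, hΨ⟩ := LieAlgd.FiltrationSpectralSequence.exists_hom ℬ.filtration_isFirstQuadrant
      φ.pullback φ.pullback_dA φ.pullback_mem_filtration S' S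
    exact ⟨Ψ, fun r hr p q n h β => ⟨(LieAlgd.approxCocyclesMap φ.pullback φ.pullback_dA
      φ.pullback_mem_filtration r p n β).2, hΨ r hr h β⟩⟩
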